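/- **Setting.** Let $U\subset\mathbb R^2$ be a nonempty, open, connected and simply connected set (a hole-free piece of paper). A *vertex-free, uniquely ruled curved crease–rule pattern* on $U$ consists of the following data. * Finitely many creases $\vec x_i:(0,\ell_i)\to U$, which are injective, $C^2$ and parameterized by arc length, have pairwise disjoint images, and whose two ends converge to points of $\partial U$. Let $\vec t_i=\vec x_i'$ be the tangent, $\hat n_i$ the left unit normal, and $\hat k_i=\vec t_i'\cdot\hat n_i$ the signed curvature; the creases are curved, i.e. $\hat k_i(s)\neq 0$ for all $s$. * For each crease $i$, each side $\sigma\in\{L,R\}$ and each $s\in(0,\ell_i)$, one rule segment. It is the open segment of some finite length $\lambda_{i,\sigma}(s)>0$ that starts at $\vec x_i(s)$ and leaves in direction $+\hat r_{i,L}(s)$ if $\sigma=L$ and $-\hat r_{i,R}(s)$ if $\sigma=R$. Here $\hat r_{i,\sigma}=\cos\hat\theta_{i,\sigma}\,\vec t_i+\sin\hat\theta_{i,\sigma}\,\hat n_i$, and the signed ruling angle $\hat\theta_{i,\sigma}:(0,\ell_i)\to(0,\pi)$ is $C^1$. The rule segments lie in $U$ minus the creases and cover this set. Two rule segments that share a point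 are the same set. The far end of each rule segment either lies on $\partial U$ or is a crease point $\vec x_j(u)$; in the latter case the segment is also the rule segment of $\vec x_j(u)$ on one of its two sides, and we say that it joins $(i,\sigma,s)$ to $(j,\tau,u)$, where $\tau$ is that side. The pattern *folds* if there is a continuous map $f:U\to\mathbb R^3$ (self-intersections are allowed) that is $C^2$ and isometric ($df$ preserves lengths) on $U$ minus the creases, agrees on either side of each crease point locally with a $C^2$ map defined near that point, maps every rule segment to a straight segment, and is not differentiable at any crease point (so that every crease is properly folded). **Theorem.** A vertex-free, uniquely ruled curved crease–rule pattern on a hole-free piece of paper folds if and only if there are differentiable functions $\rho_i:(0,\ell_i)\to(-\pi,\pi)\setminus\{0\}$, one for each crease (a fold-angle assignment), such that: 1. for every crease $i$ and every $s\in(0,\ell_i)$, $$\frac{\cot\hat\theta_{i,L}(s)+\cot\hat\theta_{i,R}(s)}{2}=\frac{1}{\hat k_i(s)}\,\frac{\rho_i'(s)}{2}\,\cot\frac{\rho_i(s)}{2};$$ 2. for every rule segment between two crease points the following compatibility equation holds. Whenever $s_1(t)$ and $s_2(t)$ are differentiable at $t_0$ and, for all $t$ near $t_0$, a rule segment joins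 $(i,\sigma,s_1(t))$ to $(j,\tau,s_2(t))$, then at $t=t_0$ $$\frac{ds_1}{dt}\,\frac{1}{\sin\hat\theta_{i,\sigma}(s_1)}\,\hat k_i(s_1)\tan\frac{\rho_i(s_1)}{2}=-\,\frac{ds_2}{dt}\,\frac{1}{\sin\hat\theta_{j,\tau}(s_2)}\,\hat k_j(s_2)\tan\frac{\rho_j(s_2)}{2}.$$ -/

import Mathlib

open Set Filter Topology

/-- The plane of the unfolded paper. -/
abbrev Plane : Type := EuclideanSpace ℝ (Fin 2)

/-- The space in which the paper is folded. -/
abbrev Space : Type := EuclideanSpace ℝ (Fin 3)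

/-- The two sides of an oriented crease. -/
inductive Side : Type
  | left
  | right

/-- Ruling vectors always point to the left of the crease; the rule segment on the left side
leaves the crease along the ruling vector, the one on the right side against it. -/
def Side.dir : Side → ℝ
  | Side.left => 1
  | Side.right => -1

/-- Rotation of the plane by a quarter turn to the left. -/
noncomputable def turnLeft (w : Plane) : Plane := !₂[-(w 1), w 0]

/-- A crease-rule pattern: an open piece of paper in the plane, creases that are `C²` simple arcs
in it, each parameterized by arc length on an open interval `(0, len i)`, and, for every point of
a crease and each of its two sides, one rule segment that starts there, given by its signed ruling
angle in `(0, π)`, a `C¹` function of arc length, and its length. -/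
structure CreaseRulePattern (ι : Type*) where
  paper : Set Plane
  isOpen_paper : IsOpen paper
  len : ι → ℝ
  len_pos : ∀ i, 0 < len i
  crease : ι → ℝ → Plane
  crease_contDiffOn : ∀ i, ContDiffOn ℝ 2 (crease i) (Ioo 0 (len i))
  crease_unit_speed : ∀ i, ∀ s ∈ Ioo 0 (len i), ‖deriv (crease i) s‖ = 1
  crease_injOn : ∀ i, InjOn (crease i) (Ioo 0 (len i))
  crease_mem_paper : ∀ i, ∀ s ∈ Ioo 0 (len i), crease i s ∈ paper
  angle : ι → Side → ℝ → ℝ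
  angle_contDiffOn : ∀ i σ, ContDiffOn ℝ 1 (angle i σ) (Ioo 0 (len i))
  angle_mem : ∀ i σ, ∀ s ∈ Ioo 0 (len i), angle i σ s ∈ Ioo 0 Real.pi
  ruleLen : ι → Side → ℝ → ℝ
  ruleLen_pos : ∀ i σ, ∀ s ∈ Ioo 0 (len i), 0 < ruleLen i σ s

namespace CreaseRulePattern

variable {ι : Type*} (P : CreaseRulePattern ι)

/-- The unit tangent vector of a crease in the plane. -/
noncomputable def tangent (i : ι) (s : ℝ) : Plane := deriv (P.crease i) s

/-- The unit normal vector pointing to the left of a crease. -/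
noncomputable def normal (i : ι) (s : ℝ) : Plane := turnLeft (P.tangent i s)

/-- The signed curvature of the unfolded crease, positive where the crease turns left. -/
noncomputable def curvature (i : ι) (s : ℝ) : ℝ :=
  inner ℝ (deriv (P.tangent i) s) (P.normal i s)

/-- The unit ruling vector, directed to the left of the crease, that makes the signed ruling
angle with the tangent. -/
noncomputable def ruleDir (i : ι) (σ : Side) (s : ℝ) : Plane :=
  Real.cos (P.angle i σ s) • P.tangent i s + Real.sin (P.angle i σ s) • P.normal i s

/-- The point at distance `v` from the crease point on the rule line of the given side. -/
noncomputable def rulePoint (i : ι) (σ : Side) (s v : ℝ) : Plane :=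
  P.crease i s + (σ.dir * v) • P.ruleDir i σ s

/-- The rule segment (without its end points) at a crease point, on the given side. -/
noncomputable def ruleSegment (i : ι) (σ : Side) (s : ℝ) : Set Plane :=
  P.rulePoint i σ s '' Ioo 0 (P.ruleLen i σ s)

/-- The end of the rule segment other than the crease point where it starts. -/
noncomputable def farEnd (i : ι) (σ : Side) (s : ℝ) : Plane :=
  P.rulePoint i σ s (P.ruleLen i σ s)

/-- The union of all creases; the components of the rest of the paper are the faces. -/
def creaseSet : Set Plane := ⋃ i, P.crease i '' Ioo 0 (P.len i)

/-- The rule segment on side `σ` of crease `i` at `s` and the one on side `τ` of crease `j` at `u`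
are one and the same segment, which joins the two crease points. -/
def Joins (i : ι) (σ : Side) (s : ℝ) (j : ι) (τ : Side) (u : ℝ) : Prop :=
  s ∈ Ioo 0 (P.len i) ∧ u ∈ Ioo 0 (P.len j) ∧
    P.farEnd i σ s = P.crease j u ∧ P.farEnd j τ u = P.crease i s

/-- All creases are curved. -/
def IsCurved : Prop := ∀ i, ∀ s ∈ Ioo 0 (P.len i), P.curvature i s ≠ 0

/-- There is no vertex in the interior of the paper: creases do not meet each other, and both ends
of every crease lie on the boundary of the paper. -/
structure IsVertexFree : Prop where
  disjoint : ∀ i j, i ≠ j →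
    Disjoint (P.crease i '' Ioo 0 (P.len i)) (P.crease j '' Ioo 0 (P.len j))
  start_mem_frontier : ∀ i, ∃ p ∈ frontier P.paper, Tendsto (P.crease i) (𝓝[>] 0) (𝓝 p)
  finish_mem_frontier : ∀ i, ∃ p ∈ frontier P.paper,
    Tendsto (P.crease i) (𝓝[<] (P.len i)) (𝓝 p)

/-- The rule segments rule the faces, each point uniquely: they lie in the faces, they cover the
faces, two of them that share a point are the same segment, and each of them extends up to the
boundary of the paper or to a crease point, where it is the rule segment of that crease point. -/
structure IsUniquelyRuled : Prop where
  subset_face : ∀ i σ, ∀ s ∈ Ioo 0 (P.len i), P.ruleSegment i σ s ⊆ P.paper \ P.creaseSet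
  cover : ∀ p ∈ P.paper \ P.creaseSet, ∃ i σ, ∃ s ∈ Ioo 0 (P.len i), p ∈ P.ruleSegment i σ s
  eq_of_meet : ∀ i σ, ∀ s ∈ Ioo 0 (P.len i), ∀ j τ, ∀ u ∈ Ioo 0 (P.len j),
    (P.ruleSegment i σ s ∩ P.ruleSegment j τ u).Nonempty →
      P.ruleSegment i σ s = P.ruleSegment j τ u
  joins_of_farEnd_mem : ∀ i σ, ∀ s ∈ Ioo 0 (P.len i), P.farEnd i σ s ∈ P.paper →
    ∃ j τ u, P.Joins i σ s j τ u

/-- The paper has the topology of a disk: it is an open, nonempty, connected and simply connected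
subset of the plane. -/
def IsHoleFree : Prop := SimplyConnectedSpace P.paper

/-- A (properly) folded state of the crease-rule pattern, self-intersections being ignored:
a continuous map of the paper to space that is `C²` and isometric on the faces, `C²` up to the
creases from either side, maps each rule segment to a straight segment, and has a genuine fold at
each crease point. -/
structure IsFoldedState (f : Plane → Space) : Prop where
  continuousOn : ContinuousOn f P.paper
  contDiffOn : ContDiffOn ℝ 2 f (P.paper \ P.creaseSet)
  isometric : ∀ p ∈ P.paper \ P.creaseSet, ∀ w : Plane, ‖fderiv ℝ f p w‖ = ‖w‖
  contDiff_side : ∀ i σ, ∀ s ∈ Ioo 0 (P.len i), ∃ g : Plane → Space,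
    ContDiffAt ℝ 2 g (P.crease i s) ∧
      ∀ᶠ q : ℝ × ℝ in 𝓝 (s, 0), 0 ≤ q.2 →
        f (P.rulePoint i σ q.1 q.2) = g (P.rulePoint i σ q.1 q.2)
  straight : ∀ i σ, ∀ s ∈ Ioo 0 (P.len i), ∃ R : Space, ‖R‖ = 1 ∧
    ∀ v ∈ Ioo 0 (P.ruleLen i σ s), f (P.rulePoint i σ s v) = f (P.crease i s) + v • R
  folded : ∀ i, ∀ s ∈ Ioo 0 (P.len i), ¬ DifferentiableAt ℝ f (P.crease i s)

/-- The crease-rule pattern folds. -/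
def Folds : Prop := ∃ f : Plane → Space, P.IsFoldedState f

/-- A fold-angle assignment: a differentiable function of arc length on every crease, with values
that are proper fold angles, neither zero (unfolded) nor `±π` (folded flat). -/
structure IsFoldAngleAssignment (ρ : ι → ℝ → ℝ) : Prop where
  differentiableAt : ∀ i, ∀ s ∈ Ioo 0 (P.len i), DifferentiableAt ℝ (ρ i) s
  mem : ∀ i, ∀ s ∈ Ioo 0 (P.len i), ρ i s ∈ Ioo (-Real.pi) Real.pi
  ne_zero : ∀ i, ∀ s ∈ Ioo 0 (P.len i), ρ i s ≠ 0

/-- The single-crease ruling equation, at every point of every crease. -/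
def RulingEquation (ρ : ι → ℝ → ℝ) : Prop :=
  ∀ i, ∀ s ∈ Ioo 0 (P.len i),
    (Real.cot (P.angle i Side.left s) + Real.cot (P.angle i Side.right s)) / 2 =
      1 / P.curvature i s * (deriv (ρ i) s / 2) * Real.cot (ρ i s / 2)

/-- The compatibility equation, at every rule segment between two crease points: the segment is
embedded in a family of rule segments joining `a t` on crease `i` to `b t` on crease `j`, for an
arbitrary parameter `t`. -/
def CompatibilityEquation (ρ : ι → ℝ → ℝ) : Prop :=
  ∀ (i : ι) (σ : Side) (j : ι) (τ : Side) (a b : ℝ → ℝ) (t : ℝ),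
    DifferentiableAt ℝ a t → DifferentiableAt ℝ b t →
    (∀ᶠ t' in 𝓝 t, P.Joins i σ (a t') j τ (b t')) →
      deriv a t * (1 / Real.sin (P.angle i σ (a t))) * P.curvature i (a t) *
          Real.tan (ρ i (a t) / 2) =
        -(deriv b t * (1 / Real.sin (P.angle j τ (b t))) * P.curvature j (b t) *
          Real.tan (ρ j (b t) / 2))

end CreaseRulePattern

/-!
A folded state carries the tangent plane at each point of a face to a plane in space, by a rigid
motion. Along a rule segment this motion is constant, and from one rule segment to the next it
changes by an infinitesimal rotation about the rule line: a face rolls along its rule lines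
(`RollsAt`). The theorem compares these rolling motions along the creases.

*Necessity.* At a crease point the derivatives of a folded state from the two sides (`sideDeriv`)
agree on the tangent, so they differ by a rotation about its image, whose angle is the fold angle.
A `C²` isometry that is straight on the rule segments is developable: its derivative is constant
along each rule segment, and the derivative of `sideDeriv` along the crease annihilates the rule
direction (`IsFoldedState.deriv_sideDeriv_ruleDir`). On either side, the rate at which the tangent
plane turns is therefore determined by the ruling angle and the normal curvature of the folded
crease. The acceleration of the folded crease is the same from both sides, so its osculating plane
bisects the two tangent planes and the normal curvatures are `± k tan (ρ / 2)`
(`IsFoldedState.sideCurv_eq`). Differentiating the angle between the tangent planes now yields the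
ruling equation. The two ends of a rule segment that joins two crease points describe the same
tangent planes, and comparing the speeds with which they turn yields the compatibility equation.

*Sufficiency.* From fold angles `ρ`, the angular velocity `ruleSpin` of the rolling on either side
of each crease is read off, and a linear differential equation produces rolling motions locally
(`exists_eventually_rollsAt`). A rolling motion sweeps out a `C²` isometric developable surface
(`hasFDerivAt_developed`). The ruling equation says exactly that the rolling motion on the left of
a crease, followed by the fold about the tangent, is a rolling motion on the right
(`IsFoldAngleAssignment.rollsAt_sideMotion`), so folded states exist near each point of the paper.
The compatibility equation says that the rolling motions from the two ends of a rule segment have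
the same angular velocity, and hence that two local folded states differ by a fixed rigid motion
(`FrameAt.eventually_eq_mul`). Local folded states therefore form a covering space of the paper,
and this has a section because the paper is simply connected
(`exists_global_of_locally_const_mul`).

Both directions need the geometry of the ruling near a rule segment. Creases are properly embedded
and rule lengths are lower semicontinuous, by compactness, so that rule segments deform
continuously (`IsUniquelyRuled.eventually_lt_ruleLen`). A zero of the Jacobian of the ruling inside
a rule segment would make neighbouring rule segments cross (`IsUniquelyRuled.ruleJac_neg`), so
arc length and distance from the crease are `C¹` coordinates near each point of a face.
-/

/-! ### Gluing local solutions over a simply connected space -/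

/-- **Developing a locally constant system.** Suppose that every point `p` of a simply connected
space has a local solution `F p`, with values in a group `G`, and that near each `q` close to `p`
the solutions `F p` and `F q` differ by a constant left factor. Then there is a global solution,
which near each `p` is a constant multiple of `F p`. The solutions form a bundle with discrete
fibre `G`, hence a covering space, and the global solution is a section of it. -/
theorem exists_global_of_locally_const_mul {X G : Type*} [TopologicalSpace X]
    [SimplyConnectedSpace X] [LocallyPathConnectedSpace X] [Group G] (F : X → X → G)
    (hF : ∀ p, ∀ᶠ q in 𝓝 p, ∃ g : G, ∀ᶠ q' in 𝓝 q, F p q' = g * F q q') :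
    ∃ H : X → G, ∀ p, ∃ g : G, ∀ᶠ q in 𝓝 p, H q = g * F p q := by
  let : TopologicalSpace G := ⊥
  have : DiscreteTopology G := ⟨rfl⟩
  let U : X → Set X := fun p => {q | ∃ g : G, ∀ᶠ q' in 𝓝 q, F p q' = g * F q q'}
  have hU : ∀ p, U p ∈ 𝓝 p := hF
  have hopen : ∀ p, IsOpen (U p) := by
    intro p
    rw [isOpen_iff_mem_nhds]
    rintro q ⟨g, hg⟩
    filter_upwards [hU q, eventually_eventually_nhds.2 hg] with q' ⟨h, hh⟩ hg'
    refine ⟨g * h, ?_⟩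
    filter_upwards [hh, hg'] with x hx hx'
    rw [hx', hx, mul_assoc]
  let Z : FiberBundleCore X X G :=
    { baseSet := U
      isOpen_baseSet := hopen
      indexAt := id
      mem_baseSet_at := fun p => mem_of_mem_nhds (hU p)
      coordChange := fun i j x v => v * (F i x * (F j x)⁻¹)
      coordChange_self := by intro i x _ v; simp
      continuousOn_coordChange := by
        intro i j
        have h1 : ContinuousOn (fun x => F i x * (F j x)⁻¹) (U i ∩ U j) := by
          rintro x ⟨⟨g, hg⟩, ⟨h, hh⟩⟩
          refine ContinuousAt.continuousWithinAt ?_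
          refine (continuousAt_const (y := g * h⁻¹)).congr ?_
          filter_upwards [hg, hh] with y hy hy'
          rw [hy, hy']; group
        refine (continuous_snd.continuousOn).mul (h1.comp continuous_fst.continuousOn ?_)
        rintro ⟨x, v⟩ hx
        exact hx.1
      coordChange_comp := by intro i j k x _ v; simp [mul_assoc] }
  have hcov : IsCoveringMap Z.proj := FiberBundle.isCoveringMap (F := G) (E := Z.Fiber)
  obtain ⟨x₀⟩ : Nonempty X := inferInstance
  obtain ⟨σ, ⟨-, hσ⟩, -⟩ := hcov.existsUnique_continuousMap_lifts (ContinuousMap.id X) x₀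
    (⟨x₀, (1 : G)⟩ : Z.TotalSpace) rfl
  have hproj : ∀ q, (σ q).1 = q := fun q => congrFun hσ q
  let val : Z.TotalSpace → G := fun y => y.2
  refine ⟨fun q => val (σ q) * F q q, fun p => ?_⟩
  have hsrc : σ p ∈ (Z.localTriv p).source := by
    rw [Z.mem_localTriv_source, hproj]; exact mem_of_mem_nhds (hU p)
  have hcont : ContinuousAt (fun q => (Z.localTriv p (σ q)).2) p :=
    continuous_snd.continuousAt.comp
      (((Z.localTriv p).continuousOn_toFun.continuousAt
        ((Z.localTriv p).open_source.mem_nhds hsrc)).comp σ.continuous.continuousAt)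
  refine ⟨(Z.localTriv p (σ p)).2, ?_⟩
  have := hcont.tendsto.eventually (IsOpen.mem_nhds (isOpen_discrete {(Z.localTriv p (σ p)).2}) rfl)
  filter_upwards [this] with q hq
  rw [← hq]
  change val (σ q) * F q q = val (σ q) * (F ((σ q).1) ((σ q).1) * (F p ((σ q).1))⁻¹) * F p q
  rw [hproj]; group

/-! ### Linear differential equations -/

/-- A linear differential equation `A' = A w` with continuous coefficient in a Banach algebra has
a solution near `s₀` with any prescribed initial value. -/
theorem exists_eventually_hasDerivAt_mul {R : Type*} [NormedRing R] [NormedAlgebra ℝ R]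
    [CompleteSpace R] {w : ℝ → R} {s₀ : ℝ} (hw : ∀ᶠ s in 𝓝 s₀, ContinuousAt w s) (a : R) :
    ∃ A : ℝ → R, A s₀ = a ∧ ∀ᶠ s in 𝓝 s₀, HasDerivAt A (A s * w s) s := by
  obtain ⟨ε, hε, hball⟩ := Metric.eventually_nhds_iff_ball.1
    (hw.and (hw.self_of_nhds.norm.eventually_lt_const (lt_add_one _)))
  set C : ℝ := ‖w s₀‖ + 1 with hC
  have hC0 : 0 < C := by positivity
  set N : ℝ := (‖a‖ + 1) * C with hN
  have hN0 : 0 < N := by positivity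
  set δ : ℝ := min (ε / 2) (1 / N) with hδ
  have hδ0 : 0 < δ := by positivity
  have hmem : s₀ ∈ Icc (s₀ - δ) (s₀ + δ) := by constructor <;> linarith
  have hsub : ∀ t ∈ Icc (s₀ - δ) (s₀ + δ), t ∈ Metric.ball s₀ ε := by
    intro t ht
    rw [Metric.mem_ball, Real.dist_eq, abs_lt]
    have : δ ≤ ε / 2 := min_le_left _ _
    constructor <;> linarith [ht.1, ht.2]
  have hPL : IsPicardLindelof (fun t x => x * w t) ⟨s₀, hmem⟩ a 1 0 ⟨N, hN0.le⟩ ⟨C, hC0.le⟩ :=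
    { lipschitzOnWith := by
        intro t ht
        refine LipschitzWith.lipschitzOnWith (LipschitzWith.of_dist_le_mul fun x y => ?_)
        rw [dist_eq_norm, dist_eq_norm, ← sub_mul]
        refine (norm_mul_le (x - y) (w t)).trans ?_
        rw [mul_comm]
        exact mul_le_mul_of_nonneg_right (hball t (hsub t ht)).2.le (norm_nonneg (x - y))
      continuousOn := fun x _ t ht =>
        (continuousAt_const.mul (hball t (hsub t ht)).1).continuousWithinAt
      norm_le := by
        intro t ht x hx
        refine (norm_mul_le _ _).trans ?_
        have hx' : ‖x‖ ≤ ‖a‖ + 1 := by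
          have : ‖x - a‖ ≤ 1 := by simpa [dist_eq_norm] using hx
          linarith [norm_le_norm_add_norm_sub' x a]
        exact mul_le_mul hx' (hball t (hsub t ht)).2.le (norm_nonneg _) (by positivity)
      mul_max_le := by
        have : δ ≤ 1 / N := min_le_right _ _
        have h2 : N * δ ≤ 1 := by
          rw [le_div_iff₀ hN0] at this; linarith
        change N * max (s₀ + δ - s₀) (s₀ - (s₀ - δ)) ≤ ((1 : ℝ) - (0 : ℝ))
        simpa using h2 }
  obtain ⟨α, h0, hα⟩ := hPL.exists_eq_forall_mem_Icc_hasDerivWithinAt₀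
  refine ⟨α, h0, ?_⟩
  filter_upwards [Ioo_mem_nhds (a := s₀ - δ) (b := s₀ + δ) (by linarith) (by linarith)] with s hs
  exact (hα s (Ioo_subset_Icc_self hs)).hasDerivAt (Icc_mem_nhds hs.1 hs.2)

/-- A function with vanishing derivative near a point is constant near that point. -/
theorem eventually_eq_of_eventually_hasDerivAt_zero {E : Type*} [NormedAddCommGroup E]
    [NormedSpace ℝ E] {h : ℝ → E} {s₀ : ℝ} (hh : ∀ᶠ s in 𝓝 s₀, HasDerivAt h 0 s) :
    ∀ᶠ s in 𝓝 s₀, h s = h s₀ := by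
  obtain ⟨ε, hε, hball⟩ := Metric.eventually_nhds_iff_ball.1 hh
  filter_upwards [Metric.ball_mem_nhds s₀ hε] with s hs
  exact Metric.isOpen_ball.is_const_of_deriv_eq_zero (convex_ball s₀ ε).isPreconnected
    (fun x hx => (hball x hx).differentiableAt.differentiableWithinAt)
    (fun x hx => (hball x hx).deriv) hs (Metric.mem_ball_self hε)

/-- A function `A` that satisfies `A' = A w` with a continuous coefficient is `C¹`. -/
theorem contDiffAt_one_of_eventually_hasDerivAt {E : Type*} [NormedAddCommGroup E]
    [NormedSpace ℝ E] {A A' : ℝ → E} {s₀ : ℝ} (hA : ∀ᶠ s in 𝓝 s₀, HasDerivAt A (A' s) s)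
    (hA' : ∀ᶠ s in 𝓝 s₀, ContinuousAt A' s) : ContDiffAt ℝ 1 A s₀ := by
  rw [contDiffAt_one_iff]
  refine ⟨fun s => ContinuousLinearMap.toSpanSingleton ℝ (A' s), _, hA.and hA',
    fun s hs => ?_, fun s hs => hs.1.hasFDerivAt⟩
  exact (((ContinuousLinearMap.toSpanSingletonCLE (𝕜 := ℝ) (E := E)).continuous.continuousAt).comp
    hs.2).continuousWithinAt

/-- If near `p` a function always takes one of the values of two functions with the same value and
the same derivative at `p`, then it has that derivative as well. -/
theorem HasFDerivAt.of_eventually_eq_or_eq {E F : Type*} [NormedAddCommGroup E] [NormedSpace ℝ E]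
    [NormedAddCommGroup F] [NormedSpace ℝ F] {f g h : E → F} {A : E →L[ℝ] F} {p : E}
    (hg : HasFDerivAt g A p) (hh : HasFDerivAt h A p) (hgp : g p = f p) (hhp : h p = f p)
    (H : ∀ᶠ q in 𝓝 p, f q = g q ∨ f q = h q) : HasFDerivAt f A p := by
  rw [hasFDerivAt_iff_isLittleO] at *
  refine Asymptotics.IsLittleO.of_bound fun c hc => ?_
  filter_upwards [H, hg.bound hc, hh.bound hc] with q hq h1 h2
  rcases hq with hq | hq <;> rw [hq]
  · rwa [hgp] at h1
  · rwa [hhp] at h2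

/-! ### The Euclidean plane -/

theorem Plane.inner_eq (u v : Plane) : inner ℝ u v = u 0 * v 0 + u 1 * v 1 := by
  simp [PiLp.inner_apply, Fin.sum_univ_two, mul_comm]

@[simp] theorem turnLeft_apply_zero (w : Plane) : turnLeft w 0 = -(w 1) := rfl

@[simp] theorem turnLeft_apply_one (w : Plane) : turnLeft w 1 = w 0 := rfl

theorem Plane.ext {u v : Plane} (h0 : u 0 = v 0) (h1 : u 1 = v 1) : u = v := by
  ext k; fin_cases k <;> assumption

/-- Rotation of the plane by a quarter turn, as a continuous linear map. -/
noncomputable def turnLeftL : Plane →L[ℝ] Plane :=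
  LinearMap.toContinuousLinearMap
    { toFun := turnLeft
      map_add' := fun u v => by apply Plane.ext <;> simp; ring
      map_smul' := fun c u => by apply Plane.ext <;> simp }

@[simp] theorem turnLeftL_apply (w : Plane) : turnLeftL w = turnLeft w := rfl

theorem turnLeft_add (u v : Plane) : turnLeft (u + v) = turnLeft u + turnLeft v :=
  map_add turnLeftL u v

theorem turnLeft_smul (c : ℝ) (u : Plane) : turnLeft (c • u) = c • turnLeft u :=
  map_smul turnLeftL c u

@[simp] theorem turnLeft_turnLeft (w : Plane) : turnLeft (turnLeft w) = -w := by
  apply Plane.ext <;> simp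

@[simp] theorem inner_turnLeft_self (w : Plane) : inner ℝ w (turnLeft w) = 0 := by
  simp [Plane.inner_eq]; ring

@[simp] theorem inner_turnLeft_self_left (w : Plane) : inner ℝ (turnLeft w) w = 0 := by
  simp [Plane.inner_eq]; ring

@[simp] theorem inner_turnLeft_turnLeft (u w : Plane) :
    inner ℝ (turnLeft u) (turnLeft w) = inner ℝ u w := by
  simp [Plane.inner_eq]; ring

@[simp] theorem norm_turnLeft (w : Plane) : ‖turnLeft w‖ = ‖w‖ := by
  rw [← sq_eq_sq₀ (norm_nonneg _) (norm_nonneg _), ← real_inner_self_eq_norm_sq,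
    ← real_inner_self_eq_norm_sq, inner_turnLeft_turnLeft]

/-- Expansion of a vector in the orthonormal basis of a unit vector and its left turn. -/
theorem eq_inner_smul_add_inner_turnLeft_smul {t : Plane} (ht : ‖t‖ = 1) (w : Plane) :
    w = inner ℝ w t • t + inner ℝ w (turnLeft t) • turnLeft t := by
  have h : t 0 * t 0 + t 1 * t 1 = 1 := by
    rw [← Plane.inner_eq, real_inner_self_eq_norm_sq, ht]; norm_num
  apply Plane.ext <;> simp [Plane.inner_eq]
  · linear_combination (-(w 0)) * h
  · linear_combination (-(w 1)) * h

/-! ### Local inverses -/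

/-- `E` is a `C¹` inverse of `Φ` between neighbourhoods of `y` and of `Φ y`. -/
structure IsLocalInverseAt {V W : Type*} [NormedAddCommGroup V] [NormedSpace ℝ V]
    [NormedAddCommGroup W] [NormedSpace ℝ W] (Φ : V → W) (y : V) (E : W → V) : Prop where
  contDiffAt : ContDiffAt ℝ 1 E (Φ y)
  right_inv : ∀ᶠ q in 𝓝 (Φ y), Φ (E q) = q
  left_inv : ∀ᶠ z in 𝓝 y, E (Φ z) = z

namespace IsLocalInverseAt

variable {V W : Type*} [NormedAddCommGroup V] [NormedSpace ℝ V]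
  [NormedAddCommGroup W] [NormedSpace ℝ W] {Φ : V → W} {y : V} {E E' : W → V}

theorem apply_eq (h : IsLocalInverseAt Φ y E) : E (Φ y) = y := h.left_inv.self_of_nhds

theorem tendsto (h : IsLocalInverseAt Φ y E) : Tendsto E (𝓝 (Φ y)) (𝓝 y) := by
  have := h.contDiffAt.continuousAt.tendsto
  rwa [h.apply_eq] at this

/-- A local inverse at `y` is one at all nearby points too. -/
theorem eventually (h : IsLocalInverseAt Φ y E) :
    ∀ᶠ q in 𝓝 (Φ y), IsLocalInverseAt Φ (E q) E := by
  filter_upwards [h.contDiffAt.eventually (by simp), eventually_eventually_nhds.2 h.right_inv,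
    h.tendsto.eventually (eventually_eventually_nhds.2 h.left_inv), h.right_inv] with q h1 h2 h3 h4
  exact ⟨by rwa [h4], by rwa [h4], h3⟩

theorem eventually_eq (h : IsLocalInverseAt Φ y E) (h' : IsLocalInverseAt Φ y E') :
    ∀ᶠ q in 𝓝 (Φ y), E q = E' q := by
  filter_upwards [h.right_inv, h'.tendsto.eventually h.left_inv, h'.right_inv] with q h1 h2 h3
  rw [h3] at h2; exact h2

end IsLocalInverseAt

theorem exists_isLocalInverseAt {V W : Type*} [NormedAddCommGroup V] [NormedSpace ℝ V]
    [NormedAddCommGroup W] [NormedSpace ℝ W] [FiniteDimensional ℝ V] [FiniteDimensional ℝ W]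
    (hVW : Module.finrank ℝ V = Module.finrank ℝ W) {Φ : V → W} {y : V} {Φ' : V →L[ℝ] W}
    (h1 : ContDiffAt ℝ 1 Φ y) (h2 : HasFDerivAt Φ Φ' y) (h3 : Function.Injective Φ') :
    ∃ E : W → V, IsLocalInverseAt Φ y E := by
  have : CompleteSpace V := FiniteDimensional.complete ℝ V
  let e : V ≃L[ℝ] W :=
    (LinearEquiv.ofInjectiveOfFinrankEq Φ'.toLinearMap h3 hVW).toContinuousLinearEquiv
  have he : (e : V →L[ℝ] W) = Φ' := by ext v; rfl
  rw [← he] at h2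
  refine ⟨h1.localInverse h2 (by simp), h1.to_localInverse h2 (by simp), ?_, ?_⟩
  · exact (h1.hasStrictFDerivAt' h2 (by simp)).eventually_right_inverse
  · exact (h1.hasStrictFDerivAt' h2 (by simp)).eventually_left_inverse

@[simp] theorem Side.dir_mul_dir (σ : Side) : σ.dir * σ.dir = 1 := by cases σ <;> norm_num [Side.dir]

theorem Side.dir_ne_zero (σ : Side) : σ.dir ≠ 0 := by cases σ <;> norm_num [Side.dir]

theorem Side.abs_dir (σ : Side) : |σ.dir| = 1 := by cases σ <;> norm_num [Side.dir]

namespace CreaseRulePattern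

variable {ι : Type*} (P : CreaseRulePattern ι) {i : ι} {σ : Side} {s : ℝ}

/-! ### The moving frame of a crease -/

theorem contDiffAt_crease (hs : s ∈ Ioo 0 (P.len i)) : ContDiffAt ℝ 2 (P.crease i) s :=
  (P.crease_contDiffOn i).contDiffAt (isOpen_Ioo.mem_nhds hs)

theorem hasDerivAt_crease (hs : s ∈ Ioo 0 (P.len i)) :
    HasDerivAt (P.crease i) (P.tangent i s) s :=
  ((P.contDiffAt_crease hs).differentiableAt (by simp)).hasDerivAt

theorem contDiffAt_tangent (hs : s ∈ Ioo 0 (P.len i)) : ContDiffAt ℝ 1 (P.tangent i) s := by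
  have h := (P.crease_contDiffOn i).deriv_of_isOpen isOpen_Ioo (m := 1) (by norm_num)
  exact h.contDiffAt (isOpen_Ioo.mem_nhds hs)

theorem contDiffAt_normal (hs : s ∈ Ioo 0 (P.len i)) : ContDiffAt ℝ 1 (P.normal i) s :=
  turnLeftL.contDiff.contDiffAt.comp s (P.contDiffAt_tangent hs)

theorem contDiffAt_angle (σ : Side) (hs : s ∈ Ioo 0 (P.len i)) :
    ContDiffAt ℝ 1 (P.angle i σ) s :=
  (P.angle_contDiffOn i σ).contDiffAt (isOpen_Ioo.mem_nhds hs)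

theorem contDiffAt_ruleDir (σ : Side) (hs : s ∈ Ioo 0 (P.len i)) :
    ContDiffAt ℝ 1 (P.ruleDir i σ) s :=
  ((Real.contDiff_cos.contDiffAt.comp s (P.contDiffAt_angle σ hs)).smul
    (P.contDiffAt_tangent hs)).add
  ((Real.contDiff_sin.contDiffAt.comp s (P.contDiffAt_angle σ hs)).smul (P.contDiffAt_normal hs))

theorem hasDerivAt_ruleDir (σ : Side) (hs : s ∈ Ioo 0 (P.len i)) :
    HasDerivAt (P.ruleDir i σ) (deriv (P.ruleDir i σ) s) s :=
  ((P.contDiffAt_ruleDir σ hs).differentiableAt (by simp)).hasDerivAt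

theorem norm_tangent (hs : s ∈ Ioo 0 (P.len i)) : ‖P.tangent i s‖ = 1 :=
  P.crease_unit_speed i s hs

theorem norm_normal (hs : s ∈ Ioo 0 (P.len i)) : ‖P.normal i s‖ = 1 := by
  rw [normal, norm_turnLeft, P.norm_tangent hs]

theorem inner_tangent_self (hs : s ∈ Ioo 0 (P.len i)) :
    inner ℝ (P.tangent i s) (P.tangent i s) = 1 := by
  rw [real_inner_self_eq_norm_sq, P.norm_tangent hs, one_pow]

theorem inner_tangent_normal : inner ℝ (P.tangent i s) (P.normal i s) = 0 := by
  simp [normal]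

theorem turnLeft_ruleDir : turnLeft (P.ruleDir i σ s) =
    -Real.sin (P.angle i σ s) • P.tangent i s + Real.cos (P.angle i σ s) • P.normal i s := by
  rw [ruleDir, turnLeft_add, turnLeft_smul, turnLeft_smul, normal, turnLeft_turnLeft]
  module

theorem inner_ruleDir_tangent (hs : s ∈ Ioo 0 (P.len i)) :
    inner ℝ (P.ruleDir i σ s) (P.tangent i s) = Real.cos (P.angle i σ s) := by
  simp [ruleDir, normal, inner_add_left, inner_smul_left, P.norm_tangent hs]

theorem inner_ruleDir_normal (hs : s ∈ Ioo 0 (P.len i)) :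
    inner ℝ (P.ruleDir i σ s) (P.normal i s) = Real.sin (P.angle i σ s) := by
  simp [ruleDir, normal, inner_add_left, inner_smul_left, P.norm_tangent hs]

theorem inner_ruleDir_self (hs : s ∈ Ioo 0 (P.len i)) :
    inner ℝ (P.ruleDir i σ s) (P.ruleDir i σ s) = 1 := by
  rw [ruleDir, inner_add_right, inner_smul_right, inner_smul_right, ← ruleDir,
    P.inner_ruleDir_tangent hs, P.inner_ruleDir_normal hs]
  linear_combination Real.cos_sq_add_sin_sq (P.angle i σ s)

theorem norm_ruleDir (hs : s ∈ Ioo 0 (P.len i)) : ‖P.ruleDir i σ s‖ = 1 := by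
  rw [← sq_eq_sq₀ (norm_nonneg _) zero_le_one, ← real_inner_self_eq_norm_sq,
    P.inner_ruleDir_self hs, one_pow]

theorem sin_angle_pos (σ : Side) (hs : s ∈ Ioo 0 (P.len i)) : 0 < Real.sin (P.angle i σ s) :=
  Real.sin_pos_of_mem_Ioo (P.angle_mem i σ s hs)

/-- The derivative of a unit vector field along a curve is orthogonal to it. -/
theorem _root_.HasDerivAt.inner_eq_zero_of_norm_eq_one {E : Type*} [NormedAddCommGroup E]
    [InnerProductSpace ℝ E] {u : ℝ → E} {u' : E} {s : ℝ} (hu : HasDerivAt u u' s)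
    (h1 : ∀ᶠ x in 𝓝 s, ‖u x‖ = 1) : inner ℝ u' (u s) = 0 := by
  have h2 := hu.inner ℝ hu
  have h3 : HasDerivAt (fun x => (inner ℝ (u x) (u x) : ℝ)) 0 s := by
    refine (hasDerivAt_const s (1 : ℝ)).congr_of_eventuallyEq ?_
    filter_upwards [h1] with x hx
    rw [real_inner_self_eq_norm_sq, hx, one_pow]
  have := h2.unique h3
  rw [real_inner_comm] at this
  linarith

theorem eventually_mem_Ioo (hs : s ∈ Ioo 0 (P.len i)) : ∀ᶠ x in 𝓝 s, x ∈ Ioo 0 (P.len i) :=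
  isOpen_Ioo.mem_nhds hs

theorem hasDerivAt_tangent (hs : s ∈ Ioo 0 (P.len i)) :
    HasDerivAt (P.tangent i) (P.curvature i s • P.normal i s) s := by
  have h := ((P.contDiffAt_tangent hs).differentiableAt (by simp)).hasDerivAt
  have h0 := h.inner_eq_zero_of_norm_eq_one
    ((P.eventually_mem_Ioo hs).mono fun _ hx => P.norm_tangent hx)
  have h1 := eq_inner_smul_add_inner_turnLeft_smul (P.norm_tangent hs) (deriv (P.tangent i) s)
  rw [h0, zero_smul, zero_add] at h1
  rw [h1] at h
  exact h

theorem hasDerivAt_normal (hs : s ∈ Ioo 0 (P.len i)) :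
    HasDerivAt (P.normal i) (-(P.curvature i s) • P.tangent i s) s := by
  have h := turnLeftL.hasFDerivAt.comp_hasDerivAt s (P.hasDerivAt_tangent hs)
  rw [turnLeftL_apply, turnLeft_smul, normal, turnLeft_turnLeft, smul_neg, ← neg_smul] at h
  exact h

theorem continuousAt_curvature (hs : s ∈ Ioo 0 (P.len i)) :
    ContinuousAt (P.curvature i) s := by
  have h := (P.crease_contDiffOn i).deriv_of_isOpen isOpen_Ioo (m := 1) (by norm_num)
  have h2 : ContinuousAt (deriv (P.tangent i)) s :=
    (h.continuousOn_deriv_of_isOpen isOpen_Ioo (by simp)).continuousAt (isOpen_Ioo.mem_nhds hs)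
  exact h2.inner (𝕜 := ℝ) (P.contDiffAt_normal hs).continuousAt

/-! ### The ruling map -/

/-- The map `(s, v) ↦ rulePoint s v` that sweeps the rule lines on one side of a crease. -/
noncomputable def ruleMap (i : ι) (σ : Side) (q : ℝ × ℝ) : Plane := P.rulePoint i σ q.1 q.2

/-- The Jacobian determinant of the ruling map, up to a sign: the velocity of the point at
distance `v` on the moving rule line, measured along the left normal of the ruling vector. -/
noncomputable def ruleJac (i : ι) (σ : Side) (s v : ℝ) : ℝ :=
  inner ℝ (P.tangent i s + (σ.dir * v) • deriv (P.ruleDir i σ) s) (turnLeft (P.ruleDir i σ s))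

@[simp] theorem ruleMap_mk (v : ℝ) : P.ruleMap i σ (s, v) = P.rulePoint i σ s v := rfl

@[simp] theorem rulePoint_zero : P.rulePoint i σ s 0 = P.crease i s := by simp [rulePoint]

theorem contDiffAt_ruleMap (σ : Side) (hs : s ∈ Ioo 0 (P.len i)) (v : ℝ) :
    ContDiffAt ℝ 1 (P.ruleMap i σ) (s, v) := by
  have h1 : ContDiffAt ℝ 1 (fun q : ℝ × ℝ => P.crease i q.1) (s, v) :=
    ((P.contDiffAt_crease hs).of_le (by norm_num)).comp (s, v) contDiffAt_fst
  have h2 : ContDiffAt ℝ 1 (fun q : ℝ × ℝ => P.ruleDir i σ q.1) (s, v) :=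
    ContDiffAt.comp (g := P.ruleDir i σ) (s, v) (P.contDiffAt_ruleDir σ hs) contDiffAt_fst
  exact h1.add ((contDiffAt_const.mul contDiffAt_snd).smul h2)

theorem hasFDerivAt_ruleMap (σ : Side) (hs : s ∈ Ioo 0 (P.len i)) (v : ℝ) :
    HasFDerivAt (P.ruleMap i σ) (fderiv ℝ (P.ruleMap i σ) (s, v)) (s, v) :=
  ((P.contDiffAt_ruleMap σ hs v).differentiableAt (by simp)).hasFDerivAt

theorem hasDerivAt_rulePoint_left (σ : Side) (hs : s ∈ Ioo 0 (P.len i)) (v : ℝ) :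
    HasDerivAt (fun x => P.rulePoint i σ x v)
      (P.tangent i s + (σ.dir * v) • deriv (P.ruleDir i σ) s) s :=
  (P.hasDerivAt_crease hs).add ((P.hasDerivAt_ruleDir σ hs).const_smul (σ.dir * v))

theorem hasDerivAt_rulePoint_right (i : ι) (σ : Side) (s v : ℝ) :
    HasDerivAt (fun x => P.rulePoint i σ s x) (σ.dir • P.ruleDir i σ s) v := by
  have h := (((hasDerivAt_id v).const_mul σ.dir).smul_const (P.ruleDir i σ s)).const_add
    (P.crease i s)
  simpa [rulePoint] using h

theorem fderiv_ruleMap (σ : Side) (hs : s ∈ Ioo 0 (P.len i)) (v : ℝ) (w : ℝ × ℝ) :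
    fderiv ℝ (P.ruleMap i σ) (s, v) w =
      w.1 • (P.tangent i s + (σ.dir * v) • deriv (P.ruleDir i σ) s) +
        w.2 • (σ.dir • P.ruleDir i σ s) := by
  have h := P.hasFDerivAt_ruleMap σ hs v
  have h1 : HasDerivAt (P.ruleMap i σ ∘ fun x => (x, v)) _ s :=
    h.comp_hasDerivAt s ((hasDerivAt_id s).prodMk (hasDerivAt_const s v))
  have h2 : HasDerivAt (P.ruleMap i σ ∘ fun x => (s, x)) _ v :=
    h.comp_hasDerivAt v ((hasDerivAt_const v s).prodMk (hasDerivAt_id v))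
  replace h1 := HasDerivAt.unique (f := fun x => P.rulePoint i σ x v) h1
    (P.hasDerivAt_rulePoint_left σ hs v)
  replace h2 := HasDerivAt.unique (f := fun x => P.rulePoint i σ s x) h2
    (P.hasDerivAt_rulePoint_right i σ s v)
  have hw : w = w.1 • ((1 : ℝ), (0 : ℝ)) + w.2 • ((0 : ℝ), (1 : ℝ)) := by ext <;> simp
  conv_lhs => rw [hw]
  rw [map_add, map_smul, map_smul, h1, h2]

theorem ruleJac_zero (hs : s ∈ Ioo 0 (P.len i)) :
    P.ruleJac i σ s 0 = -Real.sin (P.angle i σ s) := by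
  simp [ruleJac, turnLeft_ruleDir, inner_add_right, inner_smul_right, P.inner_tangent_normal,
    P.norm_tangent hs]

theorem ruleJac_zero_neg (σ : Side) (hs : s ∈ Ioo 0 (P.len i)) : P.ruleJac i σ s 0 < 0 := by
  rw [P.ruleJac_zero hs]; linarith [P.sin_angle_pos σ hs]

theorem exists_isLocalInverseAt_ruleMap (hs : s ∈ Ioo 0 (P.len i)) {v : ℝ}
    (hJ : P.ruleJac i σ s v ≠ 0) : ∃ E, IsLocalInverseAt (P.ruleMap i σ) (s, v) E := by
  refine exists_isLocalInverseAt (by simp) (P.contDiffAt_ruleMap σ hs v)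
    (P.hasFDerivAt_ruleMap σ hs v) ?_
  rw [injective_iff_map_eq_zero]
  intro w hw
  rw [P.fderiv_ruleMap σ hs] at hw
  have h1 := congrArg (fun z => inner ℝ z (turnLeft (P.ruleDir i σ s))) hw
  simp only [inner_add_left, inner_smul_left, inner_turnLeft_self, inner_zero_left, mul_zero,
    add_zero] at h1
  have h2 : w.1 = 0 := by
    rcases mul_eq_zero.1 (show w.1 * P.ruleJac i σ s v = 0 by
      rw [ruleJac, inner_add_left, inner_smul_left]; simpa using h1) with h | h
    · exact h
    · exact absurd h hJ
  rw [h2, zero_smul, zero_add, smul_smul] at hw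
  have h3 : w.2 * σ.dir = 0 := by
    rcases smul_eq_zero.1 hw with h | h
    · exact h
    · have := P.norm_ruleDir (σ := σ) hs
      rw [h, norm_zero] at this; norm_num at this
  exact Prod.ext h2 ((mul_eq_zero.1 h3).resolve_right σ.dir_ne_zero)

end CreaseRulePattern

/-! ### Open segments -/

/-- An open segment determines its starting point and direction up to exchanging its ends. -/
theorem eq_or_reverse_of_segment_eq {E : Type*} [NormedAddCommGroup E] [InnerProductSpace ℝ E]
    {a b d e : E} {l m : ℝ} (hd : ‖d‖ = 1) (he : ‖e‖ = 1) (hl : 0 < l) (hm : 0 < m)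
    (h : (fun v : ℝ => a + v • d) '' Ioo 0 l = (fun v : ℝ => b + v • e) '' Ioo 0 m) :
    (a = b ∧ d = e ∧ l = m) ∨ (b = a + l • d ∧ e = -d ∧ l = m) := by
  have hdd : inner ℝ d d = (1 : ℝ) := by rw [real_inner_self_eq_norm_sq, hd, one_pow]
  set β : ℝ := inner ℝ (b - a) d with hβ
  set γ : ℝ := inner ℝ e d with hγ
  have hψ : ∀ v ∈ Ioo 0 m, b - a + v • e = (β + v * γ) • d := by
    intro v hv
    obtain ⟨w, -, hw⟩ : b + v • e ∈ (fun v : ℝ => a + v • d) '' Ioo 0 l := h ▸ ⟨v, hv, rfl⟩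
    have h1 : b - a + v • e = w • d := by
      rw [sub_add_eq_add_sub, ← hw, add_sub_cancel_left]
    have h2 : β + v * γ = w := by
      have := congrArg (fun z => inner ℝ z d) h1
      simp only [inner_add_left, real_inner_smul_left, hdd] at this
      linarith
    rw [h1, h2]
  have h1 := hψ (m / 2) ⟨by linarith, by linarith⟩
  have h2 := hψ (m / 3) ⟨by linarith, by linarith⟩
  have heq : e = γ • d := by
    have h3 : (m / 6) • e = (m / 6) • γ • d := by
      linear_combination (norm := module) h1 - h2
    exact smul_right_injective E (by positivity : m / 6 ≠ 0) h3
  have hba : b - a = β • d := by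
    rw [heq] at h1
    linear_combination (norm := module) h1
  have hab : |γ| = 1 := by
    rw [heq, norm_smul, hd, mul_one] at he; exact he
  have hIoo : Ioo 0 l = (fun v => β + v * γ) '' Ioo 0 m := by
    have himg : (fun p => inner ℝ (p - a) d) '' ((fun v : ℝ => a + v • d) '' Ioo 0 l) =
        (fun p => inner ℝ (p - a) d) '' ((fun v : ℝ => b + v • e) '' Ioo 0 m) := by rw [h]
    rw [image_image, image_image] at himg
    simp only [add_sub_cancel_left, real_inner_smul_left, hdd, mul_one, image_id'] at himg
    rw [himg]
    refine image_congr fun v _ => ?_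
    rw [add_sub_right_comm, inner_add_left, real_inner_smul_left]
  rcases (abs_eq zero_le_one).1 hab with hg | hg
  · left
    have h3 : (fun v => β + v * γ) '' Ioo 0 m = Ioo β (β + m) := by
      simp [hg, add_comm]
    rw [h3] at hIoo
    have h4 : (0 : ℝ) = β := by
      rw [← csInf_Ioo hl, hIoo, csInf_Ioo (by linarith)]
    have h5 : l = β + m := by
      rw [← csSup_Ioo hl, hIoo, csSup_Ioo (by linarith)]
    refine ⟨?_, by rw [heq, hg, one_smul], by linarith⟩
    rw [← h4, zero_smul, sub_eq_zero] at hba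
    exact hba.symm
  · right
    have h3 : (fun v => β + v * γ) '' Ioo 0 m = Ioo (β - m) β := by
      simp [hg, ← sub_eq_add_neg, image_const_sub_Ioo]
    rw [h3] at hIoo
    have h4 : (0 : ℝ) = β - m := by
      rw [← csInf_Ioo hl, hIoo, csInf_Ioo (by linarith)]
    have h5 : l = β := by
      rw [← csSup_Ioo hl, hIoo, csSup_Ioo (by linarith)]
    refine ⟨?_, by rw [heq, hg, neg_one_smul], by linarith⟩
    rw [h5, ← hba]; abel

namespace CreaseRulePattern

variable {ι : Type*} {P : CreaseRulePattern ι} {i j : ι} {σ τ : Side} {s u v : ℝ}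

/-! ### Creases are properly embedded in the paper -/

theorem crease_mem_creaseSet (hs : s ∈ Ioo 0 (P.len i)) : P.crease i s ∈ P.creaseSet :=
  mem_iUnion.2 ⟨i, s, hs, rfl⟩

theorem IsVertexFree.eq_of_crease_eq (hv : P.IsVertexFree) (hs : s ∈ Ioo 0 (P.len i))
    (hu : u ∈ Ioo 0 (P.len j)) (h : P.crease i s = P.crease j u) : i = j ∧ s = u := by
  have hij : i = j := by
    by_contra hij
    exact disjoint_left.1 (hv.disjoint i j hij) ⟨s, hs, rfl⟩ ⟨u, hu, h.symm⟩
  subst hij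
  exact ⟨rfl, P.crease_injOn i hs hu h⟩

/-- A crease is properly embedded: parameters whose points accumulate inside the paper accumulate
inside the parameter interval. -/
theorem IsVertexFree.exists_le_nhds (hv : P.IsVertexFree) {𝒰 : Ultrafilter ℝ}
    (h𝒰 : ∀ᶠ x in 𝒰, x ∈ Ioo 0 (P.len i)) {p : Plane} (hp : p ∈ P.paper)
    (h : Tendsto (P.crease i) 𝒰 (𝓝 p)) :
    ∃ x ∈ Ioo 0 (P.len i), ↑𝒰 ≤ 𝓝 x ∧ P.crease i x = p := by
  obtain ⟨x, hx, hle⟩ := (isCompact_Icc (a := (0 : ℝ)) (b := P.len i)).ultrafilter_le_nhds 𝒰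
    (le_principal_iff.2 (h𝒰.mono fun _ hy => Ioo_subset_Icc_self hy))
  have hnot : p ∉ frontier P.paper := fun hf => by
    have := P.isOpen_paper.inter_frontier_eq
    exact (this ▸ (⟨hp, hf⟩ : p ∈ P.paper ∩ frontier P.paper) : p ∈ (∅ : Set Plane))
  rcases eq_or_ne x 0 with rfl | h0
  · obtain ⟨p', hp', ht⟩ := hv.start_mem_frontier i
    have : ↑𝒰 ≤ 𝓝[>] (0 : ℝ) := le_inf hle (le_principal_iff.2 (h𝒰.mono fun _ hy => hy.1))
    exact absurd (tendsto_nhds_unique h (ht.mono_left this) ▸ hp') hnot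
  rcases eq_or_ne x (P.len i) with rfl | h1
  · obtain ⟨p', hp', ht⟩ := hv.finish_mem_frontier i
    have : ↑𝒰 ≤ 𝓝[<] (P.len i) := le_inf hle (le_principal_iff.2 (h𝒰.mono fun _ hy => hy.2))
    exact absurd (tendsto_nhds_unique h (ht.mono_left this) ▸ hp') hnot
  have hxI : x ∈ Ioo 0 (P.len i) := ⟨lt_of_le_of_ne hx.1 h0.symm, lt_of_le_of_ne hx.2 h1⟩
  exact ⟨x, hxI, hle, tendsto_nhds_unique
    ((P.contDiffAt_crease hxI).continuousAt.tendsto.mono_left hle) h⟩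

theorem IsVertexFree.isOpen_face [Finite ι] (hv : P.IsVertexFree) :
    IsOpen (P.paper \ P.creaseSet) := by
  rw [isOpen_iff_ultrafilter]
  rintro p ⟨hp, hpc⟩ l hl
  have h1 : P.paper ∈ l := hl (P.isOpen_paper.mem_nhds hp)
  refine inter_mem h1 (Ultrafilter.compl_mem_iff_notMem.2 fun hc => ?_)
  obtain ⟨i, hi⟩ : ∃ i, P.crease i '' Ioo 0 (P.len i) ∈ l := by
    rw [creaseSet, ← biUnion_univ] at hc
    simpa using (Ultrafilter.finite_biUnion_mem_iff finite_univ).1 hc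
  have hmap := Ultrafilter.ofComapInfPrincipal_eq_of_map hi
  obtain ⟨x, hx, -, hxp⟩ := hv.exists_le_nhds (𝒰 := Ultrafilter.ofComapInfPrincipal hi)
    (Ultrafilter.ofComapInfPrincipal_mem hi) hp (by
      rw [Tendsto, ← Ultrafilter.coe_map, hmap]; exact hl)
  exact hpc (hxp ▸ crease_mem_creaseSet hx)

/-! ### Rule segments -/

theorem rulePoint_mem_ruleSegment (hv : v ∈ Ioo 0 (P.ruleLen i σ s)) :
    P.rulePoint i σ s v ∈ P.ruleSegment i σ s := ⟨v, hv, rfl⟩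

theorem rulePoint_eq_add_smul :
    P.rulePoint i σ s v = P.crease i s + v • (σ.dir • P.ruleDir i σ s) := by
  rw [rulePoint, smul_smul, mul_comm v]

theorem norm_dir_smul_ruleDir (hs : s ∈ Ioo 0 (P.len i)) : ‖σ.dir • P.ruleDir i σ s‖ = 1 := by
  rw [norm_smul, P.norm_ruleDir hs, Real.norm_eq_abs, σ.abs_dir, one_mul]

/-- The length of the rule segments is a lower semicontinuous function along a crease. A limit of
short segments would end inside a face, or else at nearby points of the same crease, which the
local injectivity of the ruling map excludes. -/
theorem IsUniquelyRuled.eventually_lt_ruleLen [Finite ι] (hr : P.IsUniquelyRuled)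
    (hv : P.IsVertexFree) (hs : s ∈ Ioo 0 (P.len i)) (hl : v < P.ruleLen i σ s) :
    ∀ᶠ x in 𝓝 s, v < P.ruleLen i σ x := by
  refine mem_iff_ultrafilter.2 fun 𝒰 h𝒰 => ?_
  by_contra hcon
  have hle : ∀ᶠ x in 𝒰, P.ruleLen i σ x ≤ v :=
    (Ultrafilter.compl_mem_iff_notMem.2 hcon : _ ∈ 𝒰) |> fun h => by
      filter_upwards [h] with x hx using not_lt.1 hx
  have hI : ∀ᶠ x in 𝒰, x ∈ Ioo 0 (P.len i) := h𝒰 (P.eventually_mem_Ioo hs)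
  obtain ⟨w, hw, hlim⟩ := (isCompact_Icc (a := (0 : ℝ)) (b := v)).ultrafilter_le_nhds
    (𝒰.map (P.ruleLen i σ)) (le_principal_iff.2 (by
      change ∀ᶠ x in 𝒰, P.ruleLen i σ x ∈ Icc 0 v
      filter_upwards [hle, hI] with x h1 h2 using ⟨(P.ruleLen_pos i σ x h2).le, h1⟩))
  have hpair : Tendsto (fun x => (x, P.ruleLen i σ x)) 𝒰 (𝓝 (s, w)) := by
    rw [nhds_prod_eq]; exact Tendsto.prodMk h𝒰 hlim
  have hfar : Tendsto (P.farEnd i σ) 𝒰 (𝓝 (P.rulePoint i σ s w)) :=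
    (P.contDiffAt_ruleMap σ hs w).continuousAt.tendsto.comp hpair
  -- The far ends converge to the crease point if the limit length `w` is zero, and otherwise to an
  -- inner point of the rule segment, where there is no crease.
  rcases hw.1.eq_or_lt with h0 | h0
  · rw [← h0] at hpair hfar
    rw [rulePoint_zero] at hfar
    have hin : ∀ᶠ x in 𝒰, P.farEnd i σ x ∈ P.paper :=
      hfar (P.isOpen_paper.mem_nhds (P.crease_mem_paper i s hs))
    have hex : ∀ᶠ x in 𝒰, ∃ j, ∃ u, u ∈ Ioo 0 (P.len j) ∧ P.farEnd i σ x = P.crease j u := by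
      filter_upwards [hin, hI] with x h1 h2
      obtain ⟨j, τ, u, hJ⟩ := hr.joins_of_farEnd_mem i σ x h2 h1
      exact ⟨j, u, hJ.2.1, hJ.2.2.1⟩
    obtain ⟨j, hj⟩ : ∃ j, ∀ᶠ x in 𝒰, ∃ u, u ∈ Ioo 0 (P.len j) ∧ P.farEnd i σ x = P.crease j u :=
      Ultrafilter.eventually_exists_iff.1 hex
    obtain ⟨u, hu⟩ := hj.choice
    obtain ⟨y, hy, hyle, hye⟩ := hv.exists_le_nhds (i := j) (𝒰 := 𝒰.map u)
      (p := P.crease i s) (by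
        change ∀ᶠ x in 𝒰, u x ∈ Ioo 0 (P.len j)
        filter_upwards [hu] with x hx using hx.1) (P.crease_mem_paper i s hs) (by
        change Tendsto (P.crease j ∘ u) 𝒰 _
        refine hfar.congr' ?_
        filter_upwards [hu] with x hx using hx.2)
    obtain ⟨rfl, rfl⟩ := hv.eq_of_crease_eq hy hs hye
    have hpair' : Tendsto (fun x => (u x, (0 : ℝ))) 𝒰 (𝓝 (y, 0)) := by
      rw [nhds_prod_eq]; exact Tendsto.prodMk hyle tendsto_const_nhds
    obtain ⟨E, hE⟩ := P.exists_isLocalInverseAt_ruleMap (σ := σ) hs (P.ruleJac_zero_neg σ hs).ne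
    obtain ⟨x, h1, h2, h3, h4⟩ := ((hpair.eventually hE.left_inv).and
      ((hpair'.eventually hE.left_inv).and (hu.and hI))).exists
    have h5 : P.ruleMap j σ (x, P.ruleLen j σ x) = P.ruleMap j σ (u x, 0) := by
      rw [ruleMap_mk, ruleMap_mk, rulePoint_zero]; exact h3.2
    rw [← h5, h1, Prod.mk.injEq] at h2
    exact (P.ruleLen_pos j σ x h4).ne' h2.2
  · have hmem : P.rulePoint i σ s w ∈ P.paper \ P.creaseSet :=
      hr.subset_face i σ s hs ⟨w, ⟨h0, hw.2.trans_lt hl⟩, rfl⟩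
    obtain ⟨x, h1, h2⟩ := ((hfar.eventually (hv.isOpen_face.mem_nhds hmem)).and hI).exists
    obtain ⟨j, τ, u, hJ⟩ := hr.joins_of_farEnd_mem i σ x h2 h1.1
    exact h1.2 (hJ.2.2.1 ▸ crease_mem_creaseSet hJ.2.1)

theorem IsUniquelyRuled.eventually_snd_lt_ruleLen [Finite ι] (hr : P.IsUniquelyRuled)
    (hv : P.IsVertexFree) (hs : s ∈ Ioo 0 (P.len i)) (hl : v < P.ruleLen i σ s) :
    ∀ᶠ q : ℝ × ℝ in 𝓝 (s, v), q.1 ∈ Ioo 0 (P.len i) ∧ q.2 < P.ruleLen i σ q.1 := by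
  obtain ⟨m, hm1, hm2⟩ := exists_between hl
  have h1 := (hr.eventually_lt_ruleLen hv hs hm2).prod_inl_nhds v
  have h2 := (P.eventually_mem_Ioo hs).prod_inl_nhds v
  have h3 := (eventually_lt_nhds hm1).prod_inr_nhds s
  filter_upwards [h1, h2, h3] with q h1 h2 h3 using ⟨h2, h3.trans h1⟩

/-- The ruling map is regular along each rule segment, up to the crease. If the Jacobian vanished
at an inner point, it would change sign there, being affine along the segment, so that the rule
segments starting nearby would cross the given one. -/
theorem IsUniquelyRuled.ruleJac_neg [Finite ι] (hr : P.IsUniquelyRuled) (hv : P.IsVertexFree)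
    (hs : s ∈ Ioo 0 (P.len i)) (h0 : 0 ≤ v) (hl : v < P.ruleLen i σ s) :
    P.ruleJac i σ s v < 0 := by
  set m : ℝ := σ.dir * inner ℝ (deriv (P.ruleDir i σ) s) (turnLeft (P.ruleDir i σ s)) with hm
  have haff : ∀ w, P.ruleJac i σ s w = P.ruleJac i σ s 0 + w * m := by
    intro w
    simp only [ruleJac, inner_add_left, real_inner_smul_left]
    ring
  have hneg := P.ruleJac_zero_neg σ hs
  by_contra hcon
  rw [not_lt, haff] at hcon
  have hmpos : 0 < m := by
    by_contra hm0
    nlinarith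
  -- `w₀` is the zero of the Jacobian; the ruling nearby crosses between `w₀ - δ` and `w₀ + δ`.
  set w₀ : ℝ := -P.ruleJac i σ s 0 / m with hw₀
  have hw₀pos : 0 < w₀ := by rw [hw₀]; apply div_pos <;> linarith
  have hw₀le : w₀ ≤ v := by rw [hw₀, div_le_iff₀ hmpos]; linarith
  have hw₀m : w₀ * m = -P.ruleJac i σ s 0 := by rw [hw₀]; field_simp
  obtain ⟨δ, hδ, hδ1, hδ2⟩ : ∃ δ > 0, 2 * δ < w₀ ∧ w₀ + 2 * δ < P.ruleLen i σ s :=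
    ⟨min w₀ (P.ruleLen i σ s - w₀) / 3, by
      have : 0 < min w₀ (P.ruleLen i σ s - w₀) := lt_min hw₀pos (by linarith)
      positivity, by linarith [min_le_left w₀ (P.ruleLen i σ s - w₀)], by
      linarith [min_le_right w₀ (P.ruleLen i σ s - w₀)]⟩
  set n := turnLeft (P.ruleDir i σ s) with hn
  let D : ℝ → ℝ → ℝ := fun x w => inner ℝ (P.rulePoint i σ x w - P.crease i s) n
  have hD : ∀ w, HasDerivAt (fun x => D x w) (P.ruleJac i σ s w) s := by
    intro w
    have h := ((P.hasDerivAt_rulePoint_left σ hs w).sub_const (P.crease i s)).inner ℝ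
      (hasDerivAt_const s n)
    rw [inner_zero_right, zero_add] at h
    exact h
  have hDs : ∀ w, D s w = 0 := by
    intro w
    simp [D, rulePoint, real_inner_smul_left, hn]
  have hsign : ∀ w, ∀ c : ℝ, 0 < c * P.ruleJac i σ s w → ∀ᶠ x in 𝓝[>] s, 0 < c * D x w := by
    intro w c hc
    have h := ((hD w).const_mul c).tendsto_slope
    have h' := (h.mono_left (nhdsWithin_mono s fun x hx => (ne_of_gt hx : x ≠ s)) :
      Tendsto _ (𝓝[>] s) _).eventually (lt_mem_nhds hc)
    filter_upwards [h', self_mem_nhdsWithin] with x hx hxs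
    rw [slope_def_field, hDs, mul_zero, sub_zero] at hx
    have : 0 < x - s := sub_pos.2 hxs
    exact (div_pos_iff_of_pos_right this).1 hx
  have hlo := hsign (w₀ - δ) (-1) (by rw [haff]; nlinarith)
  have hhi := hsign (w₀ + δ) 1 (by rw [haff]; nlinarith)
  have hlen : ∀ᶠ x in 𝓝[>] s, w₀ + δ < P.ruleLen i σ x :=
    nhdsWithin_le_nhds (hr.eventually_lt_ruleLen hv hs (by linarith))
  have hIx : ∀ᶠ x in 𝓝[>] s, x ∈ Ioo 0 (P.len i) :=
    nhdsWithin_le_nhds (P.eventually_mem_Ioo hs)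
  have hclose : ∀ᶠ x in 𝓝[>] s, ‖P.crease i x - P.crease i s‖ +
      (w₀ + δ) * ‖P.ruleDir i σ x - P.ruleDir i σ s‖ < δ := by
    have h1 : ContinuousAt (fun x => ‖P.crease i x - P.crease i s‖ +
        (w₀ + δ) * ‖P.ruleDir i σ x - P.ruleDir i σ s‖) s :=
      ((P.contDiffAt_crease hs).continuousAt.sub continuousAt_const).norm.add
        (continuousAt_const.mul
          ((P.contDiffAt_ruleDir σ hs).continuousAt.sub continuousAt_const).norm)
    exact nhdsWithin_le_nhds (h1.eventually_lt_const (by simpa using hδ))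
  obtain ⟨x, h1, h2, h3, h4, h5⟩ := (hlo.and (hhi.and (hlen.and (hIx.and hclose)))).exists
  have hcont : ContinuousOn (D x) (Icc (w₀ - δ) (w₀ + δ)) := by
    have : Continuous (D x) := by
      have h6 : Continuous fun w => P.rulePoint i σ x w :=
        continuous_iff_continuousAt.2 fun w => (P.hasDerivAt_rulePoint_right i σ x w).continuousAt
      exact (h6.sub continuous_const).inner continuous_const
    exact this.continuousOn
  obtain ⟨w, hw, hDw⟩ := intermediate_value_Icc (by linarith) hcont
    (show (0 : ℝ) ∈ Icc (D x (w₀ - δ)) (D x (w₀ + δ)) from ⟨by linarith, by linarith⟩)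
  -- The crossing point is the point at distance `w'` on the given rule segment.
  set w' : ℝ := σ.dir * inner ℝ (P.rulePoint i σ x w - P.crease i s) (P.ruleDir i σ s) with hw'
  have hpt : P.rulePoint i σ x w = P.rulePoint i σ s w' := by
    have h6 := eq_inner_smul_add_inner_turnLeft_smul (P.norm_ruleDir (σ := σ) hs)
      (P.rulePoint i σ x w - P.crease i s)
    rw [show inner ℝ (P.rulePoint i σ x w - P.crease i s) (turnLeft (P.ruleDir i σ s)) = 0
      from hDw, zero_smul, add_zero] at h6
    rw [rulePoint.eq_def P i σ s w', hw', ← mul_assoc, σ.dir_mul_dir, one_mul, ← h6]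
    abel
  have hww : |w' - w| < δ := by
    have h6 : w' - w = σ.dir * inner ℝ (P.rulePoint i σ x w - P.rulePoint i σ s w)
        (P.ruleDir i σ s) := by
      have h7 : P.rulePoint i σ x w - P.crease i s =
          (P.rulePoint i σ x w - P.rulePoint i σ s w) + (σ.dir * w) • P.ruleDir i σ s := by
        rw [rulePoint.eq_def P i σ s w]; abel
      rw [hw', h7, inner_add_left, real_inner_smul_left, P.inner_ruleDir_self hs]
      linear_combination w * σ.dir_mul_dir
    rw [h6, abs_mul, σ.abs_dir, one_mul]
    refine (abs_real_inner_le_norm _ _).trans_lt ?_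
    rw [P.norm_ruleDir hs, mul_one]
    have h8 : P.rulePoint i σ x w - P.rulePoint i σ s w = (P.crease i x - P.crease i s) +
        (σ.dir * w) • (P.ruleDir i σ x - P.ruleDir i σ s) := by
      simp only [rulePoint, smul_sub]; abel
    rw [h8]
    refine (norm_add_le _ _).trans_lt (lt_of_le_of_lt ?_ h5)
    rw [norm_smul, Real.norm_eq_abs, abs_mul, σ.abs_dir, one_mul,
      abs_of_pos (by linarith [hw.1] : 0 < w)]
    gcongr
    exact hw.2
  rw [abs_lt] at hww
  have hmeet := hr.eq_of_meet i σ x h4 i σ s hs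
    ⟨P.rulePoint i σ x w, ⟨w, ⟨by linarith [hw.1], by linarith [hw.2]⟩, rfl⟩,
      ⟨w', ⟨by linarith [hw.1], by linarith [hw.2]⟩, hpt.symm⟩⟩
  obtain ⟨z, -, hz⟩ : P.rulePoint i σ x (w₀ - δ) ∈ P.ruleSegment i σ s :=
    hmeet ▸ ⟨w₀ - δ, ⟨by linarith, by linarith⟩, rfl⟩
  have : D x (w₀ - δ) = 0 := by
    rw [show D x (w₀ - δ) = inner ℝ (P.rulePoint i σ x (w₀ - δ) - P.crease i s) n from rfl, ← hz]
    exact hDs z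
  linarith

theorem IsUniquelyRuled.exists_isLocalInverseAt [Finite ι] (hr : P.IsUniquelyRuled)
    (hv : P.IsVertexFree) (hs : s ∈ Ioo 0 (P.len i)) (h0 : 0 ≤ v) (hl : v < P.ruleLen i σ s) :
    ∃ E, IsLocalInverseAt (P.ruleMap i σ) (s, v) E :=
  P.exists_isLocalInverseAt_ruleMap hs (hr.ruleJac_neg hv hs h0 hl).ne

theorem Joins.ruleLen_eq_and_dir_eq (h : P.Joins i σ s j τ u) :
    P.ruleLen i σ s = P.ruleLen j τ u ∧
      τ.dir • P.ruleDir j τ u = -(σ.dir • P.ruleDir i σ s) := by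
  obtain ⟨hs, hu, h1, h2⟩ := h
  rw [farEnd, rulePoint_eq_add_smul] at h1 h2
  have hl := P.ruleLen_pos i σ s hs
  have hm := P.ruleLen_pos j τ u hu
  have h3 : P.ruleLen j τ u • (τ.dir • P.ruleDir j τ u) =
      -(P.ruleLen i σ s • (σ.dir • P.ruleDir i σ s)) := by
    rw [← h1] at h2
    linear_combination (norm := module) h2
  have h4 : P.ruleLen i σ s = P.ruleLen j τ u := by
    have := congrArg norm h3
    rw [norm_neg, norm_smul (P.ruleLen j τ u), norm_smul (P.ruleLen i σ s),
      norm_dir_smul_ruleDir hs, norm_dir_smul_ruleDir hu, Real.norm_of_nonneg hl.le, Real.norm_of_nonneg hm.le] at this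
    linarith
  refine ⟨h4, ?_⟩
  rw [h4, ← smul_neg] at h3
  exact smul_right_injective _ hm.ne' h3

/-- The points of a segment joining two creases, as seen from its two ends. -/
theorem Joins.rulePoint_eq (h : P.Joins i σ s j τ u) (v : ℝ) :
    P.rulePoint j τ u (P.ruleLen i σ s - v) = P.rulePoint i σ s v := by
  have h1 := h.2.2.1
  rw [rulePoint_eq_add_smul, rulePoint_eq_add_smul, h.ruleLen_eq_and_dir_eq.2, ← h1, farEnd,
    rulePoint_eq_add_smul]
  module

/-- Two rule segments with a common point are either the same one or join two crease points. -/
theorem IsUniquelyRuled.eq_or_joins (hr : P.IsUniquelyRuled)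
    (hv : P.IsVertexFree) (hs : s ∈ Ioo 0 (P.len i)) (hu : u ∈ Ioo 0 (P.len j))
    (h : (P.ruleSegment i σ s ∩ P.ruleSegment j τ u).Nonempty) :
    (i = j ∧ σ = τ ∧ s = u) ∨ P.Joins i σ s j τ u := by
  have h1 := hr.eq_of_meet i σ s hs j τ u hu h
  have h2 : ∀ (k : ι) (κ : Side) (x : ℝ), P.ruleSegment k κ x =
      (fun v : ℝ => P.crease k x + v • (κ.dir • P.ruleDir k κ x)) '' Ioo 0 (P.ruleLen k κ x) :=
    fun k κ x => image_congr fun v _ => rulePoint_eq_add_smul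
  rw [h2, h2] at h1
  rcases eq_or_reverse_of_segment_eq (norm_dir_smul_ruleDir hs) (norm_dir_smul_ruleDir hu)
    (P.ruleLen_pos i σ s hs) (P.ruleLen_pos j τ u hu) h1 with ⟨ha, hb, -⟩ | ⟨ha, hb, hc⟩
  · left
    obtain ⟨rfl, rfl⟩ := hv.eq_of_crease_eq hs hu ha
    refine ⟨rfl, ?_, rfl⟩
    have h3 := congrArg (fun z => inner ℝ z (P.normal i s)) hb
    simp only [real_inner_smul_left, P.inner_ruleDir_normal hs] at h3
    have h4 := P.sin_angle_pos σ hs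
    have h5 := P.sin_angle_pos τ hs
    cases σ <;> cases τ <;> simp only [Side.dir] at h3 <;> first | rfl | (exfalso; linarith)
  · right
    refine ⟨hs, hu, ?_, ?_⟩
    · rw [farEnd, rulePoint_eq_add_smul, ha]
    · rw [farEnd, rulePoint_eq_add_smul, ha, hb, hc]; module

/-! ### The two sides of a crease -/

theorem ruleMap_zero : P.ruleMap i σ (s, 0) = P.crease i s := rulePoint_zero P

/-- Near a crease point, the ruling coordinates of the two sides have opposite signs, so that the
two sides of the crease, with the crease itself, fill a neighbourhood of the point. -/
theorem eventually_opposite_sides (hs : s ∈ Ioo 0 (P.len i)) {E E' : Plane → ℝ × ℝ}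
    (hE : IsLocalInverseAt (P.ruleMap i Side.left) (s, 0) E)
    (hE' : IsLocalInverseAt (P.ruleMap i Side.right) (s, 0) E') :
    ∀ᶠ q in 𝓝 (P.crease i s), (0 < (E q).2 ∧ (E' q).2 < 0) ∨ ((E q).2 = 0 ∧ (E' q).2 = 0) ∨
      ((E q).2 < 0 ∧ 0 < (E' q).2) := by
  have hEc := hE.contDiffAt
  rw [ruleMap_zero] at hEc
  have hsnd : ContDiffAt ℝ 1 (fun q => (E q).2) (P.crease i s) := contDiffAt_snd.comp _ hEc
  set K : Plane →L[ℝ] ℝ := fderiv ℝ (fun q => (E q).2) (P.crease i s) with hK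
  have hKd : HasFDerivAt (fun q => (E q).2) K (P.crease i s) :=
    (hsnd.differentiableAt (by simp)).hasFDerivAt
  have hleft : ∀ᶠ x in 𝓝 s, (E (P.crease i x)).2 = 0 := by
    have h := ((((continuous_id' (X := ℝ)).prodMk continuous_const).tendsto' s (s, (0 : ℝ)) rfl) :
      Tendsto (fun x => (x, (0 : ℝ))) _ _).eventually hE.left_inv
    filter_upwards [h] with x hx
    rw [ruleMap_zero] at hx; rw [hx]
  have hKt : K (P.tangent i s) = 0 :=
    (hKd.comp_hasDerivAt s (P.hasDerivAt_crease hs)).unique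
      ((hasDerivAt_const s (0 : ℝ)).congr_of_eventuallyEq hleft)
  have hKr : K (P.ruleDir i Side.left s) = 1 := by
    have h1 : HasDerivAt ((fun q => (E q).2) ∘ fun x => P.rulePoint i Side.left s x) _ 0 :=
      HasFDerivAt.comp_hasDerivAt (l' := K) 0 (by rw [rulePoint_zero]; exact hKd)
        (P.hasDerivAt_rulePoint_right i Side.left s 0)
    have h2 : ∀ᶠ x in 𝓝 (0 : ℝ), (E (P.rulePoint i Side.left s x)).2 = x := by
      have h := (((continuous_const.prodMk (continuous_id' (X := ℝ))).tendsto' (0 : ℝ) (s, (0 : ℝ)) rfl) :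
        Tendsto (fun x => (s, x)) _ _).eventually hE.left_inv
      filter_upwards [h] with x hx
      rw [ruleMap_mk] at hx; rw [hx]
    have h3 := h1.unique ((hasDerivAt_id (0 : ℝ)).congr_of_eventuallyEq h2)
    simpa [Side.dir] using h3
  set c : ℝ := K (P.ruleDir i Side.right s) with hc
  have hcpos : 0 < c := by
    have hn : Real.sin (P.angle i Side.left s) * K (P.normal i s) = 1 := by
      rw [ruleDir, map_add, map_smul, map_smul, hKt, smul_zero, zero_add] at hKr
      exact hKr
    have h1 := P.sin_angle_pos Side.left hs
    have h2 := P.sin_angle_pos Side.right hs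
    have h3 : 0 < K (P.normal i s) := by
      by_contra h
      nlinarith
    rw [hc, ruleDir, map_add, map_smul, map_smul, hKt, smul_zero, zero_add]
    exact mul_pos h2 h3
  -- The left distance `h z` at the point with right coordinates `z` is `-c * z.2` to first order;
  -- strict differentiability makes this uniform along the crease, where `h` vanishes.
  set h : ℝ × ℝ → ℝ := fun z => (E (P.ruleMap i Side.right z)).2 with hh
  have hcd : ContDiffAt ℝ 1 h (s, 0) := by
    have : ContDiffAt ℝ 1 (fun q => (E q).2) (P.ruleMap i Side.right (s, 0)) := by
      rwa [ruleMap_zero]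
    exact this.comp (s, (0 : ℝ)) (P.contDiffAt_ruleMap Side.right hs 0)
  have hstrict := hcd.hasStrictFDerivAt (by simp)
  have hval : ∀ y, fderiv ℝ h (s, 0) (0, y) = -(c * y) := by
    intro y
    have h0 : HasFDerivAt h (K ∘L fderiv ℝ (P.ruleMap i Side.right) (s, 0)) (s, 0) :=
      HasFDerivAt.comp (g := fun q => (E q).2) (g' := K) (s, (0 : ℝ)) (by rw [ruleMap_zero]; exact hKd)
        (P.hasFDerivAt_ruleMap Side.right hs 0)
    rw [h0.fderiv, ContinuousLinearMap.comp_apply, P.fderiv_ruleMap Side.right hs]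
    simp [Side.dir, hc, mul_comm]
  have hlim : Tendsto (fun z : ℝ × ℝ => (z, (z.1, (0 : ℝ)))) (𝓝 (s, 0)) (𝓝 ((s, 0), (s, 0))) :=
    (continuous_id.prodMk (continuous_fst.prodMk continuous_const)).tendsto' _ _ rfl
  have hbound := hlim.eventually ((hasStrictFDerivAt_iff_isLittleO.1 hstrict).bound (half_pos hcpos))
  have hzero : ∀ᶠ z : ℝ × ℝ in 𝓝 (s, 0), h (z.1, 0) = 0 := by
    refine (hleft.prod_inl_nhds (0 : ℝ)).mono fun z hz => ?_
    rw [hh]; simpa [ruleMap_zero] using hz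
  have hkey : ∀ᶠ z : ℝ × ℝ in 𝓝 (s, 0), |h z + c * z.2| ≤ c / 2 * |z.2| := by
    filter_upwards [hbound, hzero] with z h1 h2
    have h3 : z - (z.1, (0 : ℝ)) = (0, z.2) := by ext <;> simp
    rw [h2, h3, hval, sub_zero, sub_neg_eq_add, Real.norm_eq_abs, Prod.norm_mk, norm_zero,
      Real.norm_eq_abs, max_eq_right (abs_nonneg _)] at h1
    exact h1
  have hE't := hE'.tendsto
  have hE'r := hE'.right_inv
  rw [ruleMap_zero] at hE't hE'r
  filter_upwards [hE't.eventually hkey, hE'r] with q h1 h2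
  have h3 : h (E' q) = (E q).2 := by rw [hh]; simp only [h2]
  rw [h3] at h1
  rcases lt_trichotomy (E' q).2 0 with h4 | h4 | h4
  · left
    rw [abs_of_neg h4, abs_le] at h1
    exact ⟨by nlinarith, h4⟩
  · right; left
    rw [h4] at h1
    simp at h1
    exact ⟨h1, h4⟩
  · right; right
    rw [abs_of_pos h4, abs_le] at h1
    exact ⟨by nlinarith, h4⟩

end CreaseRulePattern

/-! ### Vectors in space -/

/-- The vector product in space. -/
noncomputable def Space.cross (u v : Space) : Space :=
  !₂[u 1 * v 2 - u 2 * v 1, u 2 * v 0 - u 0 * v 2, u 0 * v 1 - u 1 * v 0]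

namespace Space

theorem inner_eq (u v : Space) : inner ℝ u v = u 0 * v 0 + u 1 * v 1 + u 2 * v 2 := by
  simp [PiLp.inner_apply, Fin.sum_univ_three, mul_comm]

@[simp] theorem cross_zero (u v : Space) : cross u v 0 = u 1 * v 2 - u 2 * v 1 := rfl
@[simp] theorem cross_one (u v : Space) : cross u v 1 = u 2 * v 0 - u 0 * v 2 := rfl
@[simp] theorem cross_two (u v : Space) : cross u v 2 = u 0 * v 1 - u 1 * v 0 := rfl

@[simp] theorem inner_cross_left (u v : Space) : inner ℝ (cross u v) u = 0 := by
  simp [inner_eq]; ring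

@[simp] theorem inner_cross_right (u v : Space) : inner ℝ (cross u v) v = 0 := by
  simp [inner_eq]; ring

theorem inner_cross_swap (u v w : Space) : inner ℝ (cross u v) w = -inner ℝ v (cross u w) := by
  simp [inner_eq]; ring

theorem inner_cross_cross (u v w : Space) : inner ℝ (cross u v) (cross u w) =
    inner ℝ u u * inner ℝ v w - inner ℝ u w * inner ℝ v u := by
  simp only [inner_eq, cross_zero, cross_one, cross_two]; ring

theorem differentiableAt_cross {a b : ℝ → Space} {s : ℝ} (ha : DifferentiableAt ℝ a s)
    (hb : DifferentiableAt ℝ b s) : DifferentiableAt ℝ (fun x => cross (a x) (b x)) s := by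
  rw [differentiableAt_euclidean] at *
  intro k
  fin_cases k
  · exact ((ha 1).mul (hb 2)).sub ((ha 2).mul (hb 1))
  · exact ((ha 2).mul (hb 0)).sub ((ha 0).mul (hb 2))
  · exact ((ha 0).mul (hb 1)).sub ((ha 1).mul (hb 0))

/-- Expansion of a vector in the orthonormal basis spanned by two orthonormal vectors and their
vector product. -/
theorem eq_inner_smul_add {a b : Space} (ha : inner ℝ a a = (1 : ℝ)) (hb : inner ℝ b b = (1 : ℝ))
    (hab : inner ℝ a b = (0 : ℝ)) (w : Space) :
    w = inner ℝ w a • a + inner ℝ w b • b + inner ℝ w (cross a b) • cross a b := by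
  have hba : inner ℝ b a = (0 : ℝ) := by rw [real_inner_comm]; exact hab
  have hn : inner ℝ (cross a b) (cross a b) = (1 : ℝ) := by
    rw [inner_cross_cross, ha, hb, hab]; norm_num
  have hac : inner ℝ a (cross a b) = (0 : ℝ) := by rw [real_inner_comm]; simp
  have hbc : inner ℝ b (cross a b) = (0 : ℝ) := by rw [real_inner_comm]; simp
  have ho : Orthonormal ℝ ![a, b, cross a b] := by
    rw [orthonormal_iff_ite]
    intro k l
    fin_cases k <;> fin_cases l <;> simp [ha, hb, hab, hba, hn, hac, hbc,
      -inner_self_eq_norm_sq_to_K]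
  obtain ⟨e, he⟩ := Orthonormal.exists_orthonormalBasis_extension_of_card_eq (𝕜 := ℝ)
    (v := ![a, b, cross a b]) (s := univ) (by simp) (by
      exact ho.comp (fun k : (univ : Set (Fin 3)) => (k : Fin 3)) Subtype.val_injective)
  have h := e.sum_repr' w
  rw [Fin.sum_univ_three, he 0 trivial, he 1 trivial, he 2 trivial] at h
  conv_lhs => rw [← h]
  simp [real_inner_comm]

end Space

namespace CreaseRulePattern

variable {ι : Type*} {P : CreaseRulePattern ι} {i j : ι} {σ τ : Side} {s u v : ℝ}
  {f : Plane → Space}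

/-! ### The tangent planes of a folded state along its creases -/

theorem contDiffAt_fderiv_of_two {g : Plane → Space} {p : Plane} (hg : ContDiffAt ℝ 2 g p) :
    ContDiffAt ℝ 1 (fderiv ℝ g) p :=
  hg.fderiv_right (by norm_num)

/-- The derivative of a folded state at a crease point, as seen from one side of the crease: the
limit of the derivative along the rule segment, which exists by `IsFoldedState.tendsto_sideDeriv`.
-/
noncomputable def sideDeriv (P : CreaseRulePattern ι) (f : Plane → Space) (i : ι) (σ : Side)
    (s : ℝ) : Plane →L[ℝ] Space :=
  limUnder (𝓝[>] 0) fun v => fderiv ℝ f (P.rulePoint i σ s v)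

/-- Next to a crease point, a folded state agrees on either side with the `C²` map that extends
it. -/
theorem eventually_eq_of_side (hs : s ∈ Ioo 0 (P.len i)) {g : Plane → Space}
    (hg : ∀ᶠ q : ℝ × ℝ in 𝓝 (s, 0), 0 ≤ q.2 →
      f (P.rulePoint i σ q.1 q.2) = g (P.rulePoint i σ q.1 q.2)) :
    ∀ᶠ z : ℝ × ℝ in 𝓝 (s, 0), 0 < z.2 → f =ᶠ[𝓝 (P.ruleMap i σ z)] g := by
  obtain ⟨E, hE⟩ := P.exists_isLocalInverseAt_ruleMap (σ := σ) hs (P.ruleJac_zero_neg σ hs).ne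
  have h1 : ∀ᶠ q in 𝓝 (P.ruleMap i σ (s, 0)), 0 ≤ (E q).2 → f q = g q := by
    filter_upwards [hE.tendsto.eventually hg, hE.right_inv] with q h1 h2 h3
    have h4 := h1 h3
    change f (P.ruleMap i σ (E q)) = g (P.ruleMap i σ (E q)) at h4
    rwa [h2] at h4
  have h2 : ∀ᶠ q in 𝓝 (P.ruleMap i σ (s, 0)), 0 < (E q).2 → f =ᶠ[𝓝 q] g := by
    filter_upwards [eventually_eventually_nhds.2 h1, hE.contDiffAt.eventually (by simp)]
      with q h3 h4 h5
    have h6 : ContinuousAt (fun q => (E q).2) q := continuousAt_snd.comp h4.continuousAt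
    filter_upwards [h3, h6.eventually (lt_mem_nhds h5)] with q' h7 h8 using h7 h8.le
  filter_upwards [(P.contDiffAt_ruleMap σ hs 0).continuousAt.eventually h2, hE.left_inv]
    with z h3 h4 h5
  rw [h4] at h3
  exact h3 h5

theorem eventually_tendsto_fderiv (hs : s ∈ Ioo 0 (P.len i)) {g : Plane → Space}
    (hg2 : ContDiffAt ℝ 2 g (P.crease i s))
    (hg : ∀ᶠ q : ℝ × ℝ in 𝓝 (s, 0), 0 ≤ q.2 →
      f (P.rulePoint i σ q.1 q.2) = g (P.rulePoint i σ q.1 q.2)) :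
    ∀ᶠ x in 𝓝 s, Tendsto (fun v => fderiv ℝ f (P.rulePoint i σ x v)) (𝓝[>] 0)
      (𝓝 (fderiv ℝ g (P.crease i x))) := by
  have h1 := (eventually_eq_of_side hs hg).curry_nhds
  have h2 := (P.contDiffAt_crease hs).continuousAt.eventually (hg2.eventually (by simp))
  filter_upwards [h1, h2] with x h3 h4
  have h5 : ContinuousAt (fun v => fderiv ℝ g (P.rulePoint i σ x v)) 0 := by
    refine ContinuousAt.comp (g := fderiv ℝ g) ?_
      (P.hasDerivAt_rulePoint_right i σ x 0).continuousAt
    rw [rulePoint_zero]; exact (contDiffAt_fderiv_of_two h4).continuousAt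
  have h6 : Tendsto (fun v => fderiv ℝ g (P.rulePoint i σ x v)) (𝓝[>] 0)
      (𝓝 (fderiv ℝ g (P.crease i x))) := by
    have := h5.tendsto
    rw [rulePoint_zero] at this
    exact this.mono_left nhdsWithin_le_nhds
  refine h6.congr' ?_
  filter_upwards [nhdsWithin_le_nhds h3, self_mem_nhdsWithin] with v h7 h8
  exact (h7 h8).fderiv_eq.symm

namespace IsFoldedState

theorem eventually_sideDeriv_eq (hs : s ∈ Ioo 0 (P.len i)) {g : Plane → Space}
    (hg2 : ContDiffAt ℝ 2 g (P.crease i s))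
    (hg : ∀ᶠ q : ℝ × ℝ in 𝓝 (s, 0), 0 ≤ q.2 →
      f (P.rulePoint i σ q.1 q.2) = g (P.rulePoint i σ q.1 q.2)) :
    ∀ᶠ x in 𝓝 s, P.sideDeriv f i σ x = fderiv ℝ g (P.crease i x) := by
  filter_upwards [eventually_tendsto_fderiv hs hg2 hg] with x hx using hx.limUnder_eq

theorem tendsto_sideDeriv (hf : P.IsFoldedState f) (hs : s ∈ Ioo 0 (P.len i)) :
    Tendsto (fun v => fderiv ℝ f (P.rulePoint i σ s v)) (𝓝[>] 0) (𝓝 (P.sideDeriv f i σ s)) := by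
  obtain ⟨g, hg2, hg⟩ := hf.contDiff_side i σ s hs
  have h := (eventually_tendsto_fderiv hs hg2 hg).self_of_nhds
  rwa [sideDeriv, h.limUnder_eq]

theorem norm_sideDeriv_apply (hf : P.IsFoldedState f) (hr : P.IsUniquelyRuled)
    (hs : s ∈ Ioo 0 (P.len i)) (w : Plane) : ‖P.sideDeriv f i σ s w‖ = ‖w‖ := by
  have h1 : Tendsto (fun v => ‖fderiv ℝ f (P.rulePoint i σ s v) w‖) (𝓝[>] 0)
      (𝓝 ‖P.sideDeriv f i σ s w‖) :=
    ((ContinuousLinearMap.apply ℝ Space w).continuous.continuousAt.tendsto.comp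
      (hf.tendsto_sideDeriv hs)).norm
  refine tendsto_nhds_unique h1 (tendsto_const_nhds.congr' ?_)
  filter_upwards [Ioo_mem_nhdsGT (P.ruleLen_pos i σ s hs)] with v hv
  exact (hf.isometric _ (hr.subset_face i σ s hs (rulePoint_mem_ruleSegment hv)) w).symm

theorem inner_sideDeriv_apply (hf : P.IsFoldedState f) (hr : P.IsUniquelyRuled)
    (hs : s ∈ Ioo 0 (P.len i)) (w w' : Plane) :
    inner ℝ (P.sideDeriv f i σ s w) (P.sideDeriv f i σ s w') = inner ℝ w w' :=
  (⟨(P.sideDeriv f i σ s).toLinearMap, hf.norm_sideDeriv_apply hr hs⟩ :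
    Plane →ₗᵢ[ℝ] Space).inner_map_map w w'

theorem hasDerivAt_sideDeriv (hf : P.IsFoldedState f) (hs : s ∈ Ioo 0 (P.len i)) :
    HasDerivAt (P.sideDeriv f i σ) (deriv (P.sideDeriv f i σ) s) s := by
  obtain ⟨g, hg2, hg⟩ := hf.contDiff_side i σ s hs
  have h1 : DifferentiableAt ℝ (fun x => fderiv ℝ g (P.crease i x)) s :=
    DifferentiableAt.comp (g := fderiv ℝ g) s
      ((contDiffAt_fderiv_of_two hg2).differentiableAt (by simp))
      (P.hasDerivAt_crease hs).differentiableAt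
  exact (h1.congr_of_eventuallyEq (eventually_sideDeriv_eq hs hg2 hg)).hasDerivAt

theorem hasDerivAt_crease_image (hf : P.IsFoldedState f) (σ : Side) (hs : s ∈ Ioo 0 (P.len i)) :
    HasDerivAt (fun x => f (P.crease i x)) (P.sideDeriv f i σ s (P.tangent i s)) s := by
  obtain ⟨g, hg2, hg⟩ := hf.contDiff_side i σ s hs
  have h1 : ∀ᶠ x in 𝓝 s, f (P.crease i x) = g (P.crease i x) := by
    have h2 := (((continuous_id' (X := ℝ)).prodMk continuous_const).tendsto' s (s, (0 : ℝ))
      rfl).eventually hg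
    filter_upwards [h2] with x hx
    simpa using hx le_rfl
  rw [(eventually_sideDeriv_eq hs hg2 hg).self_of_nhds]
  exact ((hg2.differentiableAt (by simp)).hasFDerivAt.comp_hasDerivAt s
    (P.hasDerivAt_crease hs)).congr_of_eventuallyEq h1

/-- The image of a rule segment, in terms of the derivative of the folded state at its crease
point. -/
theorem apply_rulePoint (hf : P.IsFoldedState f) (hs : s ∈ Ioo 0 (P.len i))
    (hv : v ∈ Ioo 0 (P.ruleLen i σ s)) : f (P.rulePoint i σ s v) =
      f (P.crease i s) + (v * σ.dir) • P.sideDeriv f i σ s (P.ruleDir i σ s) := by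
  obtain ⟨g, hg2, hg⟩ := hf.contDiff_side i σ s hs
  obtain ⟨R, -, hR⟩ := hf.straight i σ s hs
  have hg0 : f (P.crease i s) = g (P.crease i s) := by simpa using hg.self_of_nhds le_rfl
  have h1 : HasDerivAt (fun x => g (P.rulePoint i σ s x))
      (P.sideDeriv f i σ s (σ.dir • P.ruleDir i σ s)) 0 := by
    rw [(eventually_sideDeriv_eq hs hg2 hg).self_of_nhds]
    refine HasFDerivAt.comp_hasDerivAt (l := g) 0 ?_ (P.hasDerivAt_rulePoint_right i σ s 0)
    rw [rulePoint_zero]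
    exact (hg2.differentiableAt (by simp)).hasFDerivAt
  have h2 : HasDerivAt (fun x : ℝ => f (P.crease i s) + x • R) R 0 := by
    simpa using ((hasDerivAt_id (0 : ℝ)).smul_const R).const_add (f (P.crease i s))
  have h3 : HasDerivWithinAt (fun x => g (P.rulePoint i σ s x)) R (Ici 0) 0 := by
    refine h2.hasDerivWithinAt.congr_of_eventuallyEq ?_ (by simp [hg0])
    have h4 := (((continuous_const (y := s)).prodMk (continuous_id' (X := ℝ))).tendsto' (0 : ℝ)
      (s, (0 : ℝ)) rfl).eventually hg
    filter_upwards [nhdsWithin_le_nhds h4, self_mem_nhdsWithin,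
      nhdsWithin_le_nhds (Iio_mem_nhds (P.ruleLen_pos i σ s hs))] with x h5 h6 h7
    rcases (show (0 : ℝ) ≤ x from h6).eq_or_lt with h8 | h8
    · simp [← h8, hg0]
    · rw [← h5 h6]; exact hR x ⟨h8, h7⟩
  have h4 := (uniqueDiffOn_Ici (0 : ℝ) 0 self_mem_Ici).eq_deriv (Ici 0) h3 h1.hasDerivWithinAt
  rw [hR v hv, h4, map_smul, smul_smul]

theorem differentiableAt_of_mem_ruleSegment [Finite ι] (hf : P.IsFoldedState f)
    (hr : P.IsUniquelyRuled) (hV : P.IsVertexFree) (hs : s ∈ Ioo 0 (P.len i))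
    (hv : v ∈ Ioo 0 (P.ruleLen i σ s)) : DifferentiableAt ℝ f (P.rulePoint i σ s v) :=
  (hf.contDiffOn.contDiffAt (hV.isOpen_face.mem_nhds
    (hr.subset_face i σ s hs (rulePoint_mem_ruleSegment hv)))).differentiableAt (by simp)

/-- The derivative of a folded state in the direction in which the rule segment moves. -/
theorem fderiv_apply_rulePoint [Finite ι] (hf : P.IsFoldedState f)
    (hr : P.IsUniquelyRuled) (hV : P.IsVertexFree) (hs : s ∈ Ioo 0 (P.len i))
    (hv : v ∈ Ioo 0 (P.ruleLen i σ s)) :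
    fderiv ℝ f (P.rulePoint i σ s v)
        (P.tangent i s + (σ.dir * v) • deriv (P.ruleDir i σ) s) =
      P.sideDeriv f i σ s (P.tangent i s + (σ.dir * v) • deriv (P.ruleDir i σ) s) +
        (σ.dir * v) • deriv (P.sideDeriv f i σ) s (P.ruleDir i σ s) := by
  have h1 := (hf.differentiableAt_of_mem_ruleSegment hr hV hs hv).hasFDerivAt.comp_hasDerivAt
    (f := fun x => P.rulePoint i σ x v) s (P.hasDerivAt_rulePoint_left σ hs v)
  have h2 := (hf.hasDerivAt_crease_image σ hs).add
    (((hf.hasDerivAt_sideDeriv (σ := σ) hs).clm_apply (P.hasDerivAt_ruleDir σ hs)).const_smul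
      (v * σ.dir))
  have h3 : ∀ᶠ x in 𝓝 s, (f ∘ fun x => P.rulePoint i σ x v) x = f (P.crease i x) +
      (v * σ.dir) • P.sideDeriv f i σ x (P.ruleDir i σ x) := by
    filter_upwards [hr.eventually_lt_ruleLen hV hs hv.2, P.eventually_mem_Ioo hs] with x h4 h5
    exact hf.apply_rulePoint h5 ⟨hv.1, h4⟩
  rw [h1.unique (h2.congr_of_eventuallyEq h3), map_add, map_smul]
  module

theorem inner_deriv_sideDeriv (hf : P.IsFoldedState f) (hr : P.IsUniquelyRuled)
    (hs : s ∈ Ioo 0 (P.len i)) (w w' : Plane) :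
    inner ℝ (deriv (P.sideDeriv f i σ) s w) (P.sideDeriv f i σ s w') +
      inner ℝ (P.sideDeriv f i σ s w) (deriv (P.sideDeriv f i σ) s w') = 0 := by
  have hd : ∀ z : Plane, HasDerivAt (fun x => P.sideDeriv f i σ x z)
      (deriv (P.sideDeriv f i σ) s z) s := fun z => by
    simpa using (hf.hasDerivAt_sideDeriv (σ := σ) hs).clm_apply (hasDerivAt_const s z)
  have h1 := (hd w).inner ℝ (hd w')
  have h2 : HasDerivAt (fun x => (inner ℝ (P.sideDeriv f i σ x w) (P.sideDeriv f i σ x w') : ℝ))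
      0 s := by
    refine (hasDerivAt_const s (inner ℝ w w' : ℝ)).congr_of_eventuallyEq ?_
    filter_upwards [P.eventually_mem_Ioo hs] with x hx using hf.inner_sideDeriv_apply hr hx w w'
  rw [add_comm]
  exact h1.unique h2

/-- The tangent plane of a folded state rolls about the rule lines: its derivative along the
crease vanishes in the direction of the ruling. As `f` is isometric, the squared norm of
`fderiv_apply_rulePoint` does not depend on its last term, whatever the distance `v`. -/
theorem deriv_sideDeriv_ruleDir [Finite ι] (hf : P.IsFoldedState f)
    (hr : P.IsUniquelyRuled) (hV : P.IsVertexFree) (hs : s ∈ Ioo 0 (P.len i)) :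
    deriv (P.sideDeriv f i σ) s (P.ruleDir i σ s) = 0 := by
  set A := P.sideDeriv f i σ s with hA
  set r := P.ruleDir i σ s with hrd
  set r' := deriv (P.ruleDir i σ) s with hr'
  set t := P.tangent i s with ht
  set w := deriv (P.sideDeriv f i σ) s r with hw
  have hl := P.ruleLen_pos i σ s hs
  have key : ∀ v ∈ Ioo 0 (P.ruleLen i σ s),
      2 * σ.dir * inner ℝ (A t) w + v * (2 * inner ℝ (A r') w + inner ℝ w w) = 0 := by
    intro v hv
    have h1 := congrArg (fun z => inner ℝ z z) (hf.fderiv_apply_rulePoint hr hV hs hv)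
    simp only [real_inner_self_eq_norm_sq] at h1
    rw [hf.isometric _ (hr.subset_face i σ s hs (rulePoint_mem_ruleSegment hv)),
      ← hf.norm_sideDeriv_apply (σ := σ) hr hs, norm_add_sq_real] at h1
    rw [← hA, ← hrd, ← ht, ← hr', ← hw, map_add, map_smul, ← real_inner_self_eq_norm_sq (_ • w)]
      at h1
    simp only [inner_add_left, real_inner_smul_left, real_inner_smul_right] at h1
    have h2 := σ.dir_mul_dir
    have h3 : v * (2 * σ.dir * inner ℝ (A t) w + v * (2 * inner ℝ (A r') w + inner ℝ w w)) = 0 := by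
      linear_combination -h1 - v ^ 2 * (2 * inner ℝ (A r') w + inner ℝ w w) * h2
    exact (mul_eq_zero.1 h3).resolve_left hv.1.ne'
  have h1 := key (P.ruleLen i σ s / 2) ⟨by linarith, by linarith⟩
  have h2 := key (P.ruleLen i σ s / 3) ⟨by linarith, by linarith⟩
  have h3 : 2 * inner ℝ (A r') w + inner ℝ w w = 0 := by
    have : P.ruleLen i σ s / 6 * (2 * inner ℝ (A r') w + inner ℝ w w) = 0 := by linarith
    exact (mul_eq_zero.1 this).resolve_left (by positivity)
  have h4 : inner ℝ (A t) w = 0 := by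
    rw [h3, mul_zero, add_zero] at h1
    simpa [σ.dir_ne_zero] using h1
  have h5 : inner ℝ (A r) w = 0 := by
    have := hf.inner_deriv_sideDeriv (σ := σ) hr hs r r
    rw [← hw, ← hA, real_inner_comm] at this
    linarith
  -- The ruling and the tangent span the plane, so `w` is orthogonal to the range of `A`.
  have h6 : inner ℝ (A (P.normal i s)) w = 0 := by
    rw [hrd, ruleDir, map_add, map_smul, map_smul, inner_add_left, real_inner_smul_left,
      real_inner_smul_left, ← ht, h4, mul_zero, zero_add] at h5
    exact (mul_eq_zero.1 h5).resolve_left (P.sin_angle_pos σ hs).ne'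
  have h7 : inner ℝ (A r') w = 0 := by
    rw [eq_inner_smul_add_inner_turnLeft_smul (P.norm_tangent hs) r', map_add, map_smul, map_smul,
      inner_add_left, real_inner_smul_left, real_inner_smul_left, ← ht, h4]
    rw [show turnLeft t = P.normal i s from rfl, h6]
    simp
  rw [h7, mul_zero, zero_add, inner_self_eq_zero] at h3
  exact h3

/-- The tangent plane of a folded state is constant along each rule segment. -/
theorem fderiv_rulePoint [Finite ι] (hf : P.IsFoldedState f)
    (hr : P.IsUniquelyRuled) (hV : P.IsVertexFree) (hs : s ∈ Ioo 0 (P.len i))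
    (hv : v ∈ Ioo 0 (P.ruleLen i σ s)) :
    fderiv ℝ f (P.rulePoint i σ s v) = P.sideDeriv f i σ s := by
  have h1 := hf.fderiv_apply_rulePoint hr hV hs hv
  rw [hf.deriv_sideDeriv_ruleDir hr hV hs, smul_zero, add_zero] at h1
  have h2 : fderiv ℝ f (P.rulePoint i σ s v) (P.ruleDir i σ s) =
      P.sideDeriv f i σ s (P.ruleDir i σ s) := by
    have h3 := (hf.differentiableAt_of_mem_ruleSegment hr hV hs hv).hasFDerivAt.comp_hasDerivAt
      (f := fun x => P.rulePoint i σ s x) v (P.hasDerivAt_rulePoint_right i σ s v)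
    have h4 : HasDerivAt (fun x : ℝ => f (P.crease i s) +
        (x * σ.dir) • P.sideDeriv f i σ s (P.ruleDir i σ s))
        (σ.dir • P.sideDeriv f i σ s (P.ruleDir i σ s)) v := by
      simpa using (((hasDerivAt_id v).mul_const σ.dir).smul_const
        (P.sideDeriv f i σ s (P.ruleDir i σ s))).const_add (f (P.crease i s))
    have h5 : ∀ᶠ x in 𝓝 v, (f ∘ fun x => P.rulePoint i σ s x) x = f (P.crease i s) +
        (x * σ.dir) • P.sideDeriv f i σ s (P.ruleDir i σ s) := by
      filter_upwards [isOpen_Ioo.mem_nhds hv] with x hx using hf.apply_rulePoint hs hx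
    have h6 := h3.unique (h4.congr_of_eventuallyEq h5)
    rw [map_smul] at h6
    exact smul_right_injective _ σ.dir_ne_zero h6
  -- Two linear maps that agree on the ruling and on the velocity of the rule point are equal.
  set D := fderiv ℝ f (P.rulePoint i σ s v) with hD
  set A := P.sideDeriv f i σ s with hA
  set r := P.ruleDir i σ s with hrr
  set z := P.tangent i s + (σ.dir * v) • deriv (P.ruleDir i σ) s with hz
  have hJ : inner ℝ z (turnLeft r) ≠ 0 := (hr.ruleJac_neg hV hs hv.1.le hv.2).ne
  have hn : ‖r‖ = 1 := P.norm_ruleDir hs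
  have h7 : D (turnLeft r) = A (turnLeft r) := by
    rw [eq_inner_smul_add_inner_turnLeft_smul hn z, map_add, map_add, map_smul, map_smul, map_smul,
      map_smul, h2, add_right_inj] at h1
    exact smul_right_injective _ hJ h1
  ext1 x
  rw [eq_inner_smul_add_inner_turnLeft_smul hn x, map_add, map_add, map_smul, map_smul, map_smul,
    map_smul, h2, h7]

/-- A proper fold has two different tangent planes. -/
theorem sideDeriv_left_ne_right (hf : P.IsFoldedState f) (hs : s ∈ Ioo 0 (P.len i)) :
    P.sideDeriv f i Side.left s ≠ P.sideDeriv f i Side.right s := by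
  intro heq
  obtain ⟨g, hg2, hg⟩ := hf.contDiff_side i Side.left s hs
  obtain ⟨h, hh2, hh⟩ := hf.contDiff_side i Side.right s hs
  obtain ⟨E, hE⟩ := P.exists_isLocalInverseAt_ruleMap hs (P.ruleJac_zero_neg Side.left hs).ne
  obtain ⟨E', hE'⟩ := P.exists_isLocalInverseAt_ruleMap hs (P.ruleJac_zero_neg Side.right hs).ne
  have h1 : HasFDerivAt g (P.sideDeriv f i Side.left s) (P.crease i s) := by
    rw [(eventually_sideDeriv_eq hs hg2 hg).self_of_nhds]
    exact (hg2.differentiableAt (by simp)).hasFDerivAt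
  have h2 : HasFDerivAt h (P.sideDeriv f i Side.left s) (P.crease i s) := by
    rw [heq, (eventually_sideDeriv_eq hs hh2 hh).self_of_nhds]
    exact (hh2.differentiableAt (by simp)).hasFDerivAt
  refine hf.folded i s hs (HasFDerivAt.of_eventually_eq_or_eq h1 h2 ?_ ?_ ?_).differentiableAt
  · simpa using (hg.self_of_nhds le_rfl).symm
  · simpa using (hh.self_of_nhds le_rfl).symm
  have hEt := hE.tendsto.eventually hg
  have hEt' := hE'.tendsto.eventually hh
  have hEr := hE.right_inv
  have hEr' := hE'.right_inv
  rw [ruleMap_zero] at hEt hEt' hEr hEr'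
  filter_upwards [eventually_opposite_sides hs hE hE', hEt, hEt', hEr, hEr'] with q h3 h4 h5 h6 h7
  change _ → f (P.ruleMap i Side.left (E q)) = g (P.ruleMap i Side.left (E q)) at h4
  change _ → f (P.ruleMap i Side.right (E' q)) = h (P.ruleMap i Side.right (E' q)) at h5
  rw [h6] at h4
  rw [h7] at h5
  rcases h3 with h3 | h3 | h3
  · exact Or.inl (h4 h3.1.le)
  · exact Or.inl (h4 h3.1.ge)
  · exact Or.inr (h5 h3.2.le)

end IsFoldedState

/-! ### The fold angle of a folded state -/

/-- The unit normal of a folded state at a crease point, on one side of the crease. -/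
noncomputable def sideNormal (P : CreaseRulePattern ι) (f : Plane → Space) (i : ι) (σ : Side)
    (s : ℝ) : Space :=
  Space.cross (P.sideDeriv f i σ s (P.tangent i s)) (P.sideDeriv f i σ s (P.normal i s))

/-- The normal curvature of a folded crease with respect to the surface on one side of it. -/
noncomputable def sideCurv (P : CreaseRulePattern ι) (f : Plane → Space) (i : ι) (σ : Side)
    (s : ℝ) : ℝ :=
  inner ℝ (deriv (P.sideDeriv f i σ) s (P.tangent i s)) (P.sideNormal f i σ s)

/-- The cosine of the fold angle of a folded state: the angle by which the surface turns about
the folded crease from its left side to its right side. -/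
noncomputable def foldCos (P : CreaseRulePattern ι) (f : Plane → Space) (i : ι) (s : ℝ) : ℝ :=
  inner ℝ (P.sideDeriv f i Side.right s (P.normal i s)) (P.sideDeriv f i Side.left s (P.normal i s))

/-- The sine of the fold angle of a folded state. -/
noncomputable def foldSin (P : CreaseRulePattern ι) (f : Plane → Space) (i : ι) (s : ℝ) : ℝ :=
  inner ℝ (P.sideDeriv f i Side.right s (P.normal i s)) (P.sideNormal f i Side.left s)

/-- The fold angle of a folded state, recovered from the tangent of its half. The denominator
vanishes only for a crease folded flat, which a curved crease is not
(`IsFoldedState.foldCos_add_one_ne_zero`). -/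
noncomputable def foldAngle (P : CreaseRulePattern ι) (f : Plane → Space) (i : ι) (s : ℝ) : ℝ :=
  2 * Real.arctan (P.foldSin f i s / (1 + P.foldCos f i s))

theorem inner_normal_self (hs : s ∈ Ioo 0 (P.len i)) :
    inner ℝ (P.normal i s) (P.normal i s) = (1 : ℝ) := by
  rw [real_inner_self_eq_norm_sq, P.norm_normal hs, one_pow]

namespace IsFoldedState

section frame

variable (hf : P.IsFoldedState f) (hr : P.IsUniquelyRuled) (hs : s ∈ Ioo 0 (P.len i))
include hf hr hs

theorem inner_tt : inner ℝ (P.sideDeriv f i σ s (P.tangent i s))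
    (P.sideDeriv f i σ s (P.tangent i s)) = (1 : ℝ) := by
  rw [hf.inner_sideDeriv_apply hr hs, P.inner_tangent_self hs]

theorem inner_nn : inner ℝ (P.sideDeriv f i σ s (P.normal i s))
    (P.sideDeriv f i σ s (P.normal i s)) = (1 : ℝ) := by
  rw [hf.inner_sideDeriv_apply hr hs, inner_normal_self hs]

theorem inner_tn : inner ℝ (P.sideDeriv f i σ s (P.tangent i s))
    (P.sideDeriv f i σ s (P.normal i s)) = (0 : ℝ) := by
  rw [hf.inner_sideDeriv_apply hr hs, P.inner_tangent_normal]

theorem inner_sideNormal_self :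
    inner ℝ (P.sideNormal f i σ s) (P.sideNormal f i σ s) = (1 : ℝ) := by
  rw [sideNormal, Space.inner_cross_cross, hf.inner_tt hr hs, hf.inner_nn hr hs,
    hf.inner_tn hr hs]
  norm_num

end frame

theorem deriv_sideDeriv_tangent [Finite ι] (hf : P.IsFoldedState f)
    (hr : P.IsUniquelyRuled) (hV : P.IsVertexFree) (hs : s ∈ Ioo 0 (P.len i)) :
    deriv (P.sideDeriv f i σ) s (P.tangent i s) =
      P.sideCurv f i σ s • P.sideNormal f i σ s := by
  have h1 := hf.inner_deriv_sideDeriv (σ := σ) hr hs (P.tangent i s) (P.tangent i s)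
  rw [real_inner_comm (deriv (P.sideDeriv f i σ) s (P.tangent i s))] at h1
  have h2 := hf.inner_deriv_sideDeriv (σ := σ) hr hs (P.tangent i s) (P.ruleDir i σ s)
  rw [hf.deriv_sideDeriv_ruleDir hr hV hs, inner_zero_right, add_zero, ruleDir, map_add, map_smul,
    map_smul, inner_add_right, real_inner_smul_right, real_inner_smul_right] at h2
  have h3 : inner ℝ (deriv (P.sideDeriv f i σ) s (P.tangent i s))
      (P.sideDeriv f i σ s (P.tangent i s)) = 0 := by linarith
  rw [h3, mul_zero, zero_add] at h2
  have h4 := (mul_eq_zero.1 h2).resolve_left (P.sin_angle_pos σ hs).ne'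
  have h5 := Space.eq_inner_smul_add (hf.inner_tt (σ := σ) hr hs) (hf.inner_nn hr hs)
    (hf.inner_tn hr hs) (deriv (P.sideDeriv f i σ) s (P.tangent i s))
  rw [h3, h4, zero_smul, zero_smul, zero_add, zero_add] at h5
  exact h5

theorem deriv_sideDeriv_normal [Finite ι] (hf : P.IsFoldedState f)
    (hr : P.IsUniquelyRuled) (hV : P.IsVertexFree) (hs : s ∈ Ioo 0 (P.len i)) :
    deriv (P.sideDeriv f i σ) s (P.normal i s) =
      -(Real.cot (P.angle i σ s) * P.sideCurv f i σ s) • P.sideNormal f i σ s := by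
  have h1 := hf.deriv_sideDeriv_ruleDir (σ := σ) hr hV hs
  rw [ruleDir, map_add, map_smul, map_smul, hf.deriv_sideDeriv_tangent hr hV hs] at h1
  have h2 := (P.sin_angle_pos σ hs).ne'
  refine smul_right_injective _ h2 ?_
  change Real.sin (P.angle i σ s) • _ = Real.sin (P.angle i σ s) • _
  rw [eq_neg_of_add_eq_zero_right h1, Real.cot_eq_cos_div_sin, smul_smul, smul_smul, ← neg_smul]
  congr 1
  field_simp

/-- The rotation of the tangent plane takes place about the rule line. -/
theorem deriv_sideDeriv_apply [Finite ι] (hf : P.IsFoldedState f)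
    (hr : P.IsUniquelyRuled) (hV : P.IsVertexFree) (hs : s ∈ Ioo 0 (P.len i)) (w : Plane) :
    deriv (P.sideDeriv f i σ) s w =
      -(P.sideCurv f i σ s / Real.sin (P.angle i σ s) *
        inner ℝ w (turnLeft (P.ruleDir i σ s))) • P.sideNormal f i σ s := by
  have h2 := (P.sin_angle_pos σ hs).ne'
  conv_lhs => rw [eq_inner_smul_add_inner_turnLeft_smul (P.norm_tangent hs) w]
  rw [show turnLeft (P.tangent i s) = P.normal i s from rfl, map_add, map_smul, map_smul,
    hf.deriv_sideDeriv_normal hr hV hs, hf.deriv_sideDeriv_tangent hr hV hs, smul_smul, smul_smul,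
    ← add_smul, P.turnLeft_ruleDir, inner_add_right, real_inner_smul_right, real_inner_smul_right,
    Real.cot_eq_cos_div_sin]
  congr 1
  field_simp
  ring

theorem sideDeriv_tangent_eq (hf : P.IsFoldedState f) (hs : s ∈ Ioo 0 (P.len i)) :
    P.sideDeriv f i Side.right s (P.tangent i s) = P.sideDeriv f i Side.left s (P.tangent i s) :=
  (hf.hasDerivAt_crease_image Side.right hs).unique (hf.hasDerivAt_crease_image Side.left hs)

/-- The acceleration of the folded crease, computed on both sides. -/
theorem sideCurv_smul_add_eq [Finite ι] (hf : P.IsFoldedState f)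
    (hr : P.IsUniquelyRuled) (hV : P.IsVertexFree) (hs : s ∈ Ioo 0 (P.len i)) :
    P.sideCurv f i Side.left s • P.sideNormal f i Side.left s +
        P.curvature i s • P.sideDeriv f i Side.left s (P.normal i s) =
      P.sideCurv f i Side.right s • P.sideNormal f i Side.right s +
        P.curvature i s • P.sideDeriv f i Side.right s (P.normal i s) := by
  have h1 : ∀ σ, HasDerivAt (fun x => P.sideDeriv f i σ x (P.tangent i x))
      (P.sideCurv f i σ s • P.sideNormal f i σ s +
        P.curvature i s • P.sideDeriv f i σ s (P.normal i s)) s := fun σ => by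
    have h := (hf.hasDerivAt_sideDeriv (σ := σ) hs).clm_apply (P.hasDerivAt_tangent hs)
    rwa [hf.deriv_sideDeriv_tangent hr hV hs, map_smul] at h
  refine (h1 Side.left).unique ((h1 Side.right).congr_of_eventuallyEq ?_)
  filter_upwards [P.eventually_mem_Ioo hs] with x hx using (hf.sideDeriv_tangent_eq hx).symm

section fold

variable (hf : P.IsFoldedState f) (hr : P.IsUniquelyRuled) (hs : s ∈ Ioo 0 (P.len i))
include hf hr hs

theorem normal_right_eq : P.sideDeriv f i Side.right s (P.normal i s) =
    P.foldCos f i s • P.sideDeriv f i Side.left s (P.normal i s) +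
      P.foldSin f i s • P.sideNormal f i Side.left s := by
  have h := Space.eq_inner_smul_add (hf.inner_tt (σ := Side.left) hr hs) (hf.inner_nn hr hs)
    (hf.inner_tn hr hs) (P.sideDeriv f i Side.right s (P.normal i s))
  rw [← hf.sideDeriv_tangent_eq hs, real_inner_comm, hf.inner_tn hr hs, zero_smul, zero_add,
    hf.sideDeriv_tangent_eq hs] at h
  exact h

theorem foldCos_sq_add_foldSin_sq : P.foldCos f i s ^ 2 + P.foldSin f i s ^ 2 = 1 := by
  have h := hf.inner_nn (σ := Side.right) hr hs
  conv_lhs at h => rw [hf.normal_right_eq hr hs]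
  simp only [inner_add_left, inner_add_right, real_inner_smul_left, real_inner_smul_right] at h
  rw [hf.inner_nn hr hs, hf.inner_sideNormal_self hr hs] at h
  have h0 : inner ℝ (P.sideNormal f i Side.left s) (P.sideDeriv f i Side.left s (P.normal i s)) = 0 :=
    Space.inner_cross_right _ _
  have h2 : inner ℝ (P.sideDeriv f i Side.left s (P.normal i s)) (P.sideNormal f i Side.left s)
      = 0 := by rw [real_inner_comm]; exact h0
  rw [h0, h2] at h
  linear_combination h

omit hr in
theorem inner_sideNormal_right_normal_left :
    inner ℝ (P.sideNormal f i Side.right s) (P.sideDeriv f i Side.left s (P.normal i s)) =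
      -P.foldSin f i s := by
  rw [sideNormal, Space.inner_cross_swap, foldSin, sideNormal, hf.sideDeriv_tangent_eq hs]

theorem inner_sideNormal_right_left :
    inner ℝ (P.sideNormal f i Side.right s) (P.sideNormal f i Side.left s) = P.foldCos f i s := by
  rw [sideNormal, sideNormal, hf.sideDeriv_tangent_eq hs, Space.inner_cross_cross,
    hf.inner_tt hr hs, hf.inner_tn hr hs, foldCos]
  ring

end fold

section curved

variable [Finite ι] (hf : P.IsFoldedState f) (hr : P.IsUniquelyRuled) (hV : P.IsVertexFree)
  (hs : s ∈ Ioo 0 (P.len i))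
include hf hr hV hs

theorem sideCurv_left_mul_foldSin : P.sideCurv f i Side.left s * P.foldSin f i s +
    P.curvature i s * P.foldCos f i s = P.curvature i s := by
  have h := congrArg (fun z => inner ℝ z (P.sideDeriv f i Side.right s (P.normal i s)))
    (hf.sideCurv_smul_add_eq hr hV hs)
  simp only [inner_add_left, real_inner_smul_left] at h
  rw [hf.inner_nn hr hs, show inner ℝ (P.sideNormal f i Side.right s)
    (P.sideDeriv f i Side.right s (P.normal i s)) = 0 from Space.inner_cross_right _ _,
    real_inner_comm, real_inner_comm (P.sideDeriv f i Side.right s (P.normal i s))] at h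
  rw [foldSin, foldCos]
  linarith

theorem sideCurv_right_eq : P.sideCurv f i Side.right s =
    P.sideCurv f i Side.left s * P.foldCos f i s - P.curvature i s * P.foldSin f i s := by
  have h := congrArg (fun z => inner ℝ z (P.sideNormal f i Side.right s))
    (hf.sideCurv_smul_add_eq hr hV hs)
  simp only [inner_add_left, real_inner_smul_left] at h
  rw [hf.inner_sideNormal_self hr hs, real_inner_comm, hf.inner_sideNormal_right_left hr hs,
    real_inner_comm, hf.inner_sideNormal_right_normal_left hs,
    real_inner_comm _ (P.sideDeriv f i Side.right s (P.normal i s)),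
    show inner ℝ (P.sideNormal f i Side.right s)
    (P.sideDeriv f i Side.right s (P.normal i s)) = 0 from Space.inner_cross_right _ _] at h
  linarith

/-- A curved crease cannot be folded flat: its acceleration is the same vector as seen from both
sides. -/
theorem foldCos_add_one_ne_zero (hk : P.curvature i s ≠ 0) : 1 + P.foldCos f i s ≠ 0 := by
  intro h
  have h1 := hf.foldCos_sq_add_foldSin_sq hr hs
  have h2 := hf.sideCurv_left_mul_foldSin hr hV hs
  have h3 : P.foldCos f i s = -1 := by linarith
  have h4 : P.foldSin f i s = 0 := by
    rw [h3] at h1; nlinarith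
  rw [h3, h4] at h2
  apply hk; linarith

theorem foldSin_ne_zero (hk : P.curvature i s ≠ 0) : P.foldSin f i s ≠ 0 := by
  intro h
  have h1 := hf.foldCos_sq_add_foldSin_sq hr hs
  have h2 := hf.foldCos_add_one_ne_zero hr hV hs hk
  rw [h] at h1
  have h3 : P.foldCos f i s = 1 := by
    have : (1 + P.foldCos f i s) * (P.foldCos f i s - 1) = 0 := by linear_combination h1
    linarith [(mul_eq_zero.1 this).resolve_left h2]
  have h4 := hf.normal_right_eq hr hs
  rw [h, h3, one_smul, zero_smul, add_zero] at h4
  refine hf.sideDeriv_left_ne_right hs ?_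
  ext1 x
  rw [eq_inner_smul_add_inner_turnLeft_smul (P.norm_tangent hs) x]
  rw [show turnLeft (P.tangent i s) = P.normal i s from rfl]
  simp only [map_add, map_smul, h4, hf.sideDeriv_tangent_eq hs]

/-- On either side, the normal curvature of the folded crease is determined by its curvature and
its fold angle: the osculating plane bisects the two tangent planes. -/
theorem sideCurv_eq (hk : P.curvature i s ≠ 0) (σ : Side) : P.sideCurv f i σ s =
    σ.dir * P.curvature i s * (P.foldSin f i s / (1 + P.foldCos f i s)) := by
  have h1 := hf.foldCos_sq_add_foldSin_sq hr hs
  have h2 := hf.foldCos_add_one_ne_zero hr hV hs hk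
  have h3 := hf.sideCurv_left_mul_foldSin hr hV hs
  have h4 := hf.foldSin_ne_zero hr hV hs hk
  have h5 : P.sideCurv f i Side.left s =
      P.curvature i s * (P.foldSin f i s / (1 + P.foldCos f i s)) := by
    field_simp
    refine mul_right_cancel₀ h4 ?_
    linear_combination (1 + P.foldCos f i s) * h3 - P.curvature i s * h1
  cases σ
  · rw [h5]; simp [Side.dir]
  · rw [hf.sideCurv_right_eq hr hV hs, h5]
    simp only [Side.dir]
    field_simp
    ring

theorem hasDerivAt_normal_image (σ : Side) : HasDerivAt
    (fun x => P.sideDeriv f i σ x (P.normal i x))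
    (-(Real.cot (P.angle i σ s) * P.sideCurv f i σ s) • P.sideNormal f i σ s -
      P.curvature i s • P.sideDeriv f i σ s (P.tangent i s)) s := by
  have h := (hf.hasDerivAt_sideDeriv (σ := σ) hs).clm_apply (P.hasDerivAt_normal hs)
  rw [hf.deriv_sideDeriv_normal hr hV hs, map_smul, neg_smul (P.curvature i s),
    ← sub_eq_add_neg] at h
  exact h

theorem hasDerivAt_foldCos : HasDerivAt (P.foldCos f i)
    (P.foldSin f i s * (Real.cot (P.angle i Side.right s) * P.sideCurv f i Side.right s -
      Real.cot (P.angle i Side.left s) * P.sideCurv f i Side.left s)) s := by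
  have h := (hf.hasDerivAt_normal_image hr hV hs Side.right).inner ℝ
    (hf.hasDerivAt_normal_image hr hV hs Side.left)
  refine h.congr_deriv ?_
  simp only [inner_sub_left, inner_sub_right, real_inner_smul_left, real_inner_smul_right]
  rw [hf.inner_sideNormal_right_normal_left hs, hf.sideDeriv_tangent_eq hs,
    hf.inner_tn hr hs, ← hf.sideDeriv_tangent_eq hs, real_inner_comm
      (P.sideDeriv f i Side.right s (P.tangent i s)), hf.inner_tn hr hs, foldSin]
  ring

theorem hasDerivAt_foldSin : HasDerivAt (P.foldSin f i)
    (-P.foldCos f i s * (Real.cot (P.angle i Side.right s) * P.sideCurv f i Side.right s -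
      Real.cot (P.angle i Side.left s) * P.sideCurv f i Side.left s)) s := by
  have hn := hf.hasDerivAt_normal_image hr hV hs Side.left
  have hN : HasDerivAt (P.sideNormal f i Side.left) (deriv (P.sideNormal f i Side.left) s) s :=
    (Space.differentiableAt_cross
      ((hf.hasDerivAt_sideDeriv hs).clm_apply (P.hasDerivAt_tangent hs)).differentiableAt
      hn.differentiableAt).hasDerivAt
  set N' := deriv (P.sideNormal f i Side.left) s with hN'
  have h1 : inner ℝ (P.sideNormal f i Side.left s) N' = 0 := by
    rw [real_inner_comm]
    refine hN.inner_eq_zero_of_norm_eq_one ?_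
    filter_upwards [P.eventually_mem_Ioo hs] with x hx
    rw [← sq_eq_sq₀ (norm_nonneg _) zero_le_one, ← real_inner_self_eq_norm_sq,
      hf.inner_sideNormal_self hr hx, one_pow]
  have h2 : inner ℝ (P.sideDeriv f i Side.left s (P.normal i s)) N' =
      Real.cot (P.angle i Side.left s) * P.sideCurv f i Side.left s := by
    have h3 := (hn.inner ℝ hN).unique ((hasDerivAt_const s (0 : ℝ)).congr_of_eventuallyEq (by
      filter_upwards with x
      rw [real_inner_comm]; exact Space.inner_cross_right _ _))
    rw [inner_sub_left, real_inner_smul_left, real_inner_smul_left,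
      hf.inner_sideNormal_self hr hs, real_inner_comm (P.sideNormal f i Side.left s)
        (P.sideDeriv f i Side.left s (P.tangent i s)),
      show inner ℝ (P.sideNormal f i Side.left s) (P.sideDeriv f i Side.left s (P.tangent i s)) = 0
      from Space.inner_cross_left _ _] at h3
    linarith
  have h := (hf.hasDerivAt_normal_image hr hV hs Side.right).inner ℝ hN
  refine h.congr_deriv ?_
  conv_lhs => rw [hf.normal_right_eq hr hs]
  simp only [inner_sub_left, inner_add_left, real_inner_smul_left]
  rw [h1, h2, hf.inner_sideNormal_right_left hr hs, hf.sideDeriv_tangent_eq hs,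
    real_inner_comm (P.sideNormal f i Side.left s) (P.sideDeriv f i Side.left s (P.tangent i s)),
      show inner ℝ (P.sideNormal f i Side.left s) (P.sideDeriv f i Side.left s (P.tangent i s)) = 0
      from Space.inner_cross_left _ _]
  ring

/-- The fold angle solves the ruling equation, in the form `ρ' = k tan (ρ / 2) (cot θ_L + cot θ_R)`.
-/
theorem hasDerivAt_foldAngle (hk : P.curvature i s ≠ 0) : HasDerivAt (P.foldAngle f i)
    (P.curvature i s * (P.foldSin f i s / (1 + P.foldCos f i s)) *
      (Real.cot (P.angle i Side.left s) + Real.cot (P.angle i Side.right s))) s := by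
  have h1 := hf.foldCos_sq_add_foldSin_sq hr hs
  have h2 := hf.foldCos_add_one_ne_zero hr hV hs hk
  have h := (((hf.hasDerivAt_foldSin hr hV hs).div
    ((hf.hasDerivAt_foldCos hr hV hs).const_add 1) h2).arctan).const_mul 2
  refine h.congr_deriv ?_
  rw [hf.sideCurv_eq hr hV hs hk, hf.sideCurv_eq hr hV hs hk]
  simp only [Side.dir]
  set c := P.foldCos f i s
  set d := P.foldSin f i s
  have h3 : 1 + (d / (1 + c)) ^ 2 = 2 / (1 + c) := by
    field_simp
    linear_combination h1
  simp only [Pi.div_apply]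
  rw [h3]
  field_simp
  linear_combination (d *
    (Real.cot (P.angle i Side.left s) + Real.cot (P.angle i Side.right s))) * h1

end curved

theorem foldAngle_div_two : P.foldAngle f i s / 2 =
    Real.arctan (P.foldSin f i s / (1 + P.foldCos f i s)) := by
  rw [foldAngle]; ring

theorem isFoldAngleAssignment [Finite ι] (hf : P.IsFoldedState f) (hk : P.IsCurved)
    (hr : P.IsUniquelyRuled) (hV : P.IsVertexFree) :
    P.IsFoldAngleAssignment (P.foldAngle f) where
  differentiableAt i s hs := (hf.hasDerivAt_foldAngle hr hV hs (hk i s hs)).differentiableAt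
  mem i s hs := by
    have h := Real.arctan_mem_Ioo (P.foldSin f i s / (1 + P.foldCos f i s))
    rw [foldAngle]
    constructor <;> linarith [h.1, h.2]
  ne_zero i s hs := by
    rw [foldAngle, mul_ne_zero_iff, Ne, Ne, Real.arctan_eq_zero_iff, div_eq_zero_iff, not_or]
    exact ⟨two_ne_zero, hf.foldSin_ne_zero hr hV hs (hk i s hs),
      hf.foldCos_add_one_ne_zero hr hV hs (hk i s hs)⟩

theorem rulingEquation [Finite ι] (hf : P.IsFoldedState f) (hk : P.IsCurved)
    (hr : P.IsUniquelyRuled) (hV : P.IsVertexFree) : P.RulingEquation (P.foldAngle f) := by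
  intro i s hs
  have h1 := hf.foldCos_add_one_ne_zero hr hV hs (hk i s hs)
  have h2 := hf.foldSin_ne_zero hr hV hs (hk i s hs)
  have h3 := hk i s hs
  rw [(hf.hasDerivAt_foldAngle hr hV hs h3).deriv, foldAngle_div_two,
    ← Real.tan_inv_eq_cot (Real.arctan _),
    Real.tan_arctan]
  field_simp

theorem compatibilityEquation [Finite ι] (hf : P.IsFoldedState f) (hk : P.IsCurved)
    (hr : P.IsUniquelyRuled) (hV : P.IsVertexFree) : P.CompatibilityEquation (P.foldAngle f) := by
  intro i σ j τ a b t ha hb hJ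
  have hJt := hJ.self_of_nhds
  have hs := hJt.1
  have hu := hJt.2.1
  -- The tangent planes at the two ends agree, being those along the common rule segment.
  have hmid : ∀ {x y}, P.Joins i σ x j τ y → P.sideDeriv f i σ x = P.sideDeriv f j τ y := by
    intro x y h
    have h1 := P.ruleLen_pos i σ x h.1
    have h2 := h.ruleLen_eq_and_dir_eq.1
    rw [← hf.fderiv_rulePoint hr hV h.1 (v := P.ruleLen i σ x / 2) ⟨by linarith, by linarith⟩,
      ← hf.fderiv_rulePoint hr hV h.2.1 (v := P.ruleLen i σ x / 2) ⟨by linarith, by linarith⟩,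
      ← h.rulePoint_eq]
    congr 2; ring
  have h1 := (hf.hasDerivAt_sideDeriv (σ := σ) hs).scomp t ha.hasDerivAt
  have h2 := (hf.hasDerivAt_sideDeriv (σ := τ) hu).scomp t hb.hasDerivAt
  have h3 := h1.unique (h2.congr_of_eventuallyEq (hJ.mono fun x hx => hmid hx))
  -- The unit normal does not depend on the positively oriented orthonormal frame that defines it.
  have hN : P.sideNormal f j τ (b t) = P.sideNormal f i σ (a t) := by
    have h4 : ∀ (w : Plane), ‖w‖ = 1 → ∀ A : Plane →L[ℝ] Space,
        Space.cross (A w) (A (turnLeft w)) = Space.cross (A !₂[1, 0]) (A !₂[0, 1]) := by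
      intro w hw A
      have h5 : w 0 * w 0 + w 1 * w 1 = 1 := by
        rw [← Plane.inner_eq, real_inner_self_eq_norm_sq, hw]; norm_num
      have h6 : w = w 0 • !₂[1, 0] + w 1 • !₂[0, 1] := by apply Plane.ext <;> simp
      have h7 : turnLeft w = (-(w 1)) • !₂[1, 0] + w 0 • !₂[0, 1] := by apply Plane.ext <;> simp
      rw [h7, map_add, map_smul, map_smul]
      conv_lhs => rw [h6]
      rw [map_add, map_smul, map_smul]
      ext k
      fin_cases k
      · simp [-map_smul]
        linear_combination (A !₂[1, 0] 1 * A !₂[0, 1] 2 - A !₂[1, 0] 2 * A !₂[0, 1] 1) * h5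
      · simp [-map_smul]
        linear_combination (A !₂[1, 0] 2 * A !₂[0, 1] 0 - A !₂[1, 0] 0 * A !₂[0, 1] 2) * h5
      · simp [-map_smul]
        linear_combination (A !₂[1, 0] 0 * A !₂[0, 1] 1 - A !₂[1, 0] 1 * A !₂[0, 1] 0) * h5
    rw [sideNormal, sideNormal, normal, normal, h4 _ (P.norm_tangent hu),
      h4 _ (P.norm_tangent hs), hmid hJt]
  set n := turnLeft (P.ruleDir i σ (a t)) with hn
  have hdir := hJt.ruleLen_eq_and_dir_eq.2
  have hdir' : turnLeft (P.ruleDir j τ (b t)) = -(τ.dir * σ.dir) • n := by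
    have h4 : P.ruleDir j τ (b t) = -(τ.dir * σ.dir) • P.ruleDir i σ (a t) := by
      rw [← one_smul ℝ (P.ruleDir j τ (b t)), ← τ.dir_mul_dir, mul_smul, hdir]
      module
    rw [h4, turnLeft_smul]
  have hnn : inner ℝ n n = (1 : ℝ) := by
    rw [hn, inner_turnLeft_turnLeft, P.inner_ruleDir_self hs]
  have h5 := congrArg (fun L : Plane →L[ℝ] Space => inner ℝ (L n) (P.sideNormal f i σ (a t))) h3
  simp only [smul_apply] at h5
  rw [hf.deriv_sideDeriv_apply hr hV hs, hf.deriv_sideDeriv_apply hr hV hu, hN, hdir',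
    real_inner_smul_right n, ← hn, hnn] at h5
  simp only [real_inner_smul_left, hf.inner_sideNormal_self hr hs] at h5
  rw [hf.sideCurv_eq hr hV hs (hk _ _ hs), hf.sideCurv_eq hr hV hu (hk _ _ hu)] at h5
  rw [foldAngle_div_two, foldAngle_div_two, Real.tan_arctan, Real.tan_arctan]
  refine mul_left_cancel₀ σ.dir_ne_zero ?_
  linear_combination -h5 - (deriv b t / Real.sin (P.angle j τ (b t)) * P.curvature j (b t) *
    (P.foldSin f j (b t) / (1 + P.foldCos f j (b t))) * σ.dir) * τ.dir_mul_dir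

end IsFoldedState

end CreaseRulePattern

/-! ### Rigid motions of space -/

/-- The rigid motions (affine isometries) of space. -/
abbrev Motion : Type := Space ≃ᵃⁱ[ℝ] Space

namespace Motion

/-- The linear part of a rigid motion. -/
noncomputable def lin (m : Motion) : Space →L[ℝ] Space :=
  (m.linearIsometryEquiv.toContinuousLinearEquiv : Space →L[ℝ] Space)

theorem apply_eq (m : Motion) (y : Space) : m y = lin m y + m 0 := by
  have h := m.map_vadd 0 y
  rw [vadd_eq_add, add_zero] at h
  exact h

theorem lin_mul (m m' : Motion) : lin (m * m') = lin m * lin m' := rfl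

theorem norm_lin_apply (m : Motion) (y : Space) : ‖lin m y‖ = ‖y‖ :=
  m.linearIsometryEquiv.norm_map y

theorem star_lin_mul (m : Motion) : star (lin m) * lin m = 1 :=
  (ContinuousLinearMap.norm_map_iff_adjoint_comp_self _).1 (norm_lin_apply m)

theorem mul_eq_one_symm {A B : Space →L[ℝ] Space} (h : A * B = 1) : B * A = 1 := by
  have h1 : (A : Space →ₗ[ℝ] Space) * (B : Space →ₗ[ℝ] Space) = 1 := by
    ext1 x; exact congrArg (fun L : Space →L[ℝ] Space => L x) h
  have h2 := mul_eq_one_comm.1 h1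
  ext1 x
  exact congrArg (fun L : Space →ₗ[ℝ] Space => L x) h2

theorem lin_mul_star (m : Motion) : lin m * star (lin m) = 1 := mul_eq_one_symm (star_lin_mul m)

theorem ext_lin {m m' : Motion} (h : lin m = lin m') (h0 : m 0 = m' 0) : m = m' := by
  ext1 y
  rw [apply_eq m, apply_eq m', h, h0]

open Classical in
/-- The rigid motion with linear part `A` and translation part `c`; the identity if `A` is not
orthogonal. -/
noncomputable def mk (A : Space →L[ℝ] Space) (c : Space) : Motion :=
  if h : A ∈ unitary (Space →L[ℝ] Space) then
    (Unitary.linearIsometryEquiv ⟨A, h⟩).toAffineIsometryEquiv.trans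
      (AffineIsometryEquiv.constVAdd ℝ Space c)
  else 1

theorem mem_unitary_of_mul_star {A : Space →L[ℝ] Space} (h : A * star A = 1) :
    A ∈ unitary (Space →L[ℝ] Space) := ⟨mul_eq_one_symm h, h⟩

theorem mk_apply {A : Space →L[ℝ] Space} (h : A * star A = 1) (c y : Space) :
    mk A c y = c + A y := by
  rw [mk, dif_pos (mem_unitary_of_mul_star h)]; rfl

theorem lin_mk {A : Space →L[ℝ] Space} (h : A * star A = 1) (c : Space) : lin (mk A c) = A := by
  ext1 y
  have h1 := apply_eq (mk A c) y
  rw [mk_apply h, mk_apply h, map_zero, add_zero, add_comm c, add_left_inj] at h1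
  exact h1.symm

theorem mk_zero {A : Space →L[ℝ] Space} (h : A * star A = 1) (c : Space) : mk A c 0 = c := by
  rw [mk_apply h, map_zero, add_zero]

end Motion

/-- The inclusion of the plane of the unfolded paper as the horizontal plane of space. -/
noncomputable def planeIncl : Plane →L[ℝ] Space :=
  LinearMap.toContinuousLinearMap
    { toFun := fun w => !₂[w 0, w 1, 0]
      map_add' := fun u v => by ext k; fin_cases k <;> simp
      map_smul' := fun c u => by ext k; fin_cases k <;> simp }

theorem planeIncl_apply (w : Plane) : planeIncl w = !₂[w 0, w 1, 0] := rfl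

theorem norm_planeIncl (w : Plane) : ‖planeIncl w‖ = ‖w‖ := by
  rw [← sq_eq_sq₀ (norm_nonneg _) (norm_nonneg _), ← real_inner_self_eq_norm_sq,
    ← real_inner_self_eq_norm_sq, Plane.inner_eq, Space.inner_eq, planeIncl_apply]
  change w 0 * w 0 + w 1 * w 1 + 0 * 0 = _
  ring

/-- The operator on Euclidean space of a `3 × 3` matrix. -/
noncomputable abbrev matOp (M : Matrix (Fin 3) (Fin 3) ℝ) : Space →L[ℝ] Space :=
  Matrix.toEuclideanCLM (𝕜 := ℝ) (n := Fin 3) M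

theorem hasDerivAt_matOp {M : ℝ → Matrix (Fin 3) (Fin 3) ℝ} {M' : Matrix (Fin 3) (Fin 3) ℝ}
    {s : ℝ} (h : ∀ i j, HasDerivAt (fun x => M x i j) (M' i j) s) :
    HasDerivAt (fun x => matOp (M x)) (matOp M') s := by
  have hsum : ∀ N : Matrix (Fin 3) (Fin 3) ℝ,
      matOp N = ∑ i, ∑ j, N i j • matOp (Matrix.single i j 1) := by
    intro N
    conv_lhs => rw [Matrix.matrix_eq_sum_single N]
    simp only [matOp, map_sum, ← map_smul, Matrix.smul_single, smul_eq_mul, mul_one]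
  rw [funext fun x => hsum (M x), hsum M']
  exact HasDerivAt.fun_sum fun i _ => HasDerivAt.fun_sum fun j _ => 
    by have := (h i j).smul_const (matOp (Matrix.single i j 1)); exact this

theorem matOp_apply (M : Matrix (Fin 3) (Fin 3) ℝ) (y : Space) (k : Fin 3) :
    matOp M y k = M k 0 * y 0 + M k 1 * y 1 + M k 2 * y 2 := by
  change (Matrix.toEuclideanCLM (𝕜 := ℝ) (n := Fin 3) M y).ofLp k = _
  rw [Matrix.ofLp_toEuclideanCLM, Matrix.mulVec, dotProduct, Fin.sum_univ_three]

theorem star_matOp (M : Matrix (Fin 3) (Fin 3) ℝ) : star (matOp M) = matOp M.transpose := by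
  rw [matOp, ← map_star, Matrix.star_eq_conjTranspose, Matrix.conjTranspose_eq_transpose_of_trivial]

/-- The infinitesimal rotation of space with a horizontal angular velocity `w`, that is, the vector
product with `w`. -/
noncomputable def spin : Plane →L[ℝ] (Space →L[ℝ] Space) :=
  LinearMap.toContinuousLinearMap
    { toFun := fun w => matOp !![0, 0, w 1; 0, 0, -(w 0); -(w 1), w 0, 0]
      map_add' := fun u v => by
        rw [matOp, ← map_add]; congr 1
        ext i j; fin_cases i <;> fin_cases j <;> simp [add_comm]
      map_smul' := fun c u => by
        rw [RingHom.id_apply, matOp, ← map_smul]; congr 1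
        ext i j; fin_cases i <;> fin_cases j <;> simp }

theorem spin_apply (w : Plane) :
    spin w = matOp !![0, 0, w 1; 0, 0, -(w 0); -(w 1), w 0, 0] := rfl

theorem star_spin (w : Plane) : star (spin w) = -spin w := by
  rw [spin_apply, star_matOp, matOp, ← map_neg]
  congr 1
  ext i j; fin_cases i <;> fin_cases j <;> simp

theorem spin_planeIncl_self (w : Plane) : spin w (planeIncl w) = 0 := by
  ext k
  rw [spin_apply, matOp_apply, planeIncl_apply]
  fin_cases k <;> simp
  ring

/-! ### Rolling motions -/

theorem mul_mul_star_add_eq_zero {R : Type*} [Ring R] [StarRing R] {w : R} (hw : star w = -w)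
    (a b : R) : a * w * star b + a * star (b * w) = 0 := by
  rw [star_mul, hw, neg_mul, mul_neg, mul_assoc, add_neg_cancel]

/-- The motion `M` rolls at `s`: in body coordinates, its velocity is a rotation with angular
velocity `w s` about an axis through the point `x s` of the horizontal plane. -/
structure RollsAt (w x : ℝ → Plane) (M : ℝ → Motion) (s : ℝ) : Prop where
  lin : HasDerivAt (fun z => (M z).lin) ((M s).lin * spin (w s)) s
  zero : HasDerivAt (fun z => M z 0) (-((M s).lin (spin (w s) (planeIncl (x s))))) s

theorem RollsAt.const_mul {w x : ℝ → Plane} {M : ℝ → Motion} {s : ℝ} (h : RollsAt w x M s)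
    (g : Motion) : RollsAt w x (fun z => g * M z) s where
  lin := by
    have := h.lin.const_mul g.lin
    rwa [← mul_assoc] at this
  zero := by
    have h1 := (g.lin.hasFDerivAt.comp_hasDerivAt s h.zero).add_const (g 0)
    rw [map_neg] at h1
    refine h1.congr_of_eventuallyEq (Eventually.of_forall fun z => ?_)
    exact Motion.apply_eq g (M z 0)

theorem exists_eventually_hasDerivAt {E : Type*} [NormedAddCommGroup E] [NormedSpace ℝ E]
    [CompleteSpace E] {h : ℝ → E} {s₀ : ℝ} (hh : ∀ᶠ s in 𝓝 s₀, ContinuousAt h s) :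
    ∃ c : ℝ → E, ∀ᶠ s in 𝓝 s₀, HasDerivAt c (h s) s := by
  obtain ⟨ε, hε, hball⟩ := Metric.eventually_nhds_iff_ball.1 hh
  have hcont : ContinuousOn h (Metric.ball s₀ ε) := fun s hs => (hball s hs).continuousWithinAt
  refine ⟨fun s => ∫ y in s₀..s, h y, ?_⟩
  filter_upwards [Metric.ball_mem_nhds s₀ hε] with s hs
  refine intervalIntegral.integral_hasDerivAt_right ?_
    (hcont.stronglyMeasurableAtFilter Metric.isOpen_ball s hs) (hball s hs)
  refine (hcont.mono ?_).intervalIntegrable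
  exact (convex_ball s₀ ε).ordConnected.uIcc_subset (Metric.mem_ball_self hε) hs

/-- A prescribed rolling is realized by a motion: the linear part solves a linear differential
equation, whose solution stays orthogonal, and the translation part is an integral. -/
theorem exists_eventually_rollsAt {w x : ℝ → Plane} {s₀ : ℝ}
    (hw : ∀ᶠ s in 𝓝 s₀, ContinuousAt w s) (hx : ∀ᶠ s in 𝓝 s₀, ContinuousAt x s) :
    ∃ M : ℝ → Motion, ∀ᶠ s in 𝓝 s₀, RollsAt w x M s := by
  have hsw : ∀ᶠ s in 𝓝 s₀, ContinuousAt (fun s => spin (w s)) s :=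
    hw.mono fun s hs => spin.continuous.continuousAt.comp hs
  obtain ⟨A, hA0, hA⟩ := exists_eventually_hasDerivAt_mul hsw (1 : Space →L[ℝ] Space)
  have hAA : ∀ᶠ s in 𝓝 s₀, A s * star (A s) = 1 := by
    have h1 : ∀ᶠ s in 𝓝 s₀, HasDerivAt (fun s => A s * star (A s)) 0 s := by
      filter_upwards [hA] with s hs
      exact (hs.mul hs.star).congr_deriv (mul_mul_star_add_eq_zero (star_spin _) _ _)
    filter_upwards [eventually_eq_of_eventually_hasDerivAt_zero h1] with s hs
    rw [hs, hA0, star_one, mul_one]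
  obtain ⟨c, hc⟩ := exists_eventually_hasDerivAt
    (h := fun s => -(A s (spin (w s) (planeIncl (x s))))) (s₀ := s₀) (by
      filter_upwards [hA, hsw, hx] with s h1 h2 h3
      exact (h1.continuousAt.clm_apply
        (h2.clm_apply (planeIncl.continuous.continuousAt.comp h3))).neg)
  refine ⟨fun s => Motion.mk (A s) (c s), ?_⟩
  filter_upwards [hA, eventually_eventually_nhds.2 hAA, hc] with s h1 h2 h3
  have h4 := h2.self_of_nhds
  constructor
  · rw [Motion.lin_mk h4]
    exact h1.congr_of_eventuallyEq (h2.mono fun z hz => Motion.lin_mk hz _)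
  · rw [Motion.lin_mk h4]
    exact h3.congr_of_eventuallyEq (h2.mono fun z hz => Motion.mk_zero hz _)

/-- Two motions that roll about the same axes, up to a change of parameter, differ by a fixed
motion. -/
theorem eventually_eq_mul_of_rollsAt {w₁ w₂ x₁ x₂ : ℝ → Plane} {M₁ M₂ : ℝ → Motion}
    {b b' : ℝ → ℝ} {s₀ : ℝ} (h₁ : ∀ᶠ s in 𝓝 s₀, RollsAt w₁ x₁ M₁ s)
    (h₂ : ∀ᶠ s in 𝓝 (b s₀), RollsAt w₂ x₂ M₂ s) (hb : ∀ᶠ s in 𝓝 s₀, HasDerivAt b (b' s) s)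
    (hw : ∀ᶠ s in 𝓝 s₀, w₁ s = b' s • w₂ (b s))
    (hx : ∀ᶠ s in 𝓝 s₀, spin (w₁ s) (planeIncl (x₂ (b s) - x₁ s)) = 0) :
    ∃ g : Motion, ∀ᶠ s in 𝓝 s₀, M₁ s = g * M₂ (b s) := by
  have h₂' := hb.self_of_nhds.continuousAt.eventually h₂
  set g : Motion := M₁ s₀ * (M₂ (b s₀))⁻¹ with hg
  have hg1 : g * M₂ (b s₀) = M₁ s₀ := by rw [hg]; group
  have hlinD : ∀ᶠ s in 𝓝 s₀,
      HasDerivAt (fun z => (M₁ z).lin * star ((M₂ (b z)).lin)) 0 s := by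
    filter_upwards [h₁, h₂', hb, hw] with s h1 h2 h3 h4
    have h5 : HasDerivAt (fun z => (M₂ (b z)).lin) ((M₂ (b s)).lin * spin (w₁ s)) s := by
      refine (h2.lin.scomp s h3).congr_deriv ?_
      rw [h4, map_smul]
      exact (Algebra.mul_smul_comm _ _ _).symm
    exact (h1.lin.mul h5.star).congr_deriv (mul_mul_star_add_eq_zero (star_spin _) _ _)
  have hlin : ∀ᶠ s in 𝓝 s₀, (M₁ s).lin = g.lin * (M₂ (b s)).lin := by
    filter_upwards [eventually_eq_of_eventually_hasDerivAt_zero hlinD] with s hs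
    have h6 : (M₁ s₀).lin * star ((M₂ (b s₀)).lin) = g.lin := by
      rw [← hg1, Motion.lin_mul, mul_assoc, Motion.lin_mul_star, mul_one]
    rw [← h6, ← hs, mul_assoc, Motion.star_lin_mul, mul_one]
  have hzeroD : ∀ᶠ s in 𝓝 s₀, HasDerivAt (fun z => M₁ z 0 - g.lin (M₂ (b z) 0)) 0 s := by
    filter_upwards [h₁, h₂', hb, hw, hx, hlin] with s h1 h2 h3 h4 h5 h6
    have h7 : HasDerivAt (fun z => M₂ (b z) 0)
        (b' s • -((M₂ (b s)).lin (spin (w₂ (b s)) (planeIncl (x₂ (b s)))))) s :=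
      h2.zero.scomp s h3
    refine (h1.zero.sub (g.lin.hasFDerivAt.comp_hasDerivAt s h7)).congr_deriv ?_
    have h8 : ∀ y, g.lin ((M₂ (b s)).lin y) = (M₁ s).lin y := fun y => by rw [h6]; rfl
    have h9 : ∀ y, b' s • spin (w₂ (b s)) y = spin (w₁ s) y := fun y => by
      rw [h4, map_smul]; rfl
    rw [map_smul, map_neg, h8, smul_neg, ← map_smul, h9, sub_neg_eq_add, neg_add_eq_sub,
      ← map_sub, ← map_sub, ← map_sub, h5, map_zero]
  refine ⟨g, ?_⟩
  filter_upwards [hlin, eventually_eq_of_eventually_hasDerivAt_zero hzeroD] with s h1 h2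
  refine Motion.ext_lin h1 ?_
  have h3 : M₁ s₀ 0 = g.lin (M₂ (b s₀) 0) + g 0 := by
    rw [← hg1]; exact Motion.apply_eq g _
  rw [h3, add_sub_cancel_left, sub_eq_iff_eq_add, add_comm] at h2
  rw [h2]
  exact (Motion.apply_eq g _).symm

/-! ### Rotation about the tangent of a crease -/

/-- The rotation by the angle `ρ` about the axis spanned by the horizontal unit vector `t`. -/
noncomputable def axisRot (t : Plane) (ρ : ℝ) : Space →L[ℝ] Space :=
  matOp (!![t 0, -(t 1), 0; t 1, t 0, 0; 0, 0, 1] *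
    !![1, 0, 0; 0, Real.cos ρ, -Real.sin ρ; 0, Real.sin ρ, Real.cos ρ] *
    !![t 0, t 1, 0; -(t 1), t 0, 0; 0, 0, 1])

theorem axisRot_mul_star {t : Plane} (ht : ‖t‖ = 1) (ρ : ℝ) :
    axisRot t ρ * star (axisRot t ρ) = 1 := by
  have h : t 0 * t 0 + t 1 * t 1 = 1 := by
    rw [← Plane.inner_eq, real_inner_self_eq_norm_sq, ht, one_pow]
  have h2 := Real.cos_sq_add_sin_sq ρ
  have hF : !![t 0, t 1, 0; -(t 1), t 0, 0; 0, 0, 1] * !![t 0, -(t 1), 0; t 1, t 0, 0; 0, 0, 1] =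
      (1 : Matrix (Fin 3) (Fin 3) ℝ) := by
    ext i j; fin_cases i <;> fin_cases j <;> simp [Matrix.mul_apply, Fin.sum_univ_three] <;>
      first | ring1 | linear_combination h
  have hF' := mul_eq_one_comm.1 hF
  have hR : !![1, 0, 0; 0, Real.cos ρ, -Real.sin ρ; 0, Real.sin ρ, Real.cos ρ] *
      !![1, 0, 0; 0, Real.cos ρ, Real.sin ρ; 0, -Real.sin ρ, Real.cos ρ] =
      (1 : Matrix (Fin 3) (Fin 3) ℝ) := by
    ext i j; fin_cases i <;> fin_cases j <;> simp [Matrix.mul_apply, Fin.sum_univ_three] <;>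
      first | ring1 | linear_combination h2
  have hFt : (!![t 0, -(t 1), 0; t 1, t 0, 0; 0, 0, 1] : Matrix (Fin 3) (Fin 3) ℝ).transpose =
      !![t 0, t 1, 0; -(t 1), t 0, 0; 0, 0, 1] := by
    ext i j; fin_cases i <;> fin_cases j <;> rfl
  have hGt : (!![t 0, t 1, 0; -(t 1), t 0, 0; 0, 0, 1] : Matrix (Fin 3) (Fin 3) ℝ).transpose =
      !![t 0, -(t 1), 0; t 1, t 0, 0; 0, 0, 1] := by
    ext i j; fin_cases i <;> fin_cases j <;> rfl
  have hRt : (!![1, 0, 0; 0, Real.cos ρ, -Real.sin ρ; 0, Real.sin ρ, Real.cos ρ] :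
      Matrix (Fin 3) (Fin 3) ℝ).transpose =
      !![1, 0, 0; 0, Real.cos ρ, Real.sin ρ; 0, -Real.sin ρ, Real.cos ρ] := by
    ext i j; fin_cases i <;> fin_cases j <;> rfl
  rw [axisRot, star_matOp, Matrix.transpose_mul, Matrix.transpose_mul, hFt, hGt, hRt, matOp,
    ← map_mul, ← map_one (Matrix.toEuclideanCLM (𝕜 := ℝ) (n := Fin 3))]
  congr 1
  simp only [← mul_assoc]
  rw [mul_assoc (_ * _) _ (!![t 0, -(t 1), 0; t 1, t 0, 0; 0, 0, 1]), hF, mul_one,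
    mul_assoc (!![t 0, -(t 1), 0; t 1, t 0, 0; 0, 0, 1]), hR, mul_one, hF']

theorem axisRot_axis {t : Plane} (ht : ‖t‖ = 1) (ρ : ℝ) :
    axisRot t ρ (planeIncl t) = planeIncl t := by
  have h : t 0 * t 0 + t 1 * t 1 = 1 := by
    rw [← Plane.inner_eq, real_inner_self_eq_norm_sq, ht, one_pow]
  ext k
  rw [axisRot, matOp_apply, planeIncl_apply]
  fin_cases k <;> simp [Matrix.mul_apply, Fin.sum_univ_three]
  · linear_combination (t 0) * h
  · linear_combination (t 1) * h
  · ring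

/-- The height of the image of the left normal under the rotation about the tangent. -/
theorem axisRot_turnLeft_two {t : Plane} (ht : ‖t‖ = 1) (ρ : ℝ) :
    axisRot t ρ (planeIncl (turnLeft t)) 2 = Real.sin ρ := by
  have h : t 0 * t 0 + t 1 * t 1 = 1 := by
    rw [← Plane.inner_eq, real_inner_self_eq_norm_sq, ht, one_pow]
  rw [axisRot, matOp_apply, planeIncl_apply]
  simp [Matrix.mul_apply, Fin.sum_univ_three]
  linear_combination (Real.sin ρ) * h

/-- How the rotation about the tangent of a curve changes along the curve: if the angle satisfies
the ruling equation, it turns the angular velocity of the left rolling into that of the right. -/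
theorem hasDerivAt_axisRot {t : ℝ → Plane} {ρ : ℝ → ℝ} {s k cL cR : ℝ}
    (hnorm : ‖t s‖ = 1) (ht : HasDerivAt t (k • turnLeft (t s)) s)
    (hρ : HasDerivAt ρ (k * Real.tan (ρ s / 2) * (cL + cR)) s) (hc : Real.cos (ρ s / 2) ≠ 0) :
    HasDerivAt (fun z => axisRot (t z) (ρ z))
      (axisRot (t s) (ρ s) * spin ((k * Real.tan (ρ s / 2)) • (cR • t s + turnLeft (t s))) +
        spin ((k * Real.tan (ρ s / 2)) • (cL • t s + turnLeft (t s))) * axisRot (t s) (ρ s)) s := by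
  have h : t s 0 * t s 0 + t s 1 * t s 1 = 1 := by
    rw [← Plane.inner_eq, real_inner_self_eq_norm_sq, hnorm, one_pow]
  have ht0 : HasDerivAt (fun z => t z 0) (-(k * t s 1)) s := by
    have := (EuclideanSpace.proj (𝕜 := ℝ) 0 : Plane →L[ℝ] ℝ).hasFDerivAt.comp_hasDerivAt s ht
    refine this.congr_deriv ?_
    simp [turnLeft]
  have ht1 : HasDerivAt (fun z => t z 1) (k * t s 0) s := by
    have := (EuclideanSpace.proj (𝕜 := ℝ) 1 : Plane →L[ℝ] ℝ).hasFDerivAt.comp_hasDerivAt s ht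
    refine this.congr_deriv ?_
    simp [turnLeft]
  set T := Real.tan (ρ s / 2) with hT
  set c := Real.cos (ρ s) with hcd
  set d := Real.sin (ρ s) with hdd
  set a := t s 0 with ha
  set b := t s 1 with hb
  have hcos : c = 2 * Real.cos (ρ s / 2) ^ 2 - 1 := by
    rw [hcd, ← Real.cos_two_mul]; congr 1; ring
  have hsin : d = 2 * Real.sin (ρ s / 2) * Real.cos (ρ s / 2) := by
    rw [hdd, ← Real.sin_two_mul]; congr 1; ring
  have hTc : T * Real.cos (ρ s / 2) = Real.sin (ρ s / 2) := Real.tan_mul_cos hc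
  have h1 : d = T * (1 + c) := by
    rw [hcos, hsin, ← hTc]; ring
  have h2 : d * T = 1 - c := by
    have h3 := Real.sin_sq_add_cos_sq (ρ s / 2)
    rw [hsin, hcos]
    linear_combination 2 * Real.sin (ρ s / 2) * hTc + 2 * h3
  have hFd : HasDerivAt (fun z => matOp !![t z 0, -(t z 1), 0; t z 1, t z 0, 0; 0, 0, 1])
      (matOp !![-(k * b), -(k * a), 0; k * a, -(k * b), 0; 0, 0, 0]) s := by
    refine hasDerivAt_matOp fun i j => ?_
    fin_cases i <;> fin_cases j <;>
      first | exact ht0 | exact ht1 | exact ht1.neg | exact hasDerivAt_const _ _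
  have hGd : HasDerivAt (fun z => matOp !![t z 0, t z 1, 0; -(t z 1), t z 0, 0; 0, 0, 1])
      (matOp !![-(k * b), k * a, 0; -(k * a), -(k * b), 0; 0, 0, 0]) s := by
    refine hasDerivAt_matOp fun i j => ?_
    fin_cases i <;> fin_cases j <;>
      first | exact ht0 | exact ht1 | exact ht1.neg | exact hasDerivAt_const _ _
  have hRd : HasDerivAt (fun z => matOp !![1, 0, 0; 0, Real.cos (ρ z), -Real.sin (ρ z);
      0, Real.sin (ρ z), Real.cos (ρ z)])
      (matOp !![0, 0, 0; 0, -d * (k * T * (cL + cR)), -(c * (k * T * (cL + cR)));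
        0, c * (k * T * (cL + cR)), -d * (k * T * (cL + cR))]) s := by
    refine hasDerivAt_matOp fun i j => ?_
    fin_cases i <;> fin_cases j <;>
      first | exact hρ.cos | exact hρ.sin | exact hρ.sin.neg | exact hasDerivAt_const _ _
  have key := (hFd.mul hRd).mul hGd
  have hfun : (fun z => axisRot (t z) (ρ z)) = ((fun z => matOp !![t z 0, -(t z 1), 0;
      t z 1, t z 0, 0; 0, 0, 1]) * (fun z => matOp !![1, 0, 0; 0, Real.cos (ρ z), -Real.sin (ρ z);
      0, Real.sin (ρ z), Real.cos (ρ z)])) * fun z => matOp !![t z 0, t z 1, 0; -(t z 1), t z 0, 0;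
      0, 0, 1] := by
    funext z
    simp only [axisRot, matOp, map_mul, Pi.mul_apply]
  rw [hfun]
  refine key.congr_deriv ?_
  simp only [axisRot, spin_apply, Pi.mul_apply, matOp, ← map_mul, ← map_add]
  congr 1
  -- All matrices are conjugated to the frame of the tangent, the left normal and the vertical.
  set F : Matrix (Fin 3) (Fin 3) ℝ := !![a, -b, 0; b, a, 0; 0, 0, 1] with hF
  set G : Matrix (Fin 3) (Fin 3) ℝ := !![a, b, 0; -b, a, 0; 0, 0, 1] with hG
  set R : Matrix (Fin 3) (Fin 3) ℝ := !![1, 0, 0; 0, c, -d; 0, d, c] with hR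
  set R' : Matrix (Fin 3) (Fin 3) ℝ := !![0, 0, 0;
    0, -d * (k * T * (cL + cR)), -(c * (k * T * (cL + cR)));
    0, c * (k * T * (cL + cR)), -d * (k * T * (cL + cR))] with hR'
  set J : Matrix (Fin 3) (Fin 3) ℝ := !![0, -k, 0; k, 0, 0; 0, 0, 0] with hJ
  have hspin : ∀ q : ℝ, ∀ w : Plane, w = (k * T) • (q • t s + turnLeft (t s)) →
      (!![0, 0, w 1; 0, 0, -(w 0); -(w 1), w 0, 0] : Matrix (Fin 3) (Fin 3) ℝ) =
        F * !![0, 0, k * T; 0, 0, -(k * T * q); -(k * T), k * T * q, 0] * G := by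
    rintro q w rfl
    ext i j; fin_cases i <;> fin_cases j <;>
      simp [hF, hG, Matrix.mul_apply, Fin.sum_univ_three, ← ha, ← hb] <;> ring
  have hGF : G * F = 1 := by
    ext i j; fin_cases i <;> fin_cases j <;>
      simp [hF, hG, Matrix.mul_apply, Fin.sum_univ_three] <;>
      first | ring1 | linear_combination h
  have hFJ : (!![-(k * b), -(k * a), 0; k * a, -(k * b), 0; 0, 0, 0] :
      Matrix (Fin 3) (Fin 3) ℝ) = F * J := by
    ext i j; fin_cases i <;> fin_cases j <;>
      simp [hF, hJ, Matrix.mul_apply, Fin.sum_univ_three] <;> ring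
  have hJG : (!![-(k * b), k * a, 0; -(k * a), -(k * b), 0; 0, 0, 0] :
      Matrix (Fin 3) (Fin 3) ℝ) = -(J * G) := by
    ext i j; fin_cases i <;> fin_cases j <;>
      simp [hG, hJ]
  rw [hspin cL _ rfl, hspin cR _ rfl, hFJ, hJG]
  have hbody : J * R + R' - R * J =
      R * !![0, 0, k * T; 0, 0, -(k * T * cR); -(k * T), k * T * cR, 0] +
        !![0, 0, k * T; 0, 0, -(k * T * cL); -(k * T), k * T * cL, 0] * R := by
    ext i j; fin_cases i <;> fin_cases j <;>
      simp [hR, hR', hJ] <;>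
      first | ring1 | linear_combination k * h1 | linear_combination k * h2 |
        linear_combination -k * h1 | linear_combination -k * h2
  have e1 : (F * J * R + F * R') * G + F * R * -(J * G) = F * (J * R + R' - R * J) * G := by
    noncomm_ring
  have e2 : ∀ X Y : Matrix (Fin 3) (Fin 3) ℝ, F * R * G * (F * X * G) + F * Y * G * (F * R * G) =
      F * (R * X + Y * R) * G := by
    intro X Y
    calc _ = F * R * (G * F) * X * G + F * Y * (G * F) * R * G := by noncomm_ring
      _ = _ := by rw [hGF]; noncomm_ring
  rw [e1, e2, hbody]

theorem spin_smul_planeIncl_smul_self (a b : ℝ) (w : Plane) :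
    spin (a • w) (planeIncl (b • w)) = 0 := by
  rw [map_smul, map_smul, map_smul]
  change b • a • spin w (planeIncl w) = 0
  rw [spin_planeIncl_self, smul_zero, smul_zero]

/-- A rolling motion, followed in body coordinates by rotations `A` about axes that touch the curve
of contact points, is again a rolling motion. -/
theorem RollsAt.mul_mk {w w' x : ℝ → Plane} {M : ℝ → Motion} {A : ℝ → Space →L[ℝ] Space} {s : ℝ}
    {t : Plane} (hM : RollsAt w x M s)
    (hA : HasDerivAt A (A s * spin (w' s) + spin (-(w s)) * A s) s) (hx : HasDerivAt x t s)
    (hfix : A s (planeIncl t) = planeIncl t) (hAA : ∀ᶠ z in 𝓝 s, A z * star (A z) = 1) :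
    RollsAt w' x
      (fun z => M z * Motion.mk (A z) (planeIncl (x z) - A z (planeIncl (x z)))) s := by
  have hA0 := hAA.self_of_nhds
  constructor
  · rw [Motion.lin_mul, Motion.lin_mk hA0]
    refine HasDerivAt.congr_of_eventuallyEq (f := fun z => (M z).lin * A z) ?_
      (hAA.mono fun z hz => by simp only [Motion.lin_mul, Motion.lin_mk hz])
    refine (hM.lin.mul hA).congr_deriv ?_
    rw [map_neg]
    exact (fun {R : Type} [Ring R] (m a b c : R) =>
      (by noncomm_ring : m * b * a + m * (a * c + -b * a) = m * a * c)) _ _ _ _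
  · rw [Motion.lin_mul, Motion.lin_mk hA0]
    have hxι : HasDerivAt (fun z => planeIncl (x z)) (planeIncl t) s :=
      planeIncl.hasFDerivAt.comp_hasDerivAt s hx
    refine HasDerivAt.congr_of_eventuallyEq
      (f := fun z => (M z).lin (planeIncl (x z) - A z (planeIncl (x z))) + M z 0) ?_
      (hAA.mono fun z hz => ?_)
    · refine ((hM.lin.clm_apply (hxι.sub (hA.clm_apply hxι))).add hM.zero).congr_deriv ?_
      rw [map_neg, hfix]
      change (M s).lin (spin (w s) (planeIncl (x s) - A s (planeIncl (x s)))) +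
        (M s).lin (planeIncl t - (A s (spin (w' s) (planeIncl (x s))) +
          -spin (w s) (A s (planeIncl (x s))) + planeIncl t)) +
          -(M s).lin (spin (w s) (planeIncl (x s))) =
        -(M s).lin (A s (spin (w' s) (planeIncl (x s))))
      simp only [map_sub, map_add, map_neg]
      abel
    · change M z (Motion.mk (A z) (planeIncl (x z) - A z (planeIncl (x z))) 0) = _
      rw [Motion.mk_zero hz]
      exact Motion.apply_eq _ _

namespace CreaseRulePattern

variable {ι : Type*} {P : CreaseRulePattern ι} {ρ : ι → ℝ → ℝ} {i j : ι} {σ τ : Side}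
  {s u v : ℝ} {p : Plane} {F F' : Plane → Motion}

/-! ### The rolling of a face along its rule lines -/

/-- The angular velocity, per unit of arc length along the crease, with which the tangent plane of
a folded state with fold angles `ρ` turns about the rule lines on one side of a crease. -/
noncomputable def ruleSpin (P : CreaseRulePattern ι) (ρ : ι → ℝ → ℝ) (i : ι) (σ : Side) (s : ℝ) :
    Plane :=
  (-(σ.dir * P.curvature i s * Real.tan (ρ i s / 2) / Real.sin (P.angle i σ s))) •
    P.ruleDir i σ s

theorem ruleSpin_eq (hs : s ∈ Ioo 0 (P.len i)) : P.ruleSpin ρ i σ s =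
    (-(σ.dir * P.curvature i s * Real.tan (ρ i s / 2))) •
      (Real.cot (P.angle i σ s) • P.tangent i s + P.normal i s) := by
  have h := (P.sin_angle_pos σ hs).ne'
  rw [ruleSpin, ruleDir, Real.cot_eq_cos_div_sin, smul_add, smul_add, smul_smul, smul_smul,
    smul_smul]
  congr 2 <;> field_simp

theorem IsFoldAngleAssignment.cos_ne_zero (h : P.IsFoldAngleAssignment ρ)
    (hs : s ∈ Ioo 0 (P.len i)) : Real.cos (ρ i s / 2) ≠ 0 := by
  have h1 := h.mem i s hs
  exact (Real.cos_pos_of_mem_Ioo ⟨by linarith [h1.1], by linarith [h1.2]⟩).ne'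

theorem IsFoldAngleAssignment.sin_half_ne_zero (h : P.IsFoldAngleAssignment ρ)
    (hs : s ∈ Ioo 0 (P.len i)) : Real.sin (ρ i s / 2) ≠ 0 := by
  have h1 := h.mem i s hs
  intro h2
  rw [Real.sin_eq_zero_iff_of_lt_of_lt (by linarith [h1.1, Real.pi_pos])
    (by linarith [h1.2, Real.pi_pos])] at h2
  exact h.ne_zero i s hs (by linarith)

theorem IsFoldAngleAssignment.sin_ne_zero (h : P.IsFoldAngleAssignment ρ)
    (hs : s ∈ Ioo 0 (P.len i)) : Real.sin (ρ i s) ≠ 0 := by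
  have h1 := h.mem i s hs
  rw [Ne, Real.sin_eq_zero_iff_of_lt_of_lt h1.1 h1.2]
  exact h.ne_zero i s hs

theorem IsFoldAngleAssignment.continuousAt_ruleSpin (h : P.IsFoldAngleAssignment ρ)
    (hs : s ∈ Ioo 0 (P.len i)) : ContinuousAt (P.ruleSpin ρ i σ) s := by
  have h1 : ContinuousAt (fun z => Real.tan (ρ i z / 2)) s :=
    ContinuousAt.comp (g := Real.tan) (Real.continuousAt_tan.2 (h.cos_ne_zero hs))
      ((h.differentiableAt i s hs).continuousAt.div_const 2)
  have h2 : ContinuousAt (fun z => Real.sin (P.angle i σ z)) s :=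
    Real.continuous_sin.continuousAt.comp (P.contDiffAt_angle σ hs).continuousAt
  exact ((((continuousAt_const.mul (P.continuousAt_curvature hs)).mul h1).div h2
    (P.sin_angle_pos σ hs).ne').neg).smul (P.contDiffAt_ruleDir σ hs).continuousAt

/-- The ruling equation, solved for the derivative of the fold angle. -/
theorem IsFoldAngleAssignment.hasDerivAt (h : P.IsFoldAngleAssignment ρ)
    (hR : P.RulingEquation ρ) (hk : P.IsCurved) (hs : s ∈ Ioo 0 (P.len i)) :
    HasDerivAt (ρ i) (P.curvature i s * Real.tan (ρ i s / 2) *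
      (Real.cot (P.angle i Side.left s) + Real.cot (P.angle i Side.right s))) s := by
  refine (h.differentiableAt i s hs).hasDerivAt.congr_deriv ?_
  have h1 := hR i s hs
  have h2 := hk i s hs
  have h3 := h.cos_ne_zero hs
  have h4 := h.sin_half_ne_zero hs
  have h5 : Real.cot (P.angle i Side.left s) + Real.cot (P.angle i Side.right s) =
      1 / P.curvature i s * deriv (ρ i) s * Real.cot (ρ i s / 2) := by linarith
  rw [h5, Real.cot_eq_cos_div_sin, Real.tan_eq_sin_div_cos]
  field_simp

/-- The fold at a crease point: the rotation by the fold angle about the tangent line of the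
unfolded crease. -/
noncomputable def creaseTurn (P : CreaseRulePattern ι) (ρ : ι → ℝ → ℝ) (i : ι) (s : ℝ) : Motion :=
  Motion.mk (axisRot (P.tangent i s) (ρ i s))
    (planeIncl (P.crease i s) - axisRot (P.tangent i s) (ρ i s) (planeIncl (P.crease i s)))

theorem lin_creaseTurn (hs : s ∈ Ioo 0 (P.len i)) :
    (P.creaseTurn ρ i s).lin = axisRot (P.tangent i s) (ρ i s) :=
  Motion.lin_mk (axisRot_mul_star (P.norm_tangent hs) _) _

theorem creaseTurn_crease (hs : s ∈ Ioo 0 (P.len i)) :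
    P.creaseTurn ρ i s (planeIncl (P.crease i s)) = planeIncl (P.crease i s) := by
  rw [creaseTurn, Motion.mk_apply (axisRot_mul_star (P.norm_tangent hs) _), sub_add_cancel]

/-- If `M` rolls along a crease on its left side, this is the motion that rolls along the crease
on the given side. -/
noncomputable def sideMotion (P : CreaseRulePattern ι) (ρ : ι → ℝ → ℝ) (i : ι) (M : ℝ → Motion) :
    Side → ℝ → Motion
  | Side.left => M
  | Side.right => fun s => M s * P.creaseTurn ρ i s

theorem sideMotion_crease (M : ℝ → Motion) (hs : s ∈ Ioo 0 (P.len i)) :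
    P.sideMotion ρ i M σ s (planeIncl (P.crease i s)) = M s (planeIncl (P.crease i s)) := by
  cases σ
  · rfl
  · exact congrArg (M s) (creaseTurn_crease hs)

/-- The ruling equation makes the rolling motions on the two sides of a crease differ by the
fold. -/
theorem IsFoldAngleAssignment.rollsAt_sideMotion (h : P.IsFoldAngleAssignment ρ)
    (hR : P.RulingEquation ρ) (hk : P.IsCurved) (hs : s ∈ Ioo 0 (P.len i)) {M : ℝ → Motion}
    (hM : RollsAt (P.ruleSpin ρ i Side.left) (P.crease i) M s) (σ : Side) :
    RollsAt (P.ruleSpin ρ i σ) (P.crease i) (P.sideMotion ρ i M σ) s := by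
  cases σ
  · exact hM
  refine hM.mul_mk (A := fun z => axisRot (P.tangent i z) (ρ i z)) ?_ (P.hasDerivAt_crease hs)
    (axisRot_axis (P.norm_tangent hs) _)
    ((P.eventually_mem_Ioo hs).mono fun z hz => axisRot_mul_star (P.norm_tangent hz) _)
  refine (hasDerivAt_axisRot (P.norm_tangent hs) (P.hasDerivAt_tangent hs)
    (h.hasDerivAt hR hk hs) (h.cos_ne_zero hs)).congr_deriv ?_
  rw [ruleSpin_eq hs, ruleSpin_eq hs, ← neg_smul]
  simp only [Side.dir, one_mul, neg_mul, neg_neg]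
  rfl

/-- The developable surface that a rolling motion sweeps out. Its tangent plane at a point is
carried by the motion at the foot of the rule line through the point, since that motion turns
about this very line. -/
theorem hasFDerivAt_developed {E : Plane → ℝ × ℝ} {M : ℝ → Motion}
    (hE : IsLocalInverseAt (P.ruleMap i σ) (s, v) E)
    (hM : ∀ᶠ z in 𝓝 s, RollsAt (P.ruleSpin ρ i σ) (P.crease i) M z) :
    ∀ᶠ q in 𝓝 (P.ruleMap i σ (s, v)), HasFDerivAt (fun y => M (E y).1 (planeIncl y))
      ((M (E q).1).lin ∘L planeIncl) q := by
  have hfst : Tendsto (fun q => (E q).1) (𝓝 (P.ruleMap i σ (s, v))) (𝓝 s) :=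
    (continuous_fst.tendsto _).comp hE.tendsto
  filter_upwards [hE.contDiffAt.eventually (by simp), hE.right_inv, hfst.eventually hM]
    with q h1 h2 h3
  obtain ⟨L, hL⟩ : ∃ L : Plane →L[ℝ] ℝ, HasFDerivAt (fun y => (E y).1) L q :=
    ⟨_, (hasFDerivAt_fst.comp q (h1.differentiableAt (by simp)).hasFDerivAt)⟩
  have h4 : HasFDerivAt (fun y => (M (E y).1).lin)
      (L.smulRight ((M (E q).1).lin * spin (P.ruleSpin ρ i σ (E q).1))) q :=
    (HasFDerivAt.comp (g := fun z => (M z).lin) q h3.lin.hasFDerivAt hL).congr_fderiv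
      (by ext1; rfl)
  have h5 : HasFDerivAt (fun y => M (E y).1 0)
      (L.smulRight (-((M (E q).1).lin (spin (P.ruleSpin ρ i σ (E q).1)
        (planeIncl (P.crease i (E q).1)))))) q :=
    (HasFDerivAt.comp (g := fun z => M z 0) q h3.zero.hasFDerivAt hL).congr_fderiv
      (by ext1; rfl)
  have h6 := (h4.clm_apply planeIncl.hasFDerivAt).add h5
  refine (h6.congr_of_eventuallyEq (Eventually.of_forall fun y => Motion.apply_eq _ _)).congr_fderiv
    ?_
  have h7 : spin (P.ruleSpin ρ i σ (E q).1) (planeIncl q) =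
      spin (P.ruleSpin ρ i σ (E q).1) (planeIncl (P.crease i (E q).1)) := by
    rw [← sub_eq_zero, ← map_sub, ← map_sub]
    have h8 : q - P.crease i (E q).1 = (σ.dir * (E q).2) • P.ruleDir i σ (E q).1 := by
      have h9 : q = P.crease i (E q).1 + (σ.dir * (E q).2) • P.ruleDir i σ (E q).1 := h2.symm
      rw [sub_eq_iff_eq_add', ← h9]
    rw [h8]
    exact spin_smul_planeIncl_smul_self _ _ _
  ext1 w
  change (M (E q).1).lin (planeIncl w) +
    L w • (M (E q).1).lin (spin (P.ruleSpin ρ i σ (E q).1) (planeIncl q)) +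
      L w • -(M (E q).1).lin (spin (P.ruleSpin ρ i σ (E q).1)
        (planeIncl (P.crease i (E q).1))) = (M (E q).1).lin (planeIncl w)
  rw [h7, smul_neg, add_neg_cancel_right]

theorem IsFoldAngleAssignment.contDiffAt_developed (h : P.IsFoldAngleAssignment ρ)
    (hs : s ∈ Ioo 0 (P.len i)) {E : Plane → ℝ × ℝ} {M : ℝ → Motion}
    (hE : IsLocalInverseAt (P.ruleMap i σ) (s, v) E)
    (hM : ∀ᶠ z in 𝓝 s, RollsAt (P.ruleSpin ρ i σ) (P.crease i) M z) :
    ContDiffAt ℝ 2 (fun y => M (E y).1 (planeIncl y)) (P.ruleMap i σ (s, v)) := by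
  have h1 : ContDiffAt ℝ 1 (fun z => (M z).lin) s := by
    refine contDiffAt_one_of_eventually_hasDerivAt (hM.mono fun z hz => hz.lin) ?_
    filter_upwards [hM, P.eventually_mem_Ioo hs] with z h1 h2
    exact h1.lin.continuousAt.mul
      (spin.continuous.continuousAt.comp (h.continuousAt_ruleSpin h2))
  have h2 : ContDiffAt ℝ 1 (fun y => (M (E y).1).lin) (P.ruleMap i σ (s, v)) := by
    refine ContDiffAt.comp (g := fun z => (M z).lin) _ ?_ (contDiffAt_fst.comp _ hE.contDiffAt)
    rw [hE.apply_eq]; exact h1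
  have h3 : ContDiffAt ℝ 1 (fun y => (M (E y).1).lin ∘L planeIncl) (P.ruleMap i σ (s, v)) :=
    h2.clm_comp contDiffAt_const
  rw [show (2 : WithTop ℕ∞) = ((1 : ℕ) : WithTop ℕ∞) + 1 by norm_num, contDiffAt_succ_iff_hasFDerivAt]
  exact ⟨_, ⟨_, hasFDerivAt_developed hE hM, fun q hq => hq⟩,
    by exact_mod_cast h3⟩

end CreaseRulePattern

namespace CreaseRulePattern

variable {ι : Type*} {P : CreaseRulePattern ι} {ρ : ι → ℝ → ℝ} {i j : ι} {σ τ : Side}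
  {s u v w : ℝ} {p : Plane} {F F' : Plane → Motion}

/-! ### Local folded states -/

/-- Near the point with ruling coordinates `(s, v)`, the motion `F q` carries the tangent plane at
`q` of a developable surface swept out by a rolling motion. -/
def IsFaceFrame (P : CreaseRulePattern ι) (ρ : ι → ℝ → ℝ) (i : ι) (σ : Side) (s v : ℝ)
    (F : Plane → Motion) : Prop :=
  ∃ (E : Plane → ℝ × ℝ) (M : ℝ → Motion), IsLocalInverseAt (P.ruleMap i σ) (s, v) E ∧
    (∀ᶠ z in 𝓝 s, RollsAt (P.ruleSpin ρ i σ) (P.crease i) M z) ∧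
    ∀ᶠ q in 𝓝 (P.ruleMap i σ (s, v)), F q = M (E q).1

/-- Near the crease point at `s`, the motion `F q` carries the tangent plane at `q` of two
developable surfaces swept out by rolling motions, which are folded against each other along the
crease; on the crease itself, it carries the tangent plane on the left. -/
def IsCreaseFrame (P : CreaseRulePattern ι) (ρ : ι → ℝ → ℝ) (i : ι) (s : ℝ)
    (F : Plane → Motion) : Prop :=
  ∃ (E : Side → Plane → ℝ × ℝ) (M : ℝ → Motion),
    (∀ σ, IsLocalInverseAt (P.ruleMap i σ) (s, 0) (E σ)) ∧
    (∀ᶠ z in 𝓝 s, RollsAt (P.ruleSpin ρ i Side.left) (P.crease i) M z) ∧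
    ∀ᶠ q in 𝓝 (P.crease i s),
      (∀ σ, 0 < (E σ q).2 → F q = P.sideMotion ρ i M σ (E σ q).1) ∧
        ((E Side.left q).2 = 0 → F q = M (E Side.left q).1)

/-- The map `q ↦ F q q` is a folded state with fold angles `ρ` near the point `p`. -/
def FrameAt (P : CreaseRulePattern ι) (ρ : ι → ℝ → ℝ) (p : Plane) (F : Plane → Motion) : Prop :=
  (∃ i σ s v, s ∈ Ioo 0 (P.len i) ∧ v ∈ Ioo 0 (P.ruleLen i σ s) ∧ P.rulePoint i σ s v = p ∧
    P.IsFaceFrame ρ i σ s v F) ∨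
  ∃ i s, s ∈ Ioo 0 (P.len i) ∧ P.crease i s = p ∧ P.IsCreaseFrame ρ i s F

theorem IsFaceFrame.const_mul_congr (h : P.IsFaceFrame ρ i σ s v F) {g : Motion}
    (hF : ∀ᶠ q in 𝓝 (P.rulePoint i σ s v), F' q = g * F q) : P.IsFaceFrame ρ i σ s v F' := by
  obtain ⟨E, M, hE, hM, hq⟩ := h
  refine ⟨E, fun z => g * M z, hE, hM.mono fun z hz => hz.const_mul g, ?_⟩
  filter_upwards [hq, hF] with q h1 h2
  rw [h2, h1]

theorem IsCreaseFrame.const_mul_congr (h : P.IsCreaseFrame ρ i s F) {g : Motion}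
    (hF : ∀ᶠ q in 𝓝 (P.crease i s), F' q = g * F q) : P.IsCreaseFrame ρ i s F' := by
  obtain ⟨E, M, hE, hM, hq⟩ := h
  refine ⟨E, fun z => g * M z, hE, hM.mono fun z hz => hz.const_mul g, ?_⟩
  filter_upwards [hq, hF] with q h1 h2
  rw [h2]
  refine ⟨fun σ h3 => ?_, fun h3 => by rw [h1.2 h3]⟩
  rw [h1.1 σ h3]
  cases σ
  · rfl
  · exact (mul_assoc _ _ _).symm

theorem FrameAt.const_mul_congr (h : P.FrameAt ρ p F) {g : Motion}
    (hF : ∀ᶠ q in 𝓝 p, F' q = g * F q) : P.FrameAt ρ p F' := by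
  rcases h with ⟨i, σ, s, v, hs, hv, rfl, h⟩ | ⟨i, s, hs, rfl, h⟩
  · exact Or.inl ⟨i, σ, s, v, hs, hv, rfl, h.const_mul_congr hF⟩
  · exact Or.inr ⟨i, s, hs, rfl, h.const_mul_congr hF⟩

theorem IsFoldAngleAssignment.exists_rollsAt (h : P.IsFoldAngleAssignment ρ) (σ : Side)
    (hs : s ∈ Ioo 0 (P.len i)) :
    ∃ M : ℝ → Motion, ∀ᶠ z in 𝓝 s, RollsAt (P.ruleSpin ρ i σ) (P.crease i) M z := by
  refine exists_eventually_rollsAt ?_ ?_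
  · filter_upwards [P.eventually_mem_Ioo hs] with z hz using h.continuousAt_ruleSpin hz
  · filter_upwards [P.eventually_mem_Ioo hs] with z hz using (P.hasDerivAt_crease hz).continuousAt

theorem IsFoldAngleAssignment.exists_isFaceFrame [Finite ι] (h : P.IsFoldAngleAssignment ρ)
    (hr : P.IsUniquelyRuled) (hV : P.IsVertexFree) (hs : s ∈ Ioo 0 (P.len i))
    (hv : v ∈ Ioo 0 (P.ruleLen i σ s)) : ∃ F, P.IsFaceFrame ρ i σ s v F := by
  obtain ⟨E, hE⟩ := hr.exists_isLocalInverseAt hV hs hv.1.le hv.2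
  obtain ⟨M, hM⟩ := h.exists_rollsAt σ hs
  exact ⟨fun q => M (E q).1, E, M, hE, hM, Eventually.of_forall fun _ => rfl⟩

theorem IsFoldAngleAssignment.exists_isCreaseFrame (h : P.IsFoldAngleAssignment ρ)
    (hs : s ∈ Ioo 0 (P.len i)) : ∃ F, P.IsCreaseFrame ρ i s F := by
  have hE : ∀ σ, ∃ E, IsLocalInverseAt (P.ruleMap i σ) (s, 0) E := fun σ =>
    P.exists_isLocalInverseAt_ruleMap hs (P.ruleJac_zero_neg σ hs).ne
  choose E hE using hE
  obtain ⟨M, hM⟩ := h.exists_rollsAt Side.left hs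
  refine ⟨fun q => if 0 < (E Side.right q).2 then P.sideMotion ρ i M Side.right (E Side.right q).1
    else M (E Side.left q).1, E, M, hE, hM, ?_⟩
  filter_upwards [eventually_opposite_sides hs (hE Side.left) (hE Side.right)] with q hq
  refine ⟨fun σ h1 => ?_, fun h1 => ?_⟩
  · cases σ
    · rw [if_neg]; · rfl
      rcases hq with hq | hq | hq <;> linarith
    · rw [if_pos h1]
  · rw [if_neg]
    rcases hq with hq | hq | hq <;> linarith

theorem IsFoldAngleAssignment.exists_frameAt [Finite ι] (h : P.IsFoldAngleAssignment ρ)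
    (hr : P.IsUniquelyRuled) (hV : P.IsVertexFree) (hp : p ∈ P.paper) :
    ∃ F, P.FrameAt ρ p F := by
  by_cases hc : p ∈ P.creaseSet
  · obtain ⟨i, s, hs, rfl⟩ := mem_iUnion.1 hc
    obtain ⟨F, hF⟩ := h.exists_isCreaseFrame hs
    exact ⟨F, Or.inr ⟨i, s, hs, rfl, hF⟩⟩
  · obtain ⟨i, σ, s, hs, v, hv, rfl⟩ := hr.cover p ⟨hp, hc⟩
    obtain ⟨F, hF⟩ := h.exists_isFaceFrame hr hV hs hv
    exact ⟨F, Or.inl ⟨i, σ, s, v, hs, hv, rfl, hF⟩⟩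

/-- The rule segments through points near a point of a rule segment are those given by the ruling
coordinates. -/
theorem IsUniquelyRuled.eventually_mem_ruleSegment [Finite ι] (hr : P.IsUniquelyRuled)
    (hV : P.IsVertexFree) (hs : s ∈ Ioo 0 (P.len i)) (hv : v ∈ Ioo 0 (P.ruleLen i σ s))
    {E : Plane → ℝ × ℝ} (hE : IsLocalInverseAt (P.ruleMap i σ) (s, v) E) :
    ∀ᶠ q in 𝓝 (P.rulePoint i σ s v), (E q).1 ∈ Ioo 0 (P.len i) ∧
      (E q).2 ∈ Ioo 0 (P.ruleLen i σ (E q).1) ∧ P.rulePoint i σ (E q).1 (E q).2 = q := by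
  filter_upwards [hE.tendsto.eventually (hr.eventually_snd_lt_ruleLen hV hs hv.2),
    hE.tendsto.eventually ((lt_mem_nhds hv.1).prod_inr_nhds s), hE.right_inv] with q h1 h2 h3
  exact ⟨h1.1, ⟨h2, h1.2⟩, h3⟩

theorem IsFaceFrame.eventually_frameAt [Finite ι] (h : P.IsFaceFrame ρ i σ s v F)
    (hr : P.IsUniquelyRuled) (hV : P.IsVertexFree) (hs : s ∈ Ioo 0 (P.len i))
    (hv : v ∈ Ioo 0 (P.ruleLen i σ s)) :
    ∀ᶠ q in 𝓝 (P.rulePoint i σ s v), P.FrameAt ρ q F := by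
  obtain ⟨E, M, hE, hM, hF⟩ := h
  have hfst : Tendsto (fun q => (E q).1) (𝓝 (P.ruleMap i σ (s, v))) (𝓝 s) :=
    (continuous_fst.tendsto _).comp hE.tendsto
  filter_upwards [hr.eventually_mem_ruleSegment hV hs hv hE, hE.eventually,
    hfst.eventually (eventually_eventually_nhds.2 hM), eventually_eventually_nhds.2 hF]
    with q h1 h2 h3 h4
  refine Or.inl ⟨i, σ, (E q).1, (E q).2, h1.1, h1.2.1, h1.2.2, E, M, h2, h3, ?_⟩
  rw [ruleMap_mk, h1.2.2]
  exact h4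

theorem IsCreaseFrame.eventually_frameAt [Finite ι] (h : P.IsCreaseFrame ρ i s F)
    (hρ : P.IsFoldAngleAssignment ρ) (hR : P.RulingEquation ρ) (hk : P.IsCurved)
    (hr : P.IsUniquelyRuled) (hV : P.IsVertexFree) (hs : s ∈ Ioo 0 (P.len i)) :
    ∀ᶠ q in 𝓝 (P.crease i s), P.FrameAt ρ q F := by
  obtain ⟨E, M, hE, hM, hF⟩ := h
  have hside : ∀ σ, ∀ᶠ q in 𝓝 (P.crease i s), 0 < (E σ q).2 → P.FrameAt ρ q F := by
    intro σ
    have hEσ := hE σ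
    have hend := hEσ.eventually
    have htend := hEσ.tendsto
    have hright := hEσ.right_inv
    have hcont := hEσ.contDiffAt.eventually (by simp)
    rw [ruleMap_zero] at hend htend hright hcont
    have hfst : Tendsto (fun q => (E σ q).1) (𝓝 (P.crease i s)) (𝓝 s) :=
      (continuous_fst.tendsto _).comp htend
    have hroll : ∀ᶠ z in 𝓝 s,
        RollsAt (P.ruleSpin ρ i σ) (P.crease i) (P.sideMotion ρ i M σ) z := by
      filter_upwards [hM, P.eventually_mem_Ioo hs] with z h1 h2
      exact hρ.rollsAt_sideMotion hR hk h2 h1 σ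
    filter_upwards [hend, hright, hcont, eventually_eventually_nhds.2 hF,
      hfst.eventually (eventually_eventually_nhds.2 hroll),
      htend.eventually (hr.eventually_snd_lt_ruleLen hV hs (P.ruleLen_pos i σ s hs))]
      with q h1 h2 h3 h4 h5 h6 h7
    refine Or.inl ⟨i, σ, (E σ q).1, (E σ q).2, h6.1, ⟨h7, h6.2⟩, h2, E σ, _, h1, h5, ?_⟩
    change ∀ᶠ q' in 𝓝 (P.ruleMap i σ (E σ q)), _
    rw [h2]
    have h8 : ContinuousAt (fun q => (E σ q).2) q := continuousAt_snd.comp h3.continuousAt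
    filter_upwards [h4, h8.eventually (lt_mem_nhds h7)] with q' h9 h10 using h9.1 σ h10
  have hl := hE Side.left
  have hr' := hE Side.right
  have e1 := hl.eventually
  have e2 := hr'.eventually
  have e3 := hl.tendsto
  have e4 := hr'.tendsto
  have e5 := hl.right_inv
  have e6 := hr'.right_inv
  rw [ruleMap_zero] at e1 e2 e3 e4 e5 e6
  filter_upwards [hside Side.left, hside Side.right, e1, e2, e5, e6,
    e3.eventually ((P.eventually_mem_Ioo hs).prod_inl_nhds 0),
    e4.eventually ((P.eventually_mem_Ioo hs).prod_inl_nhds 0),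
    e3.eventually ((eventually_eventually_nhds.2 hM).prod_inl_nhds 0),
    eventually_eventually_nhds.2 hF, eventually_opposite_sides hs hl hr']
    with q h1 h2 h3 h4 h5 h6 h7 h8 h9 h10 h11
  rcases h11 with h11 | h11 | h11
  · exact h1 h11.1
  · have h12 : E Side.left q = ((E Side.left q).1, 0) := Prod.ext rfl h11.1
    have h13 : E Side.right q = ((E Side.right q).1, 0) := Prod.ext rfl h11.2
    rw [h12, ruleMap_zero] at h5
    rw [h13, ruleMap_zero] at h6
    have h14 : (E Side.right q).1 = (E Side.left q).1 :=
      P.crease_injOn i h8 h7 (h6.trans h5.symm)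
    rw [h14] at h13
    rw [h12] at h3
    rw [h13] at h4
    refine Or.inr ⟨i, (E Side.left q).1, h7, h5, E, M, fun σ => ?_, h9, ?_⟩
    · cases σ
      · exact h3
      · exact h4
    · rw [h5]; exact h10
  · exact h2 h11.2

theorem FrameAt.eventually [Finite ι] (h : P.FrameAt ρ p F) (hρ : P.IsFoldAngleAssignment ρ)
    (hR : P.RulingEquation ρ) (hk : P.IsCurved) (hr : P.IsUniquelyRuled) (hV : P.IsVertexFree) :
    ∀ᶠ q in 𝓝 p, P.FrameAt ρ q F := by
  rcases h with ⟨i, σ, s, v, hs, hv, rfl, h⟩ | ⟨i, s, hs, rfl, h⟩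
  · exact h.eventually_frameAt hr hV hs hv
  · exact h.eventually_frameAt hρ hR hk hr hV hs

/-! ### Uniqueness of local folded states -/

theorem IsCreaseFrame.eventually_eq_mul (h : P.IsCreaseFrame ρ i s F)
    (h' : P.IsCreaseFrame ρ i s F') (hs : s ∈ Ioo 0 (P.len i)) :
    ∃ g : Motion, ∀ᶠ q in 𝓝 (P.crease i s), F q = g * F' q := by
  obtain ⟨E, M, hE, hM, hF⟩ := h
  obtain ⟨E', M', hE', hM', hF'⟩ := h'
  obtain ⟨g, hg⟩ := eventually_eq_mul_of_rollsAt (b := id) (b' := fun _ => 1) hM hM'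
    (Eventually.of_forall fun z => hasDerivAt_id z)
    (Eventually.of_forall fun z => (one_smul ℝ _).symm)
    (Eventually.of_forall fun z => by rw [id, sub_self, map_zero, map_zero])
  refine ⟨g, ?_⟩
  have hEE : ∀ σ, ∀ᶠ q in 𝓝 (P.crease i s), E σ q = E' σ q := fun σ => by
    have := (hE σ).eventually_eq (hE' σ)
    rwa [ruleMap_zero] at this
  have htend : ∀ σ, Tendsto (fun q => (E σ q).1) (𝓝 (P.crease i s)) (𝓝 s) := fun σ => by
    have := (continuous_fst.tendsto _).comp (hE σ).tendsto
    rwa [ruleMap_zero] at this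
  filter_upwards [hF, hF', hEE Side.left, hEE Side.right, (htend Side.left).eventually hg,
    (htend Side.right).eventually hg, eventually_opposite_sides hs (hE Side.left) (hE Side.right)]
    with q h1 h2 h3 h4 h5 h6 h7
  rcases h7 with h7 | h7 | h7
  · rw [h1.1 Side.left h7.1, h2.1 Side.left (h3 ▸ h7.1), ← h3]
    exact h5
  · rw [h1.2 h7.1, h2.2 (h3 ▸ h7.1), ← h3]
    exact h5
  · rw [h1.1 Side.right h7.2, h2.1 Side.right (h4 ▸ h7.2), ← h4]
    change M (E Side.right q).1 * _ = g * (M' (E Side.right q).1 * _)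
    rw [h6, mul_assoc]; rfl

theorem IsFaceFrame.eventually_eq_mul (h : P.IsFaceFrame ρ i σ s v F)
    (h' : P.IsFaceFrame ρ i σ s v F') :
    ∃ g : Motion, ∀ᶠ q in 𝓝 (P.rulePoint i σ s v), F q = g * F' q := by
  obtain ⟨E, M, hE, hM, hF⟩ := h
  obtain ⟨E', M', hE', hM', hF'⟩ := h'
  obtain ⟨g, hg⟩ := eventually_eq_mul_of_rollsAt (b := id) (b' := fun _ => 1) hM hM'
    (Eventually.of_forall fun z => hasDerivAt_id z)
    (Eventually.of_forall fun z => (one_smul ℝ _).symm)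
    (Eventually.of_forall fun z => by rw [id, sub_self, map_zero, map_zero])
  refine ⟨g, ?_⟩
  have htend : Tendsto (fun q => (E q).1) (𝓝 (P.rulePoint i σ s v)) (𝓝 s) :=
    (continuous_fst.tendsto _).comp hE.tendsto
  filter_upwards [hF, hF', hE.eventually_eq hE', htend.eventually hg] with q h1 h2 h3 h4
  rw [h1, h2, ← h3]
  exact h4

theorem rulePoint_injective (hs : s ∈ Ioo 0 (P.len i)) (h : P.rulePoint i σ s v =
    P.rulePoint i σ s w) : v = w := by
  rw [rulePoint_eq_add_smul, rulePoint_eq_add_smul, add_right_inj, ← sub_eq_zero, ← sub_smul,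
    smul_eq_zero] at h
  rcases h with h | h
  · linarith
  · have := norm_dir_smul_ruleDir (σ := σ) hs
    rw [h, norm_zero] at this
    norm_num at this

/-- The rolling motions from the two ends of a rule segment that joins two crease points differ by
a fixed motion, by the compatibility equation. -/
theorem CompatibilityEquation.eventually_eq_mul [Finite ι] (hC : P.CompatibilityEquation ρ)
    (hr : P.IsUniquelyRuled) (hV : P.IsVertexFree) (hJ : P.Joins i σ s j τ u)
    (hv : v ∈ Ioo 0 (P.ruleLen i σ s)) (hw : w ∈ Ioo 0 (P.ruleLen j τ u))
    (hp : P.rulePoint i σ s v = P.rulePoint j τ u w)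
    (h : P.IsFaceFrame ρ i σ s v F) (h' : P.IsFaceFrame ρ j τ u w F') :
    ∃ g : Motion, ∀ᶠ q in 𝓝 (P.rulePoint i σ s v), F q = g * F' q := by
  obtain ⟨E, M, hE, hM, hF⟩ := h
  obtain ⟨E', M', hE', hM', hF'⟩ := h'
  have hs := hJ.1
  have hu := hJ.2.1
  have htend : Tendsto (fun q => (E q).1) (𝓝 (P.rulePoint i σ s v)) (𝓝 s) :=
    (continuous_fst.tendsto _).comp hE.tendsto
  have htend' : Tendsto (fun q => (E' q).1) (𝓝 (P.rulePoint i σ s v)) (𝓝 u) := by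
    rw [hp]; exact (continuous_fst.tendsto _).comp hE'.tendsto
  have hne : ¬(i = j ∧ σ = τ ∧ s = u) := by
    rintro ⟨rfl, rfl, rfl⟩
    have h1 : P.rulePoint i σ s (P.ruleLen i σ s) = P.rulePoint i σ s 0 := by
      rw [rulePoint_zero]; exact hJ.2.2.1
    exact (P.ruleLen_pos i σ s hs).ne' (rulePoint_injective hs h1)
  have hjoin : ∀ᶠ q in 𝓝 (P.rulePoint i σ s v), P.Joins i σ (E q).1 j τ (E' q).1 := by
    have h1 : ∀ᶠ q in 𝓝 (P.rulePoint i σ s v), ¬(i = j ∧ σ = τ ∧ (E q).1 = (E' q).1) := by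
      by_cases hij : i = j ∧ σ = τ
      · have h2 : s ≠ u := fun h2 => hne ⟨hij.1, hij.2, h2⟩
        filter_upwards [(htend.prodMk_nhds htend').eventually
          (isOpen_ne_fun continuous_fst continuous_snd |>.mem_nhds h2)] with q h3 h4
        exact h3 h4.2.2
      · exact Eventually.of_forall fun q h2 => hij ⟨h2.1, h2.2.1⟩
    have h2 := hr.eventually_mem_ruleSegment hV hu hw hE'
    rw [← hp] at h2
    filter_upwards [h1, hr.eventually_mem_ruleSegment hV hs hv hE, h2] with q h1 h2 h3
    refine (hr.eq_or_joins hV h2.1 h3.1 ⟨q, ⟨_, h2.2.1, h2.2.2⟩, ⟨_, h3.2.1, h3.2.2⟩⟩).resolve_left h1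
  -- `b z` is the foot on the second crease of the rule line that starts at `z` on the first one.
  set b : ℝ → ℝ := fun z => (E' (P.rulePoint i σ z v)).1 with hb
  have hcurve : ContinuousAt (fun z => P.rulePoint i σ z v) s :=
    (P.hasDerivAt_rulePoint_left σ hs v).continuousAt
  have hbs : b s = u := by
    rw [hb]; simp only [hp]; exact congrArg Prod.fst hE'.apply_eq
  have hbd : ∀ᶠ z in 𝓝 s, HasDerivAt b (deriv b z) z := by
    have h1 : ∀ᶠ q in 𝓝 (P.rulePoint i σ s v), DifferentiableAt ℝ E' q := by
      rw [hp]
      exact (hE'.contDiffAt.eventually (by simp)).mono fun q hq => hq.differentiableAt (by simp)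
    filter_upwards [hcurve.eventually h1, P.eventually_mem_Ioo hs] with z h2 h3
    exact (differentiableAt_fst.comp z
      (h2.comp z (P.hasDerivAt_rulePoint_left σ h3 v).differentiableAt)).hasDerivAt
  have hbJ : ∀ᶠ z in 𝓝 s, P.Joins i σ z j τ (b z) := by
    have h1 : Tendsto (fun z : ℝ => (z, v)) (𝓝 s) (𝓝 (s, v)) :=
      (continuous_id.prodMk continuous_const).tendsto s
    filter_upwards [hcurve.eventually hjoin, h1.eventually hE.left_inv] with z h2 h3
    rw [ruleMap_mk] at h3
    rwa [h3] at h2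
  rw [← hbs] at hM'
  obtain ⟨g, hg⟩ := eventually_eq_mul_of_rollsAt hM hM' hbd (by
    filter_upwards [hbd, eventually_eventually_nhds.2 hbJ] with z h1 h2
    have h3 := hC i σ j τ id b z differentiableAt_id h1.differentiableAt h2
    rw [deriv_id, id, one_mul] at h3
    have h4 := h2.self_of_nhds.ruleLen_eq_and_dir_eq.2
    have h5 : P.ruleDir j τ (b z) = -(τ.dir * σ.dir) • P.ruleDir i σ z := by
      rw [neg_smul, mul_smul, ← smul_neg, ← h4, smul_smul, τ.dir_mul_dir, one_smul]
    rw [ruleSpin, ruleSpin, h5, smul_smul, smul_smul]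
    congr 1
    have h6 := τ.dir_mul_dir
    linear_combination (-σ.dir) * h3 -
      deriv b z * P.curvature j (b z) * Real.tan (ρ j (b z) / 2) /
        Real.sin (P.angle j τ (b z)) * σ.dir * h6) (by
    filter_upwards [hbJ] with z h1
    have h2 : P.crease j (b z) - P.crease i z =
        (σ.dir * P.ruleLen i σ z) • P.ruleDir i σ z := by
      rw [← h1.2.2.1]; exact add_sub_cancel_left _ _
    rw [h2]
    exact spin_smul_planeIncl_smul_self _ _ _)
  refine ⟨g, ?_⟩
  rw [ruleMap_mk, ← hp] at hF'
  filter_upwards [hF, hF', hjoin, htend.eventually hg, htend.eventually hbJ] with q h1 h2 h3 h4 h5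
  have h6 : (E' q).1 = b (E q).1 :=
    P.crease_injOn j h3.2.1 h5.2.1 (h3.2.2.1.symm.trans h5.2.2.1)
  rw [h1, h2, h6]
  exact h4

/-- Two local folded states with the same fold angles differ by a rigid motion. -/
theorem FrameAt.eventually_eq_mul [Finite ι] (h : P.FrameAt ρ p F) (h' : P.FrameAt ρ p F')
    (hC : P.CompatibilityEquation ρ) (hr : P.IsUniquelyRuled) (hV : P.IsVertexFree) :
    ∃ g : Motion, ∀ᶠ q in 𝓝 p, F q = g * F' q := by
  rcases h with ⟨i, σ, s, v, hs, hv, rfl, h⟩ | ⟨i, s, hs, rfl, h⟩ <;>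
    rcases h' with ⟨j, τ, u, w, hu, hw, hp, h'⟩ | ⟨j, u, hu, hp, h'⟩
  · rcases hr.eq_or_joins hV hs hu ⟨_, ⟨v, hv, rfl⟩, ⟨w, hw, hp⟩⟩ with ⟨rfl, rfl, rfl⟩ | hJ
    · obtain rfl := rulePoint_injective hs hp
      exact h.eventually_eq_mul h'
    · exact hC.eventually_eq_mul hr hV hJ hv hw hp.symm h h'
  · have := (hr.subset_face i σ s hs (rulePoint_mem_ruleSegment hv)).2
    exact absurd (hp ▸ crease_mem_creaseSet hu) this
  · have := (hr.subset_face j τ u hu (rulePoint_mem_ruleSegment hw)).2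
    exact absurd (hp ▸ crease_mem_creaseSet hs) this
  · obtain ⟨rfl, rfl⟩ := hV.eq_of_crease_eq hu hs hp
    exact h.eventually_eq_mul h' hs

/-! ### The global folded state -/

/-- On simply connected paper, the local folded states can be moved to fit together. -/
theorem IsFoldAngleAssignment.exists_forall_frameAt [Finite ι] (hρ : P.IsFoldAngleAssignment ρ)
    (hR : P.RulingEquation ρ) (hC : P.CompatibilityEquation ρ) (hk : P.IsCurved)
    (hr : P.IsUniquelyRuled) (hV : P.IsVertexFree) (hS : P.IsHoleFree) :
    ∃ H : Plane → Motion, ∀ p ∈ P.paper, P.FrameAt ρ p H := by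
  have : SimplyConnectedSpace P.paper := hS
  have : LocallyPathConnectedSpace P.paper := P.isOpen_paper.locallyPathConnectedSpace
  have hmap : ∀ p : P.paper, map ((↑) : P.paper → Plane) (𝓝 p) = 𝓝 (p : Plane) := fun p =>
    P.isOpen_paper.isOpenEmbedding_subtypeVal.map_nhds_eq p
  choose F hF using fun p : P.paper => hρ.exists_frameAt hr hV p.2
  obtain ⟨H, hH⟩ := exists_global_of_locally_const_mul (fun p q : P.paper => F p q) (by
    intro p
    have h1 := (hF p).eventually hρ hR hk hr hV
    rw [← hmap, eventually_map] at h1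
    filter_upwards [h1] with q hq
    obtain ⟨g, hg⟩ := hq.eventually_eq_mul (hF q) hC hr hV
    rw [← hmap, eventually_map] at hg
    exact ⟨g, hg⟩)
  classical
  refine ⟨fun q => if hq : q ∈ P.paper then H ⟨q, hq⟩ else 1, fun p hp => ?_⟩
  obtain ⟨g, hg⟩ := hH ⟨p, hp⟩
  refine (hF ⟨p, hp⟩).const_mul_congr (g := g) ?_
  rw [← hmap ⟨p, hp⟩, eventually_map]
  filter_upwards [hg] with q hq
  rw [dif_pos q.2]
  exact hq

end CreaseRulePattern

namespace CreaseRulePattern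

variable {ι : Type*} {P : CreaseRulePattern ι} {ρ : ι → ℝ → ℝ} {i j : ι} {σ τ : Side}
  {s u v w : ℝ} {p : Plane} {H : Plane → Motion}

theorem FrameAt.isCreaseFrame (h : P.FrameAt ρ (P.crease i s) H) (hr : P.IsUniquelyRuled)
    (hV : P.IsVertexFree) (hs : s ∈ Ioo 0 (P.len i)) : P.IsCreaseFrame ρ i s H := by
  rcases h with ⟨j, τ, u, w, hu, hw, hp, h⟩ | ⟨j, u, hu, hp, h⟩
  · have := (hr.subset_face j τ u hu (rulePoint_mem_ruleSegment hw)).2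
    exact absurd (hp ▸ crease_mem_creaseSet hs) this
  · obtain ⟨rfl, rfl⟩ := hV.eq_of_crease_eq hu hs hp
    exact h

/-- On either side of a crease, a local folded state is the developable surface swept out by the
rolling motion of that side. -/
theorem IsCreaseFrame.exists_sideMotion (h : P.IsCreaseFrame ρ i s H)
    (hs : s ∈ Ioo 0 (P.len i)) : ∃ (E : Side → Plane → ℝ × ℝ) (M : ℝ → Motion),
      (∀ σ, IsLocalInverseAt (P.ruleMap i σ) (s, 0) (E σ)) ∧
      (∀ᶠ z in 𝓝 s, RollsAt (P.ruleSpin ρ i Side.left) (P.crease i) M z) ∧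
      (∀ σ, ∀ᶠ q in 𝓝 (P.crease i s), 0 < (E σ q).2 →
        H q = P.sideMotion ρ i M σ (E σ q).1) ∧
      ∀ σ, ∀ᶠ q in 𝓝 (P.crease i s), 0 ≤ (E σ q).2 →
        H q (planeIncl q) = P.sideMotion ρ i M σ (E σ q).1 (planeIncl q) := by
  obtain ⟨E, M, hE, hM, hH⟩ := h
  refine ⟨E, M, hE, hM, fun σ => hH.mono fun q hq => hq.1 σ, fun σ => ?_⟩
  have hI : ∀ σ, ∀ᶠ q in 𝓝 (P.crease i s),
      (E σ q).1 ∈ Ioo 0 (P.len i) ∧ P.rulePoint i σ (E σ q).1 (E σ q).2 = q := by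
    intro σ
    have h1 := (hE σ).tendsto.eventually ((P.eventually_mem_Ioo hs).prod_inl_nhds 0)
    have h2 := (hE σ).right_inv
    rw [ruleMap_zero] at h1 h2
    exact h1.and h2
  filter_upwards [hH, hI Side.left, hI σ,
    eventually_opposite_sides hs (hE Side.left) (hE Side.right)] with q h1 h2 h3 h4 h5
  rcases h5.eq_or_lt with h5 | h5
  · have h6 : (E Side.left q).2 = 0 := by
      cases σ
      · exact h5.symm
      · rcases h4 with h4 | h4 | h4 <;> linarith
    rw [h1.2 h6]
    have h7 := h2.2
    have h8 := h3.2
    rw [h6, rulePoint_zero] at h7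
    rw [← h5, rulePoint_zero] at h8
    have h9 : (E σ q).1 = (E Side.left q).1 := P.crease_injOn i h3.1 h2.1 (h8.trans h7.symm)
    rw [h9]
    have h10 := sideMotion_crease (ρ := ρ) (σ := σ) M h2.1
    rw [h7] at h10
    exact h10.symm
  · rw [h1.1 σ h5]

/-- Two maps that agree on one side of a crease, the crease included, and are differentiable at a
crease point have the same derivative there. -/
theorem fderiv_eq_of_eq_on_side {f g : Plane → Space} {A B : Plane →L[ℝ] Space}
    (hs : s ∈ Ioo 0 (P.len i)) (hf : HasFDerivAt f A (P.crease i s))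
    (hg : HasFDerivAt g B (P.crease i s)) (σ : Side)
    (h : ∀ᶠ z : ℝ × ℝ in 𝓝 (s, 0), 0 ≤ z.2 → f (P.ruleMap i σ z) = g (P.ruleMap i σ z)) :
    A = B := by
  have ht : A (P.tangent i s) = B (P.tangent i s) := by
    refine (hf.comp_hasDerivAt s (P.hasDerivAt_crease hs)).unique
      ((hg.comp_hasDerivAt s (P.hasDerivAt_crease hs)).congr_of_eventuallyEq ?_)
    have h1 : Tendsto (fun x : ℝ => (x, (0 : ℝ))) (𝓝 s) (𝓝 (s, 0)) :=
      (continuous_id.prodMk continuous_const).tendsto s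
    filter_upwards [h1.eventually h] with x hx
    have h2 := hx le_rfl
    rwa [ruleMap_zero] at h2
  have hd : A (σ.dir • P.ruleDir i σ s) = B (σ.dir • P.ruleDir i σ s) := by
    have hr := P.hasDerivAt_rulePoint_right i σ s 0
    rw [← rulePoint_zero (P := P) (i := i) (σ := σ)] at hf hg
    have hA := (hf.comp_hasDerivAt (0 : ℝ) hr).hasDerivWithinAt (s := Ici 0)
    have hB := (hg.comp_hasDerivAt (0 : ℝ) hr).hasDerivWithinAt (s := Ici 0)
    have h1 : Tendsto (fun x : ℝ => (s, x)) (𝓝 0) (𝓝 (s, 0)) :=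
      (continuous_const.prodMk continuous_id).tendsto 0
    have h2 : ∀ᶠ x in 𝓝[Ici 0] (0 : ℝ), (f ∘ P.rulePoint i σ s) x = (g ∘ P.rulePoint i σ s) x := by
      filter_upwards [nhdsWithin_le_nhds (h1.eventually h), self_mem_nhdsWithin] with x h3 h4
      exact h3 h4
    exact UniqueDiffWithinAt.eq_deriv _ (uniqueDiffWithinAt_Ici 0) hA
      (hB.congr_of_eventuallyEq h2 (h1.eventually h |>.self_of_nhds le_rfl))
  have hn : A (P.normal i s) = B (P.normal i s) := by
    rw [map_smul, map_smul, smul_right_inj σ.dir_ne_zero, ruleDir, map_add, map_add, map_smul,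
      map_smul, map_smul, map_smul, ht, add_right_inj,
      smul_right_inj (P.sin_angle_pos σ hs).ne'] at hd
    exact hd
  ext1 y
  have hy := eq_inner_smul_add_inner_turnLeft_smul (P.norm_tangent hs) y
  rw [hy, map_add, map_add, map_smul, map_smul, map_smul, map_smul, ht]
  congr 2

/-- The motions that carry the tangent planes of a folded state are constant along each rule
segment. -/
theorem motion_eq_of_mem_ruleSegment [Finite ι] (hρ : P.IsFoldAngleAssignment ρ)
    (hC : P.CompatibilityEquation ρ) (hr : P.IsUniquelyRuled) (hV : P.IsVertexFree)
    (hH : ∀ p ∈ P.paper, P.FrameAt ρ p H) (hs : s ∈ Ioo 0 (P.len i))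
    (hv : v ∈ Ioo 0 (P.ruleLen i σ s)) (hw : w ∈ Ioo 0 (P.ruleLen i σ s)) :
    H (P.rulePoint i σ s v) = H (P.rulePoint i σ s w) := by
  have hloc : ∀ x ∈ Ioo 0 (P.ruleLen i σ s),
      ∀ᶠ y in 𝓝 x, H (P.rulePoint i σ s x) = H (P.rulePoint i σ s y) := by
    intro x hx
    have hmem := hr.subset_face i σ s hs (rulePoint_mem_ruleSegment hx)
    obtain ⟨F, hF⟩ := hρ.exists_isFaceFrame hr hV hs hx
    obtain ⟨g, hg⟩ := (hH _ hmem.1).eventually_eq_mul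
      (Or.inl ⟨i, σ, s, x, hs, hx, rfl, hF⟩) hC hr hV
    obtain ⟨E, M, hE, -, hFM⟩ := hF
    have h1 : Tendsto (fun y : ℝ => (s, y)) (𝓝 x) (𝓝 (s, x)) :=
      (continuous_const.prodMk continuous_id).tendsto x
    have h2 := (P.hasDerivAt_rulePoint_right i σ s x).continuousAt
    have h3 : ∀ᶠ y in 𝓝 x, H (P.rulePoint i σ s y) = g * M s := by
      filter_upwards [h1.eventually hE.left_inv, h2.eventually hFM, h2.eventually hg]
        with y h4 h5 h6
      rw [ruleMap_mk] at h4
      rw [h6, h5, h4]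
    have h4 := h3.self_of_nhds
    filter_upwards [h3] with y h5
    rw [h4, h5]
  refine isPreconnected_Ioo.induction₂ (fun x y => H (P.rulePoint i σ s x) =
    H (P.rulePoint i σ s y)) (fun x hx => nhdsWithin_le_nhds (hloc x hx))
    (fun x y z _ _ _ h1 h2 => h1.trans h2) (fun x y _ _ h1 => h1.symm) hv hw

/-- Fold angles that satisfy the ruling equation and the compatibility equation are realized by a
folded state. -/
theorem folds_of_isFoldAngleAssignment [Finite ι] (hρ : P.IsFoldAngleAssignment ρ)
    (hR : P.RulingEquation ρ) (hC : P.CompatibilityEquation ρ) (hk : P.IsCurved)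
    (hr : P.IsUniquelyRuled) (hV : P.IsVertexFree) (hS : P.IsHoleFree) : P.Folds := by
  obtain ⟨H, hH⟩ := hρ.exists_forall_frameAt hR hC hk hr hV hS
  set f : Plane → Space := fun q => H q (planeIncl q) with hf
  -- The surface is developable near the points of the faces.
  have hface : ∀ p ∈ P.paper \ P.creaseSet, ContDiffAt ℝ 2 f p ∧
      ∃ m : Motion, HasFDerivAt f (m.lin ∘L planeIncl) p := by
    intro p hp
    rcases hH p hp.1 with ⟨i, σ, s, v, hs, hv, rfl, E, M, hE, hM, hF⟩ | ⟨i, s, hs, rfl, -⟩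
    · have h1 : f =ᶠ[𝓝 (P.ruleMap i σ (s, v))] fun y => M (E y).1 (planeIncl y) :=
        hF.mono fun q hq => by rw [hf]; simp only [hq]
      exact ⟨(hρ.contDiffAt_developed hs hE hM).congr_of_eventuallyEq h1, _,
        (hasFDerivAt_developed hE hM).self_of_nhds.congr_of_eventuallyEq h1⟩
    · exact absurd (crease_mem_creaseSet hs) hp.2
  -- Next to a crease, it agrees with a developable surface on either side.
  have hcrease : ∀ i, ∀ s ∈ Ioo 0 (P.len i), ∃ (M : ℝ → Motion) (G : Side → Plane → Space),
      (∀ σ, ContDiffAt ℝ 2 (G σ) (P.crease i s)) ∧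
      (∀ σ, HasFDerivAt (G σ) ((P.sideMotion ρ i M σ s).lin ∘L planeIncl) (P.crease i s)) ∧
      (∀ σ, ∀ᶠ z : ℝ × ℝ in 𝓝 (s, 0), 0 ≤ z.2 →
        f (P.ruleMap i σ z) = G σ (P.ruleMap i σ z)) ∧
      (∀ᶠ q in 𝓝 (P.crease i s), f q = G Side.left q ∨ f q = G Side.right q) ∧
      (∀ σ, G σ (P.crease i s) = f (P.crease i s)) ∧
      (∀ σ, P.sideMotion ρ i M σ s (planeIncl (P.crease i s)) = f (P.crease i s)) ∧
      ∀ σ, ∀ᶠ z : ℝ × ℝ in 𝓝 (s, 0), 0 < z.2 →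
        H (P.ruleMap i σ z) = P.sideMotion ρ i M σ z.1 := by
    intro i s hs
    obtain ⟨E, M, hE, hM, hpos, hnonneg⟩ := ((hH _ (P.crease_mem_paper i s hs)).isCreaseFrame
      hr hV hs).exists_sideMotion hs
    have hroll : ∀ σ, ∀ᶠ z in 𝓝 s,
        RollsAt (P.ruleSpin ρ i σ) (P.crease i) (P.sideMotion ρ i M σ) z := fun σ => by
      filter_upwards [hM, P.eventually_mem_Ioo hs] with z h1 h2
      exact hρ.rollsAt_sideMotion hR hk h2 h1 σ
    have hcont : ∀ σ, Tendsto (P.ruleMap i σ) (𝓝 (s, 0)) (𝓝 (P.crease i s)) := fun σ => by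
      have := (P.contDiffAt_ruleMap σ hs 0).continuousAt.tendsto
      rwa [ruleMap_zero] at this
    have hE0 : ∀ σ, E σ (P.crease i s) = (s, 0) := fun σ => by
      rw [← ruleMap_zero (P := P) (i := i) (σ := σ)]; exact (hE σ).apply_eq
    have hval : ∀ σ, P.sideMotion ρ i M σ s (planeIncl (P.crease i s)) = f (P.crease i s) := by
      intro σ
      have h1 := (hnonneg σ).self_of_nhds
      rw [hE0 σ] at h1
      exact (h1 le_rfl).symm
    refine ⟨M, fun σ q => P.sideMotion ρ i M σ (E σ q).1 (planeIncl q), fun σ => ?_, fun σ => ?_,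
      fun σ => ?_, ?_, fun σ => ?_, hval, fun σ => ?_⟩
    · have := hρ.contDiffAt_developed hs (hE σ) (hroll σ)
      rwa [ruleMap_zero] at this
    · have := (hasFDerivAt_developed (hE σ) (hroll σ)).self_of_nhds
      rw [ruleMap_zero] at this
      simpa only [hE0 σ] using this
    · filter_upwards [(hcont σ).eventually (hnonneg σ), (hE σ).left_inv] with z h1 h2 h3
      refine h1 ?_
      rwa [h2]
    · filter_upwards [hnonneg Side.left, hnonneg Side.right,
        eventually_opposite_sides hs (hE Side.left) (hE Side.right)] with q h1 h2 h3
      rcases h3 with h3 | h3 | h3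
      · exact Or.inl (h1 h3.1.le)
      · exact Or.inl (h1 h3.1.ge)
      · exact Or.inr (h2 h3.2.le)
    · simp only [hE0 σ]
      exact hval σ
    · filter_upwards [(hcont σ).eventually (hpos σ), (hE σ).left_inv] with z h1 h2 h3
      rw [h2] at h1
      exact h1 h3
  refine ⟨f, ?_, fun p hp => (hface p hp).1.contDiffWithinAt, ?_, ?_, ?_, ?_⟩
  · intro p hp
    by_cases hc : p ∈ P.creaseSet
    · obtain ⟨i, s, hs, rfl⟩ := mem_iUnion.1 hc
      obtain ⟨M, G, hG, -, -, hor, hval, -⟩ := hcrease i s hs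
      refine ContinuousAt.continuousWithinAt ?_
      refine Metric.continuousAt_iff'.2 fun ε hε => ?_
      filter_upwards [hor, Metric.continuousAt_iff'.1 (hG Side.left).continuousAt ε hε,
        Metric.continuousAt_iff'.1 (hG Side.right).continuousAt ε hε] with q h1 h2 h3
      rw [hval] at h2 h3
      rcases h1 with h1 | h1 <;> rwa [h1]
    · exact (hface p ⟨hp, hc⟩).1.continuousAt.continuousWithinAt
  · intro p hp w
    obtain ⟨-, m, hm⟩ := hface p hp
    rw [hm.fderiv]
    change ‖m.lin (planeIncl w)‖ = ‖w‖
    rw [Motion.norm_lin_apply, norm_planeIncl]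
  · intro i σ s hs
    obtain ⟨M, G, hG, -, hside, -⟩ := hcrease i s hs
    exact ⟨G σ, hG σ, hside σ⟩
  · intro i σ s hs
    obtain ⟨M, -, -, -, -, -, -, hval, hHM⟩ := hcrease i s hs
    have hconst : ∀ v ∈ Ioo 0 (P.ruleLen i σ s),
        H (P.rulePoint i σ s v) = P.sideMotion ρ i M σ s := by
      intro v hv
      have h1 : Tendsto (fun x : ℝ => (s, x)) (𝓝 0) (𝓝 (s, 0)) :=
        (continuous_const.prodMk continuous_id).tendsto 0
      obtain ⟨w, h2, h3⟩ := (((h1.eventually (hHM σ)).filter_mono nhdsWithin_le_nhds).and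
        (Ioo_mem_nhdsGT (P.ruleLen_pos i σ s hs))).exists
      rw [motion_eq_of_mem_ruleSegment hρ hC hr hV hH hs hv h3]
      exact h2 h3.1
    refine ⟨(P.sideMotion ρ i M σ s).lin (planeIncl (σ.dir • P.ruleDir i σ s)), ?_, fun v hv => ?_⟩
    · rw [Motion.norm_lin_apply, norm_planeIncl, norm_dir_smul_ruleDir hs]
    · rw [← hval σ, hf]
      simp only [hconst v hv]
      rw [Motion.apply_eq, Motion.apply_eq _ (planeIncl (P.crease i s)), rulePoint_eq_add_smul,
        map_add, map_add, map_smul planeIncl, map_smul]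
      abel
  · intro i s hs hdiff
    obtain ⟨M, G, -, hGd, hside, -⟩ := hcrease i s hs
    have h1 : ∀ σ, fderiv ℝ f (P.crease i s) = (P.sideMotion ρ i M σ s).lin ∘L planeIncl :=
      fun σ => fderiv_eq_of_eq_on_side hs hdiff.hasFDerivAt (hGd σ) σ (hside σ)
    have h2 := congrArg (fun L : Plane →L[ℝ] Space => L (turnLeft (P.tangent i s)))
      ((h1 Side.left).symm.trans (h1 Side.right))
    have h3 : (M s).lin (planeIncl (turnLeft (P.tangent i s))) =
        (M s).lin ((P.creaseTurn ρ i s).lin (planeIncl (turnLeft (P.tangent i s)))) := h2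
    have h4 : planeIncl (turnLeft (P.tangent i s)) =
        (P.creaseTurn ρ i s).lin (planeIncl (turnLeft (P.tangent i s))) :=
      (M s).linearIsometryEquiv.injective h3
    rw [lin_creaseTurn hs] at h4
    have h5 := congrArg (fun y : Space => y 2) h4
    simp only [axisRot_turnLeft_two (P.norm_tangent hs)] at h5
    exact hρ.sin_ne_zero hs h5.symm

end CreaseRulePattern

theorem mainTheorem3 {ι : Type*} [Finite ι] (P : CreaseRulePattern ι)
    (h_curved : P.IsCurved) (h_vertex : P.IsVertexFree) (h_ruled : P.IsUniquelyRuled)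
    (h_hole : P.IsHoleFree) :
    P.Folds ↔ ∃ ρ : ι → ℝ → ℝ,
      P.IsFoldAngleAssignment ρ ∧ P.RulingEquation ρ ∧ P.CompatibilityEquation ρ := by
  constructor
  · rintro ⟨f, hf⟩
    exact ⟨P.foldAngle f, hf.isFoldAngleAssignment h_curved h_ruled h_vertex,
      hf.rulingEquation h_curved h_ruled h_vertex,
      hf.compatibilityEquation h_curved h_ruled h_vertex⟩
  · rintro ⟨ρ, hρ, hR, hC⟩
    exact CreaseRulePattern.folds_of_isFoldAngleAssignment hρ hR hC h_curved h_ruled h_vertex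
      h_hole
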